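/- Let $K$ be a field, let $V$ be a finite-dimensional $K$-vector space and let $W=\operatorname{Hom}_K(V,K)$ be its dual. Let $S=\operatorname{Sym}(W)$ and $E=\bigwedge V$, graded so that $\operatorname{Sym}_i(W)$ has degree $i$ and $\bigwedge^j V$ has degree $-j$. Let $S\text{-mod}$ and $E\text{-mod}$ be the categories of finitely generated $\mathbb{Z}$-graded left modules over $S$ and over $E$, with the homomorphisms of degree $0$, and let $D^b(S\text{-mod})$ and $D^b(E\text{-mod})$ be their bounded derived categories. Let $(e_k)$ and $(x_k)$ be dual bases of $V$ and $W$. For a module $M$ in $S\text{-mod}$ let $\mathbf R(M)$ be the complex of graded $E$-modules whose term in cohomological degree $d$ is $\operatorname{Hom}_K(E,M_d)$, where $M_d$ is regarded as concentrated in internal degree $d$ and $(a\alpha)(b)=\alpha(ba)$ for $a,b\in E$, with differential $\alpha\mapsto[\,b\mapsto\sum_k x_k\,\alpha(e_k b)\,]$. For a module $P$ in $E\text{-mod}$ let $\mathbf L(P)$ be the complex of graded $S$-modules whose term in cohomological degree $-j$ is $S\otimes_K P_j$, where $P_j$ is regarded as concentrated in internal degree $j$, with differential $s\otimes p\mapsto\sum_k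 x_k s\otimes e_k p$. For a bounded complex $\mathbf F$ over $S\text{-mod}$ let $\mathbf R(\mathbf F)$ be the total complex of the double complex obtained by applying $\mathbf R$ to every term of $\mathbf F$, and define $\mathbf L(\mathbf G)$ in the same way for a bounded complex $\mathbf G$ over $E\text{-mod}$. Then $\mathbf R$ and $\mathbf L$ induce mutually quasi-inverse equivalences of triangulated categories $D^b(S\text{-mod})\cong D^b(E\text{-mod})$. That is, there is an equivalence of triangulated categories $\Phi\colon D^b(S\text{-mod})\to D^b(E\text{-mod})$, with a quasi-inverse $\Psi$, such that $\Phi(\mathbf F)\cong\mathbf R(\mathbf F)$ in the derived category of $E\text{-mod}$, naturally in the bounded complex $\mathbf F$ over $S\text{-mod}$, and $\Psi(\mathbf G)\cong\mathbf L(\mathbf G)$ in the derived category of $S\text{-mod}$, naturally in the bounded complex $\mathbf G$ over $E\text{-mod}$. -/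

import Mathlib

open CategoryTheory CategoryTheory.Limits
open scoped DirectSum TensorProduct

universe w w' u

namespace BGG

section Gradings

variable {K : Type u} [Field K] {M : Type u} [AddCommGroup M] [Module K M]

/-- The projection of a vector space with an internal `ℤ`-grading onto its component of degree `i`,
as an endomorphism. -/
noncomputable def component (deg : ℤ → Submodule K M) (h : DirectSum.IsInternal deg) (i : ℤ) :
    M →ₗ[K] M :=
  letI := h.chooseDecomposition
  (deg i).subtype ∘ₗ DirectSum.component K ℤ (fun i => deg i) i ∘ₗ
    (DirectSum.decomposeLinearEquiv deg).toLinearMap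

variable {deg : ℤ → Submodule K M} (h : DirectSum.IsInternal deg)

lemma component_mem (i : ℤ) (x : M) : component deg h i x ∈ deg i := by
  simp [component]

lemma component_of_mem {i : ℤ} {x : M} (hx : x ∈ deg i) : component deg h i x = x := by
  let _ := h.chooseDecomposition
  exact DirectSum.decompose_of_mem_same deg hx

lemma component_of_mem_ne {i j : ℤ} {x : M} (hx : x ∈ deg j) (hij : j ≠ i) :
    component deg h i x = 0 := by
  let _ := h.chooseDecomposition
  exact DirectSum.decompose_of_mem_ne deg hx hij

lemma exists_eq_sum_component (x : M) :
    ∃ T : Finset ℤ, x = ∑ i ∈ T, component deg h i x := by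
  classical
  let _ := h.chooseDecomposition
  exact ⟨_, (DirectSum.sum_support_decompose deg x).symm⟩

lemma mem_iff_component {i : ℤ} {x : M} : x ∈ deg i ↔ component deg h i x = x :=
  ⟨component_of_mem h, fun hx => hx ▸ component_mem h i x⟩

/-- A family of subspaces with a compatible family of projections and with sum everything is an
internal grading. -/
lemma isInternal_of_proj (p : ℤ → M →ₗ[K] M)
    (h₁ : ∀ i x, x ∈ deg i → p i x = x) (h₂ : ∀ i j x, x ∈ deg j → j ≠ i → p i x = 0)
    (h₃ : ∀ x, x ∈ iSup deg) : DirectSum.IsInternal deg := by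
  rw [DirectSum.isInternal_submodule_iff_iSupIndep_and_iSup_eq_top]
  refine ⟨fun i => ?_, eq_top_iff.2 fun x _ => h₃ x⟩
  rw [Submodule.disjoint_def]
  intro x hx hx'
  have : (⨆ (j) (_ : j ≠ i), deg j) ≤ LinearMap.ker (p i) :=
    iSup₂_le fun j hj y hy => h₂ i j y hy hj
  rw [← h₁ i x hx]
  exact this hx'

/-- A grading by `ℕ`, regarded as a grading by `ℤ` along a map `e`. -/
lemma isInternal_of_nat {𝒜 : ℕ → Submodule K M} [DirectSum.Decomposition 𝒜] (e : ℕ → ℤ)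
    (he : ∀ n, deg (e n) = 𝒜 n) (he' : ∀ i, (∀ n, e n ≠ i) → deg i = ⊥) : DirectSum.IsInternal deg := by
  classical
  have hA := DirectSum.Decomposition.isInternal 𝒜
  rw [DirectSum.isInternal_submodule_iff_iSupIndep_and_iSup_eq_top] at hA
  refine isInternal_of_proj (fun i => if hi : ∃ n, e n = i then
    (𝒜 hi.choose).subtype ∘ₗ DirectSum.component K ℕ (fun i => 𝒜 i) hi.choose ∘ₗ
    (DirectSum.decomposeLinearEquiv 𝒜).toLinearMap else 0) ?_ ?_ ?_
  · intro i x hx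
    by_cases hi : ∃ n, e n = i
    · rw [dif_pos hi]
      have hx' : x ∈ 𝒜 hi.choose := by rw [← he, hi.choose_spec]; exact hx
      exact DirectSum.decompose_of_mem_same 𝒜 hx'
    · rw [he' i (fun n hn => hi ⟨n, hn⟩), Submodule.mem_bot] at hx
      simp [hx]
  · intro i j x hx hij
    by_cases hj : ∃ n, e n = j
    · obtain ⟨m, rfl⟩ := hj
      by_cases hi : ∃ n, e n = i
      · rw [dif_pos hi]
        rw [he] at hx
        refine DirectSum.decompose_of_mem_ne 𝒜 hx ?_
        intro hm
        exact hij (by rw [hm, hi.choose_spec])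
      · rw [dif_neg hi]; rfl
    · rw [he' j (fun n hn => hj ⟨n, hn⟩), Submodule.mem_bot] at hx
      simp [hx]
  · intro x
    have : x ∈ iSup 𝒜 := by rw [hA.2]; trivial
    exact (iSup_le fun n => (he n) ▸ le_iSup deg (e n) : iSup 𝒜 ≤ iSup deg) this

end Gradings

/-! ### Finitely generated graded modules -/

section GradedModules

variable {K : Type u} [Field K] {A : Type u} [Ring A] [Algebra K A]

/-- A finitely generated `ℤ`-graded left module over a `ℤ`-graded `K`-algebra. -/
structure GrMod (𝒜 : ℤ → Submodule K A) where
  /-- the underlying module -/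
  carrier : Type u
  [addCommGroup : AddCommGroup carrier]
  [moduleBase : Module K carrier]
  [module : Module A carrier]
  [isScalarTower : IsScalarTower K A carrier]
  /-- the homogeneous component of degree `i` -/
  deg : ℤ → Submodule K carrier
  isInternal : DirectSum.IsInternal deg
  [gradedSMul : SetLike.GradedSMul 𝒜 deg]
  [finite : Module.Finite A carrier]

attribute [instance] GrMod.addCommGroup GrMod.moduleBase GrMod.module GrMod.isScalarTower
  GrMod.gradedSMul GrMod.finite

namespace GrMod

variable {𝒜 : ℤ → Submodule K A}

/-- Homomorphisms of graded modules: the linear maps that preserve degrees. -/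
def homs (M N : GrMod 𝒜) : AddSubgroup (M.carrier →ₗ[A] N.carrier) where
  carrier := {f | ∀ i, ∀ x ∈ M.deg i, f x ∈ N.deg i}
  add_mem' hf hg i x hx := add_mem (hf i x hx) (hg i x hx)
  zero_mem' i _ _ := zero_mem (N.deg i)
  neg_mem' hf i x hx := neg_mem (hf i x hx)

instance : Category (GrMod 𝒜) where
  Hom M N := homs M N
  id M := ⟨LinearMap.id, fun _ _ hx => hx⟩
  comp f g := ⟨g.1 ∘ₗ f.1, fun i x hx => g.2 i _ (f.2 i x hx)⟩

variable {M N P : GrMod 𝒜}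

/-- The morphism given by a linear map that preserves degrees. -/
def ofLin (f : M.carrier →ₗ[A] N.carrier) (hf : ∀ i, ∀ x ∈ M.deg i, f x ∈ N.deg i) : M ⟶ N :=
  ⟨f, hf⟩

/-- The linear map underlying a morphism. -/
def Hom.lin (f : M ⟶ N) : M.carrier →ₗ[A] N.carrier := f.1

lemma Hom.map_mem (f : M ⟶ N) {i : ℤ} {x : M.carrier} (hx : x ∈ M.deg i) :
    Hom.lin f x ∈ N.deg i := f.2 i x hx

lemma hom_ext {f g : M ⟶ N} (h : ∀ x, Hom.lin f x = Hom.lin g x) : f = g :=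
  Subtype.ext (LinearMap.ext h)

instance : Preadditive (GrMod 𝒜) where
  homGroup M N := inferInstanceAs (AddCommGroup (homs M N))
  add_comp _ _ _ f f' g := Subtype.ext (LinearMap.comp_add f.1 f'.1 g.1)
  comp_add _ _ _ f g g' := Subtype.ext (LinearMap.add_comp f.1 g'.1 g.1)

@[simp] lemma lin_ofLin (f : M.carrier →ₗ[A] N.carrier) (hf) :
    Hom.lin (ofLin f hf : M ⟶ N) = f := rfl
@[simp] lemma lin_id : Hom.lin (𝟙 M) = LinearMap.id := rfl
@[simp] lemma lin_comp (f : M ⟶ N) (g : N ⟶ P) : Hom.lin (f ≫ g) = Hom.lin g ∘ₗ Hom.lin f := rfl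
@[simp] lemma lin_zero : Hom.lin (0 : M ⟶ N) = 0 := rfl
@[simp] lemma lin_add (f g : M ⟶ N) : Hom.lin (f + g) = Hom.lin f + Hom.lin g := rfl

/-- The projection of a graded module onto its component of degree `i`. -/
noncomputable def proj (M : GrMod 𝒜) (i : ℤ) : M.carrier →ₗ[K] M.carrier :=
  component M.deg M.isInternal i

lemma proj_hom (f : M ⟶ N) (i : ℤ) (x : M.carrier) :
    N.proj i (Hom.lin f x) = Hom.lin f (M.proj i x) := by
  obtain ⟨T, hT⟩ := exists_eq_sum_component M.isInternal x
  have key : ∀ j, N.proj i (Hom.lin f (M.proj j x)) = Hom.lin f (M.proj i (M.proj j x)) := by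
    intro j
    have hj := component_mem M.isInternal j x
    by_cases hij : j = i
    · subst hij
      rw [proj, proj, component_of_mem N.isInternal (Hom.map_mem f hj),
        component_of_mem M.isInternal hj]
    · rw [show N.proj i (Hom.lin f (M.proj j x)) = 0 from
          component_of_mem_ne N.isInternal (Hom.map_mem f hj) hij,
        show M.proj i (M.proj j x) = 0 from
          component_of_mem_ne M.isInternal hj hij, map_zero]
  rw [hT]
  simp only [map_sum]
  exact Finset.sum_congr rfl fun j _ => key j

lemma ker_stable (f : M ⟶ N) (i : ℤ) (x : M.carrier) (hx : x ∈ LinearMap.ker (Hom.lin f)) :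
    M.proj i x ∈ LinearMap.ker (Hom.lin f) := by
  rw [LinearMap.mem_ker] at hx ⊢
  rw [← proj_hom, hx, map_zero]

lemma range_stable (f : M ⟶ N) (i : ℤ) (y : N.carrier) (hy : y ∈ LinearMap.range (Hom.lin f)) :
    N.proj i y ∈ LinearMap.range (Hom.lin f) := by
  obtain ⟨x, rfl⟩ := hy
  exact ⟨_, (proj_hom f i x).symm⟩

lemma mem_deg_of_injective (f : M ⟶ N) (hf : Function.Injective (Hom.lin f)) {i : ℤ}
    {x : M.carrier} (hx : Hom.lin f x ∈ N.deg i) : x ∈ M.deg i := by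
  rw [mem_iff_component M.isInternal]
  apply hf
  exact (proj_hom f i x).symm.trans (component_of_mem N.isInternal hx)

lemma exists_lift_of_surjective (f : M ⟶ N) (hf : Function.Surjective (Hom.lin f)) {i : ℤ}
    {y : N.carrier} (hy : y ∈ N.deg i) : ∃ x ∈ M.deg i, Hom.lin f x = y := by
  obtain ⟨x, rfl⟩ := hf y
  exact ⟨M.proj i x, component_mem M.isInternal i x,
    (proj_hom f i x).symm.trans (component_of_mem N.isInternal hy)⟩

section Noetherian

variable [IsNoetherianRing A]

set_option linter.unusedSectionVars false

/-- A graded submodule of a graded module. -/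
def sub (M : GrMod 𝒜) (N : Submodule A M.carrier) (hN : ∀ i, ∀ x ∈ N, M.proj i x ∈ N) :
    GrMod 𝒜 where
  carrier := N
  deg i := (M.deg i).comap (N.subtype.restrictScalars K)
  isInternal := by
    let p : ℤ → N →ₗ[K] N := fun i =>
      (M.proj i).restrict (p := N.restrictScalars K) (q := N.restrictScalars K) (hN i)
    have hp : ∀ i x, (p i x : M.carrier) = M.proj i x := fun i x => rfl
    refine isInternal_of_proj p ?_ ?_ ?_
    · exact fun i x hx => Subtype.ext (component_of_mem M.isInternal hx)
    · exact fun i j x hx hij => Subtype.ext (component_of_mem_ne M.isInternal hx hij)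
    · intro x
      obtain ⟨T, hT⟩ := exists_eq_sum_component M.isInternal (x : M.carrier)
      have : x = ∑ i ∈ T, p i x := by
        apply Subtype.ext
        rw [AddSubmonoidClass.coe_finsetSum]
        exact hT
      rw [this]
      exact sum_mem fun i _ => Submodule.mem_iSup_of_mem i
        (show M.proj i x ∈ M.deg i from component_mem M.isInternal i _)
  gradedSMul := ⟨fun {i j a b} ha hb =>
    (SetLike.GradedSMul.smul_mem (B := M.deg) ha hb : a • (b : M.carrier) ∈ M.deg (i +ᵥ j))⟩

/-- The quotient of a graded module by a graded submodule. -/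
def quot (M : GrMod 𝒜) (N : Submodule A M.carrier) (hN : ∀ i, ∀ x ∈ N, M.proj i x ∈ N) :
    GrMod 𝒜 where
  carrier := M.carrier ⧸ N
  deg i := (M.deg i).map (N.mkQ.restrictScalars K)
  isInternal := by
    have hN' : ∀ i, N.restrictScalars K ≤
        LinearMap.ker (N.mkQ.restrictScalars K ∘ₗ M.proj i) := by
      intro i x hx
      simpa using hN i x hx
    let p : ℤ → (M.carrier ⧸ N) →ₗ[K] (M.carrier ⧸ N) := fun i =>
      ((N.restrictScalars K).liftQ _ (hN' i)) ∘ₗ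
        (Submodule.Quotient.restrictScalarsEquiv K N).symm.toLinearMap
    have hp : ∀ i x, p i (N.mkQ x) = N.mkQ (M.proj i x) := fun i x => rfl
    refine isInternal_of_proj p ?_ ?_ ?_
    · rintro i _ ⟨x, hx, rfl⟩
      exact (hp i x).trans (congrArg N.mkQ (component_of_mem M.isInternal hx))
    · rintro i j _ ⟨x, hx, rfl⟩ hij
      refine (hp i x).trans ?_
      rw [proj, component_of_mem_ne M.isInternal hx hij, map_zero]
    · intro x
      obtain ⟨x, rfl⟩ := N.mkQ_surjective x
      obtain ⟨T, hT⟩ := exists_eq_sum_component M.isInternal x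
      rw [hT, map_sum]
      exact sum_mem fun i _ => Submodule.mem_iSup_of_mem i
        ⟨_, component_mem M.isInternal i x, rfl⟩
  gradedSMul := ⟨by
    rintro i j a _ ha ⟨x, hx, rfl⟩
    exact ⟨a • x, SetLike.GradedSMul.smul_mem (B := M.deg) ha hx, rfl⟩⟩

/-- The kernel of a morphism. -/
def ker (f : M ⟶ N) : GrMod 𝒜 := M.sub (LinearMap.ker (Hom.lin f)) (ker_stable f)

/-- The inclusion of the kernel. -/
def kerι (f : M ⟶ N) : ker f ⟶ M := ofLin (LinearMap.ker (Hom.lin f)).subtype fun _ _ hx => hx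

/-- The cokernel of a morphism. -/
def coker (f : M ⟶ N) : GrMod 𝒜 := N.quot (LinearMap.range (Hom.lin f)) (range_stable f)

/-- The projection onto the cokernel. -/
def cokerπ (f : M ⟶ N) : N ⟶ coker f :=
  ofLin (LinearMap.range (Hom.lin f)).mkQ fun _ x hx => ⟨x, hx, rfl⟩

lemma kerι_comp (f : M ⟶ N) : kerι f ≫ f = 0 := hom_ext fun x => x.2

lemma comp_cokerπ (f : M ⟶ N) : f ≫ cokerπ f = 0 :=
  hom_ext fun x => (Submodule.Quotient.mk_eq_zero _).2 ⟨x, rfl⟩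

/-- The kernel is a limit. -/
def kerIsLimit (f : M ⟶ N) : IsLimit (KernelFork.ofι (kerι f) (kerι_comp f)) :=
  KernelFork.IsLimit.ofι _ _
    (fun g hg => ofLin ((Hom.lin g).codRestrict _ fun x => congrArg (fun k => Hom.lin k x) hg)
      fun _ _ hx => Hom.map_mem g hx)
    (fun _ _ => rfl)
    (fun _ _ _ hm => hom_ext fun x => Subtype.ext (congrArg (fun k => Hom.lin k x) hm))

/-- The cokernel is a colimit. -/
def cokerIsColimit (f : M ⟶ N) : IsColimit (CokernelCofork.ofπ (cokerπ f) (comp_cokerπ f)) :=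
  CokernelCofork.IsColimit.ofπ _ _
    (fun g hg => ofLin (Submodule.liftQ _ (Hom.lin g) (by
      rintro _ ⟨x, rfl⟩
      exact congrArg (fun k => Hom.lin k x) hg)) (by
      rintro i _ ⟨x, hx, rfl⟩
      exact Hom.map_mem g hx))
    (fun _ _ => rfl)
    (fun _ _ m hm => hom_ext fun x => by
      obtain ⟨x, rfl⟩ := Submodule.mkQ_surjective _ x
      exact congrArg (fun k => Hom.lin k x) hm)

lemma injective_of_mono (f : M ⟶ N) [Mono f] : Function.Injective (Hom.lin f) := by
  have h : kerι f = 0 := by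
    rw [← cancel_mono f, kerι_comp, zero_comp]
  rw [← LinearMap.ker_eq_bot, eq_bot_iff]
  intro x hx
  exact congrArg (fun k => Hom.lin k (⟨x, hx⟩ : LinearMap.ker (Hom.lin f))) h

lemma surjective_of_epi (f : M ⟶ N) [Epi f] : Function.Surjective (Hom.lin f) := by
  have h : cokerπ f = 0 := by
    rw [← cancel_epi f, comp_cokerπ, comp_zero]
  intro x
  exact (Submodule.Quotient.mk_eq_zero _).1 (congrArg (fun k => Hom.lin k x) h)

/-- Every monomorphism is the kernel of its cokernel. -/
@[reducible]
noncomputable def normalMono (f : M ⟶ N) [Mono f] : NormalMono f where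
  Z := coker f
  g := cokerπ f
  w := comp_cokerπ f
  isLimit := by
    have inj := injective_of_mono f
    have h : ∀ {T : GrMod 𝒜} (g : T ⟶ N) (_ : g ≫ cokerπ f = 0) (x : T.carrier),
        Hom.lin g x ∈ LinearMap.range (Hom.lin f) := fun g hg x =>
      (Submodule.Quotient.mk_eq_zero _).1 (congrArg (fun k => Hom.lin k x) hg)
    have key : ∀ {T : GrMod 𝒜} (g : T ⟶ N) (hg : g ≫ cokerπ f = 0) (x : T.carrier),
        Hom.lin f ((LinearEquiv.ofInjective (Hom.lin f) inj).symm ⟨Hom.lin g x, h g hg x⟩) =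
          Hom.lin g x := fun g hg x =>
      congrArg Subtype.val ((LinearEquiv.ofInjective (Hom.lin f) inj).apply_symm_apply
        ⟨Hom.lin g x, h g hg x⟩)
    refine KernelFork.IsLimit.ofι' f _ (fun {T} g hg => ⟨ofLin
      ((LinearEquiv.ofInjective (Hom.lin f) inj).symm.toLinearMap ∘ₗ
        (Hom.lin g).codRestrict _ (h g hg)) ?_, hom_ext fun x => key g hg x⟩)
    intro i x hx
    refine mem_deg_of_injective f inj ?_
    exact (key g hg x).symm ▸ Hom.map_mem g hx

/-- Every epimorphism is the cokernel of its kernel. -/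
@[reducible]
noncomputable def normalEpi (f : M ⟶ N) [Epi f] : NormalEpi f where
  W := ker f
  g := kerι f
  w := kerι_comp f
  isColimit := by
    have surj := surjective_of_epi f
    have h : ∀ {T : GrMod 𝒜} (g : M ⟶ T) (_ : kerι f ≫ g = 0),
        LinearMap.ker (Hom.lin f) ≤ LinearMap.ker (Hom.lin g) := fun g hg x hx =>
      LinearMap.mem_ker.2 (congrArg (fun k => Hom.lin k (⟨x, hx⟩ : LinearMap.ker (Hom.lin f))) hg)
    have key : ∀ {T : GrMod 𝒜} (g : M ⟶ T) (hg : kerι f ≫ g = 0) (x : M.carrier),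
        (Submodule.liftQ _ (Hom.lin g) (h g hg))
          (((Hom.lin f).quotKerEquivOfSurjective surj).symm (Hom.lin f x)) = Hom.lin g x := by
      intro T g hg x
      have : ((Hom.lin f).quotKerEquivOfSurjective surj).symm (Hom.lin f x) =
          Submodule.Quotient.mk x := by
        rw [LinearEquiv.symm_apply_eq]
        rfl
      rw [this]
      rfl
    refine CokernelCofork.IsColimit.ofπ' f _ (fun {T} g hg => ⟨ofLin
      ((Submodule.liftQ _ (Hom.lin g) (h g hg)) ∘ₗ
        ((Hom.lin f).quotKerEquivOfSurjective surj).symm.toLinearMap) ?_,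
        hom_ext fun x => key g hg x⟩)
    intro i y hy
    obtain ⟨x, hx, rfl⟩ := exists_lift_of_surjective f surj hy
    exact (key g hg x).symm ▸ Hom.map_mem g hx

/-- The direct sum of two graded modules. -/
def prod (M N : GrMod 𝒜) : GrMod 𝒜 where
  carrier := M.carrier × N.carrier
  deg i := (M.deg i).prod (N.deg i)
  isInternal := by
    refine isInternal_of_proj (fun i => (M.proj i).prodMap (N.proj i)) ?_ ?_ ?_
    · rintro i ⟨x, y⟩ ⟨hx, hy⟩
      exact Prod.ext (component_of_mem M.isInternal hx) (component_of_mem N.isInternal hy)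
    · rintro i j ⟨x, y⟩ ⟨hx, hy⟩ hij
      exact Prod.ext (component_of_mem_ne M.isInternal hx hij)
        (component_of_mem_ne N.isInternal hy hij)
    · rintro ⟨x, y⟩
      obtain ⟨T, hT⟩ := exists_eq_sum_component M.isInternal x
      obtain ⟨T', hT'⟩ := exists_eq_sum_component N.isInternal y
      have : (x, y) = LinearMap.inl K _ _ x + LinearMap.inr K _ _ y := by simp
      rw [this, hT, hT', map_sum, map_sum]
      refine add_mem (sum_mem fun i _ => Submodule.mem_iSup_of_mem i ?_)
        (sum_mem fun i _ => Submodule.mem_iSup_of_mem i ?_)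
      · exact ⟨component_mem M.isInternal i x, zero_mem _⟩
      · exact ⟨zero_mem _, component_mem N.isInternal i y⟩
  gradedSMul := ⟨by
    rintro i j a ⟨x, y⟩ ha ⟨hx, hy⟩
    exact ⟨SetLike.GradedSMul.smul_mem (B := M.deg) ha hx,
      SetLike.GradedSMul.smul_mem (B := N.deg) ha hy⟩⟩

/-- The zero module. -/
def zero : GrMod 𝒜 where
  carrier := PUnit
  deg _ := ⊥
  isInternal := isInternal_of_proj (fun _ => 0) (fun _ _ _ => rfl) (fun _ _ _ _ _ => rfl)
    (fun _ => zero_mem _)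
  gradedSMul := ⟨by intros; exact (Submodule.mem_bot K).2 (Subsingleton.elim _ _)⟩

instance : HasZeroObject (GrMod 𝒜) :=
  ⟨zero, (IsZero.iff_id_eq_zero _).2 (hom_ext fun _ => rfl)⟩

instance : HasBinaryBiproducts (GrMod 𝒜) where
  has_binary_biproduct M N := hasBinaryBiproduct_of_total
    { pt := M.prod N
      fst := ofLin (LinearMap.fst A _ _) fun _ _ hx => hx.1
      snd := ofLin (LinearMap.snd A _ _) fun _ _ hx => hx.2
      inl := ofLin (LinearMap.inl A _ _) fun _ _ hx => ⟨hx, zero_mem _⟩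
      inr := ofLin (LinearMap.inr A _ _) fun _ _ hx => ⟨zero_mem _, hx⟩
      inl_fst := rfl
      inl_snd := rfl
      inr_fst := rfl
      inr_snd := rfl }
    (hom_ext fun x => Prod.ext (add_zero x.1) (zero_add x.2))

instance : HasFiniteProducts (GrMod 𝒜) :=
  have : HasTerminal (GrMod 𝒜) := HasZeroObject.hasTerminal
  hasFiniteProducts_of_has_binary_and_terminal

noncomputable instance : Abelian (GrMod 𝒜) where
  normalMonoOfMono f _ := ⟨normalMono f⟩
  normalEpiOfEpi f _ := ⟨normalEpi f⟩
  has_kernels := ⟨fun f => ⟨⟨_, kerIsLimit f⟩⟩⟩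
  has_cokernels := ⟨fun f => ⟨⟨_, cokerIsColimit f⟩⟩⟩

end Noetherian

end GrMod

end GradedModules

/-! ### The symmetric and the exterior algebra -/

section Algebras

variable (K : Type u) [Field K] (U : Type u) [AddCommGroup U] [Module K U]

/-- The grading of `Sym U` in which `Sym_i U` has degree `i`. -/
noncomputable def symDeg (n : ℤ) : Submodule K (SymmetricAlgebra K U) :=
  if 0 ≤ n then LinearMap.range (SymmetricAlgebra.ι K U) ^ n.toNat else ⊥

/-- The grading of `⋀ U` in which `⋀^j U` has degree `-j`. -/
noncomputable def extDeg (n : ℤ) : Submodule K (ExteriorAlgebra K U) :=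
  if n ≤ 0 then LinearMap.range (ExteriorAlgebra.ι K : U →ₗ[K] ExteriorAlgebra K U) ^ (-n).toNat
  else ⊥

/-- The map from the symmetric algebra to the direct sum of its homogeneous components. -/
noncomputable def symDecompose : SymmetricAlgebra K U →ₐ[K]
    ⨁ i : ℕ, ↥(LinearMap.range (SymmetricAlgebra.ι K U) ^ i) :=
  SymmetricAlgebra.lift (DirectSum.lof K ℕ
    (fun i => ↥(LinearMap.range (SymmetricAlgebra.ι K U) ^ i)) 1 ∘ₗ
    (SymmetricAlgebra.ι K U).codRestrict _ fun m => by
      simpa only [pow_one] using LinearMap.mem_range_self _ m)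

lemma symDecompose_ι (m : U) : symDecompose K U (SymmetricAlgebra.ι K U m) =
    DirectSum.of (fun i : ℕ => ↥(LinearMap.range (SymmetricAlgebra.ι K U) ^ i)) 1
      ⟨SymmetricAlgebra.ι K U m, by
        simpa only [pow_one] using LinearMap.mem_range_self _ m⟩ := by
  rw [symDecompose, SymmetricAlgebra.lift_ι_apply]
  rfl

lemma symDecompose_coe (i : ℕ) (x : ↥(LinearMap.range (SymmetricAlgebra.ι K U) ^ i)) :
    symDecompose K U x =
      DirectSum.of (fun i : ℕ => ↥(LinearMap.range (SymmetricAlgebra.ι K U) ^ i)) i x := by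
  obtain ⟨x, hx⟩ := x
  dsimp only
  induction hx using Submodule.pow_induction_on_left' with
  | algebraMap => simp_rw [AlgHom.commutes, DirectSum.algebraMap_apply]; rfl
  | add _ _ _ _ _ ihx ihy => simp_rw [map_add, ihx, ihy, ← map_add]; rfl
  | mem_mul _ hm _ _ _ ih =>
      obtain ⟨_, rfl⟩ := hm
      simp_rw [map_mul, ih, symDecompose_ι, DirectSum.of_mul_of]
      exact DirectSum.of_eq_of_gradedMonoid_eq (Sigma.subtype_ext (add_comm _ _) rfl)

noncomputable instance : GradedAlgebra
    (fun i : ℕ => LinearMap.range (SymmetricAlgebra.ι K U) ^ i) :=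
  GradedAlgebra.ofAlgHom _ (symDecompose K U)
    (by
      ext m
      change DirectSum.coeAlgHom _ (symDecompose K U (SymmetricAlgebra.ι K U m)) =
        SymmetricAlgebra.ι K U m
      rw [symDecompose_ι, DirectSum.coeAlgHom_of])
    (symDecompose_coe K U)

lemma symDeg_isInternal : DirectSum.IsInternal (symDeg K U) :=
  isInternal_of_nat (𝒜 := fun i : ℕ => LinearMap.range (SymmetricAlgebra.ι K U) ^ i)
    (fun n => (n : ℤ)) (fun n => by simp [symDeg]) fun i hi => by
      rw [symDeg, if_neg]
      exact fun h => hi i.toNat (Int.toNat_of_nonneg h)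

lemma extDeg_isInternal : DirectSum.IsInternal (extDeg K U) :=
  isInternal_of_nat (𝒜 := fun i : ℕ => ⋀[K]^i U)
    (fun n => -(n : ℤ)) (fun n => by simp [extDeg]) fun i hi => by
      rw [extDeg, if_neg]
      exact fun h => hi (-i).toNat (by rw [Int.toNat_of_nonneg (by omega), neg_neg])

lemma ι_mem_symDeg (x : U) : SymmetricAlgebra.ι K U x ∈ symDeg K U 1 := by
  simp [symDeg]

lemma one_mem_symDeg : (1 : SymmetricAlgebra K U) ∈ symDeg K U 0 := by
  simp [symDeg]

lemma ι_mem_extDeg (x : U) : ExteriorAlgebra.ι K x ∈ extDeg K U (-1) := by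
  simp [extDeg]

lemma symDeg_mul {i j : ℤ} {a b : SymmetricAlgebra K U} (ha : a ∈ symDeg K U i)
    (hb : b ∈ symDeg K U j) : a * b ∈ symDeg K U (i + j) := by
  unfold symDeg at *
  split_ifs at ha with hi
  · split_ifs at hb with hj
    · rw [if_pos (by omega), Int.toNat_add hi hj, pow_add]
      exact Submodule.mul_mem_mul ha hb
    · rw [Submodule.mem_bot] at hb
      simp [hb]
  · rw [Submodule.mem_bot] at ha
    simp [ha]

lemma extDeg_mul {i j : ℤ} {a b : ExteriorAlgebra K U} (ha : a ∈ extDeg K U i)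
    (hb : b ∈ extDeg K U j) : a * b ∈ extDeg K U (i + j) := by
  unfold extDeg at *
  split_ifs at ha with hi
  · split_ifs at hb with hj
    · rw [if_pos (by omega), neg_add, Int.toNat_add (by omega) (by omega), pow_add]
      exact Submodule.mul_mem_mul ha hb
    · rw [Submodule.mem_bot] at hb
      simp [hb]
  · rw [Submodule.mem_bot] at ha
    simp [ha]

variable [FiniteDimensional K U]

instance : IsNoetherianRing (SymmetricAlgebra K U) :=
  isNoetherianRing_of_ringEquiv (MvPolynomial (Fin (Module.finrank K U)) K)
    (SymmetricAlgebra.equivMvPolynomial (Module.finBasis K U)).symm.toRingEquiv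

instance : Module.Finite K (ExteriorAlgebra K U) :=
  Module.Finite.of_basis (Module.finBasis K U).ExteriorAlgebra

instance : IsNoetherianRing (ExteriorAlgebra K U) :=
  isNoetherian_of_tower K inferInstance

instance (n : ℤ) : Module.Finite K (symDeg K U n) := by
  rw [Module.Finite.iff_fg, symDeg]
  split_ifs
  · exact Submodule.FG.pow (Module.Finite.iff_fg.1 inferInstance) _
  · exact Submodule.fg_bot

end Algebras

section FiniteComponents

variable {K : Type u} [Field K] {A : Type u} [Ring A] [Algebra K A] {𝒜 : ℤ → Submodule K A}

/-- The homogeneous components of a finitely generated graded module are finite-dimensional if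
those of the algebra are. -/
lemma GrMod.finite_deg (h𝒜 : DirectSum.IsInternal 𝒜) [∀ i, Module.Finite K (𝒜 i)] (M : GrMod 𝒜)
    (j : ℤ) : Module.Finite K (M.deg j) := by
  classical
  obtain ⟨G, hG⟩ := (Module.Finite.fg_top : (⊤ : Submodule A M.carrier).FG)
  choose T hT using fun g : M.carrier => exists_eq_sum_component M.isInternal g
  let act : M.carrier → A →ₗ[K] M.carrier := fun y =>
    (LinearMap.toSpanSingleton A M.carrier y).restrictScalars K
  let B : Submodule K M.carrier :=
    ⨆ g ∈ G, ⨆ l ∈ T g, (𝒜 (j - l)).map (act (M.proj l g))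
  have hB : B.FG := Submodule.fg_biSup _ _ fun g _ => Submodule.fg_biSup _ _ fun l _ =>
    Submodule.FG.map _ (Module.Finite.iff_fg.1 inferInstance)
  have hom : ∀ (a : A) (i : ℤ), a ∈ 𝒜 i → ∀ g ∈ G, M.proj j (a • g) ∈ B := by
    intro a i ha g hg
    rw [hT g, Finset.smul_sum, map_sum]
    refine sum_mem fun l hl => ?_
    have hmem : a • M.proj l g ∈ M.deg (i + l) :=
      SetLike.GradedSMul.smul_mem (B := M.deg) ha (component_mem M.isInternal l g)
    by_cases hij : i + l = j
    · rw [show M.proj j (a • component M.deg M.isInternal l g) = a • M.proj l g from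
        component_of_mem M.isInternal (hij ▸ hmem)]
      refine Submodule.mem_iSup_of_mem g (Submodule.mem_iSup_of_mem hg
        (Submodule.mem_iSup_of_mem l (Submodule.mem_iSup_of_mem hl ⟨a, ?_, rfl⟩)))
      rwa [← hij, add_sub_cancel_right]
    · rw [show M.proj j (a • component M.deg M.isInternal l g) = 0 from
        component_of_mem_ne M.isInternal hmem hij]
      exact zero_mem _
  have hom' : ∀ (a : A), ∀ g ∈ G, M.proj j (a • g) ∈ B := by
    intro a g hg
    obtain ⟨T', hT'⟩ := exists_eq_sum_component h𝒜 a
    rw [hT', Finset.sum_smul, map_sum]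
    exact sum_mem fun i _ => hom _ i (component_mem h𝒜 i a) g hg
  have le : M.deg j ≤ B := by
    intro x hx
    have hx' : x ∈ Submodule.span A (G : Set M.carrier) := hG ▸ Submodule.mem_top
    obtain ⟨f, -, rfl⟩ := Submodule.mem_span_finset.1 hx'
    rw [← component_of_mem M.isInternal hx]
    change M.proj j _ ∈ B
    rw [map_sum]
    exact sum_mem fun g hg => hom' (f g) g hg
  have : Module.Finite K B := Module.Finite.iff_fg.2 hB
  exact Submodule.finiteDimensional_of_le le

end FiniteComponents

/-! ### The functors on modules -/

section Functors

variable {K : Type u} [Field K] {V : Type u} [AddCommGroup V] [Module K V]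

variable (K V) in
/-- Finitely generated graded modules over `S = Sym W`, where `W` is the dual space of `V`. -/
abbrev SMod := GrMod (symDeg K (Module.Dual K V))

variable (K V) in
/-- Finitely generated graded (left) modules over `E = ⋀ V`. -/
abbrev EMod := GrMod (extDeg K V)

/-- The restriction of a morphism of graded modules to the components of degree `i`. -/
def GrMod.Hom.onDeg {A : Type u} [Ring A] [Algebra K A] {𝒜 : ℤ → Submodule K A} {M N : GrMod 𝒜}
    (f : M ⟶ N) (i : ℤ) : M.deg i →ₗ[K] N.deg i :=
  ((Hom.lin f).restrictScalars K).restrict fun _ hx => Hom.map_mem f hx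

/-- Multiplication by a homogeneous element `a` of degree `s`, from degree `i` to degree
`j = s + i`. -/
def GrMod.act {A : Type u} [Ring A] [Algebra K A] {𝒜 : ℤ → Submodule K A} (M : GrMod 𝒜)
    {s i j : ℤ} {a : A} (ha : a ∈ 𝒜 s) (h : s + i = j) : M.deg i →ₗ[K] M.deg j :=
  (Algebra.lsmul K K M.carrier a).restrict fun x hx => by
    subst h
    exact SetLike.GradedSMul.smul_mem (B := M.deg) ha hx

/-- The space `Hom_K(E, N)`. -/
def HomE (K V N : Type u) [Field K] [AddCommGroup V] [Module K V] [AddCommGroup N] [Module K N] :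
    Type u := ExteriorAlgebra K V →ₗ[K] N

section HomE

variable {N N' : Type u} [AddCommGroup N] [Module K N] [AddCommGroup N'] [Module K N']

instance : AddCommGroup (HomE K V N) :=
  inferInstanceAs (AddCommGroup (ExteriorAlgebra K V →ₗ[K] N))

instance : Module K (HomE K V N) :=
  inferInstanceAs (Module K (ExteriorAlgebra K V →ₗ[K] N))

/-- The left `E`-module structure of `Hom_K(E, N)`: `(a • α) b = α (b * a)`. -/
noncomputable instance : Module (ExteriorAlgebra K V) (HomE K V N) where
  smul a α := LinearMap.comp (show ExteriorAlgebra K V →ₗ[K] N from α) (LinearMap.mulRight K a)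
  one_smul α := LinearMap.ext fun b =>
    congrArg (show ExteriorAlgebra K V →ₗ[K] N from α) (mul_one b)
  mul_smul a a' α := LinearMap.ext fun b =>
    congrArg (show ExteriorAlgebra K V →ₗ[K] N from α) (mul_assoc b a a').symm
  smul_zero _ := LinearMap.zero_comp _
  smul_add _ _ _ := LinearMap.add_comp _ _ _
  add_smul a a' α := LinearMap.ext fun b =>
    (congrArg (show ExteriorAlgebra K V →ₗ[K] N from α) (mul_add b a a')).trans (map_add _ _ _)
  zero_smul α := LinearMap.ext fun b =>
    (congrArg (show ExteriorAlgebra K V →ₗ[K] N from α) (mul_zero b)).trans (map_zero _)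

/-- A map `E → N`, regarded as an element of `Hom_K(E, N)`. -/
def HomE.of : (ExteriorAlgebra K V →ₗ[K] N) ≃ₗ[K] HomE K V N := LinearEquiv.refl K _

/-- The value of an element of `Hom_K(E, N)`. -/
def HomE.fn (α : HomE K V N) : ExteriorAlgebra K V →ₗ[K] N := α

lemma HomE.ext {α β : HomE K V N} (h : ∀ b, α.fn b = β.fn b) : α = β := LinearMap.ext h

@[simp] lemma HomE.fn_of (α : ExteriorAlgebra K V →ₗ[K] N) : (HomE.of α).fn = α := rfl
@[simp] lemma HomE.fn_smul (a : ExteriorAlgebra K V) (α : HomE K V N) (b : ExteriorAlgebra K V) :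
    (a • α).fn b = α.fn (b * a) := rfl
@[simp] lemma HomE.fn_smul' (a : K) (α : HomE K V N) (b : ExteriorAlgebra K V) :
    (a • α).fn b = a • α.fn b := rfl
@[simp] lemma HomE.fn_add (α β : HomE K V N) : (α + β).fn = α.fn + β.fn := rfl
@[simp] lemma HomE.fn_zero : (0 : HomE K V N).fn = 0 := rfl

instance : IsScalarTower K (ExteriorAlgebra K V) (HomE K V N) :=
  ⟨fun k a α => HomE.ext fun b => by simp⟩

/-- For `N` concentrated in degree `d`, an element of `Hom_K(E, N)` has degree `t` if it factors
through the projection of `E` onto its component of degree `d - t`. -/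
def HomE.deg (N : Type u) [AddCommGroup N] [Module K N] (d t : ℤ) : Submodule K (HomE K V N) where
  carrier := {α | ∀ s, s ≠ d - t → ∀ b ∈ extDeg K V s, α.fn b = 0}
  add_mem' hα hβ s hs b hb := by simp [hα s hs b hb, hβ s hs b hb]
  zero_mem' s hs b hb := by simp
  smul_mem' k α hα s hs b hb := by simp [hα s hs b hb]

variable [FiniteDimensional K V]

lemma HomE.deg_isInternal (d : ℤ) :
    DirectSum.IsInternal (HomE.deg N d : ℤ → Submodule K (HomE K V N)) := by
  classical
  have hE := extDeg_isInternal K V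
  let p : ℤ → HomE K V N →ₗ[K] HomE K V N := fun t =>
    HomE.of.toLinearMap ∘ₗ LinearMap.lcomp K N (component (extDeg K V) hE (d - t)) ∘ₗ
      HomE.of.symm.toLinearMap
  have hp : ∀ t α b, (p t α).fn b = α.fn (component (extDeg K V) hE (d - t) b) :=
    fun _ _ _ => rfl
  have hmem : ∀ t α, p t α ∈ HomE.deg N d t := by
    intro t α s hs b hb
    rw [hp, component_of_mem_ne hE hb hs, map_zero]
  refine isInternal_of_proj p ?_ ?_ ?_
  · intro t α hα
    refine HomE.ext fun b => ?_
    obtain ⟨T, hT⟩ := exists_eq_sum_component hE b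
    rw [hp]
    conv_rhs => rw [hT]
    rw [map_sum]
    by_cases ht : d - t ∈ T
    · rw [Finset.sum_eq_single_of_mem _ ht]
      exact fun s _ hs => hα s hs _ (component_mem hE s b)
    · rw [Finset.sum_eq_zero fun s hs =>
        hα s (fun h => ht (h ▸ hs)) _ (component_mem hE s b)]
      have : component (extDeg K V) hE (d - t) b = 0 := by
        rw [hT, map_sum]
        exact Finset.sum_eq_zero fun s hs =>
          component_of_mem_ne hE (component_mem hE s b) (fun h => ht (h ▸ hs))
      rw [this, map_zero]
  · intro i j α hα hij
    refine HomE.ext fun b => ?_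
    rw [hp]
    exact hα _ (by omega) _ (component_mem hE _ b)
  · intro α
    obtain ⟨G, hG⟩ := (Module.Finite.fg_top : (⊤ : Submodule K (ExteriorAlgebra K V)).FG)
    choose T hT using fun b : ExteriorAlgebra K V => exists_eq_sum_component hE b
    let U : Finset ℤ := G.biUnion T
    have key : ∀ b, b = ∑ s ∈ U, component (extDeg K V) hE s b := by
      have : (LinearMap.id : ExteriorAlgebra K V →ₗ[K] ExteriorAlgebra K V) =
          ∑ s ∈ U, component (extDeg K V) hE s := by
        refine LinearMap.ext_on hG fun b hb => ?_
        rw [LinearMap.id_apply, LinearMap.sum_apply]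
        rw [← Finset.sum_subset (Finset.subset_biUnion_of_mem T hb)]
        · exact hT b
        · intro s _ hs
          conv_lhs => rw [hT b]
          rw [map_sum]
          exact Finset.sum_eq_zero fun r hr =>
            component_of_mem_ne hE (component_mem hE r b) (fun h => hs (h ▸ hr))
      intro b
      conv_lhs => rw [← LinearMap.id_apply (R := K) b, this, LinearMap.sum_apply]
    have : α = ∑ s ∈ U, p (d - s) α := by
      have hs : (∑ s ∈ U, p (d - s) α).fn = ∑ s ∈ U, (p (d - s) α).fn :=
        map_sum (HomE.of (K := K) (V := V) (N := N)).symm _ _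
      refine HomE.ext fun b => ?_
      rw [hs, LinearMap.sum_apply]
      conv_lhs => rw [key b, map_sum]
      refine Finset.sum_congr rfl fun s _ => ?_
      rw [hp, sub_sub_cancel]
    rw [this]
    exact sum_mem fun s _ => Submodule.mem_iSup_of_mem _ (hmem _ α)

/-- The graded `E`-module `Hom_K(E, N)`, for a finite-dimensional `N` concentrated in degree `d`. -/
noncomputable def homE (N : Type u) [AddCommGroup N] [Module K N] [Module.Finite K N] (d : ℤ) :
    EMod K V where
  carrier := HomE K V N
  deg := HomE.deg N d
  isInternal := HomE.deg_isInternal d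
  gradedSMul := ⟨fun {i j a α} ha hα s hs b hb => by
    rw [HomE.fn_smul]
    refine hα (s + i) (fun h => hs ?_) _ (extDeg_mul K V hb ha)
    rw [vadd_eq_add]
    omega⟩
  finite := by
    have : Module.Finite K (HomE K V N) :=
      inferInstanceAs (Module.Finite K (ExteriorAlgebra K V →ₗ[K] N))
    exact Module.Finite.of_restrictScalars_finite K _ _

/-- The map `Hom_K(E, N) → Hom_K(E, N')` induced by a map `N → N'`. -/
noncomputable def homEMap [Module.Finite K N] [Module.Finite K N'] (f : N →ₗ[K] N') (d : ℤ) :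
    (homE N d : EMod K V) ⟶ homE N' d :=
  GrMod.ofLin
    { toFun := fun α => HomE.of (f ∘ₗ HomE.fn α)
      map_add' := fun _ _ => LinearMap.comp_add _ _ _
      map_smul' := fun _ _ => rfl }
    fun _ _ hα s hs b hb => (congrArg f (hα s hs b hb)).trans (map_zero f)

end HomE

section TensorS

variable (K V) in
/-- The graded `S`-module `S ⊗_K N`, for a finite-dimensional `N` concentrated in degree `d`. -/
noncomputable def tensorS (N : Type u) [AddCommGroup N] [Module K N] [Module.Finite K N] (d : ℤ) :
    SMod K V where
  carrier := SymmetricAlgebra K (Module.Dual K V) ⊗[K] N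
  deg n := LinearMap.range ((symDeg K (Module.Dual K V) (n - d)).subtype.rTensor N)
  isInternal := by
    have hS := symDeg_isInternal K (Module.Dual K V)
    have mem : ∀ (i : ℤ) (s : SymmetricAlgebra K (Module.Dual K V)) (_ : s ∈ symDeg K _ i) (y : N),
        s ⊗ₜ[K] y ∈ LinearMap.range
          ((symDeg K (Module.Dual K V) (i + d - d)).subtype.rTensor N) := by
      intro i s hs y
      exact ⟨(⟨s, by rwa [add_sub_cancel_right]⟩ : symDeg K (Module.Dual K V) (i + d - d)) ⊗ₜ y,
        LinearMap.rTensor_tmul _ _ _ _⟩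
    refine isInternal_of_proj
      (fun n => (component (symDeg K (Module.Dual K V)) hS (n - d)).rTensor N) ?_ ?_ ?_
    · rintro n _ ⟨z, rfl⟩
      rw [← LinearMap.comp_apply, ← LinearMap.rTensor_comp]
      congr 2
      exact LinearMap.ext fun x => component_of_mem hS x.2
    · rintro n m _ ⟨z, rfl⟩ hnm
      rw [← LinearMap.comp_apply, ← LinearMap.rTensor_comp]
      have : component (symDeg K (Module.Dual K V)) hS (n - d) ∘ₗ
          (symDeg K (Module.Dual K V) (m - d)).subtype = 0 :=
        LinearMap.ext fun x => component_of_mem_ne hS x.2 (by omega)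
      rw [this, LinearMap.rTensor_zero, LinearMap.zero_apply]
    · intro z
      induction z with
      | zero => exact zero_mem _
      | add x y hx hy => exact add_mem hx hy
      | tmul s y =>
        obtain ⟨T, hT⟩ := exists_eq_sum_component hS s
        rw [hT, TensorProduct.sum_tmul]
        exact sum_mem fun i _ => Submodule.mem_iSup_of_mem (i + d)
          (mem i _ (component_mem hS i s) y)
  gradedSMul := ⟨by
    rintro i j a _ ha ⟨z, rfl⟩
    induction z with
    | zero => simp
    | add x y hx hy =>
      rw [map_add, smul_add]
      exact add_mem hx hy
    | tmul s y =>
      refine ⟨(⟨a * s.1, ?_⟩ : symDeg K (Module.Dual K V) ((i +ᵥ j) - d)) ⊗ₜ y, ?_⟩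
      · have := symDeg_mul K (Module.Dual K V) ha s.2
        rw [← add_sub_assoc] at this
        exact this
      · simp [LinearMap.rTensor_tmul, TensorProduct.smul_tmul']⟩
  finite := inferInstance

lemma tensorSMap_mem {N N' : Type u} [AddCommGroup N] [Module K N] [AddCommGroup N']
    [Module K N'] {r n n' : ℤ} {a : SymmetricAlgebra K (Module.Dual K V)}
    (ha : a ∈ symDeg K (Module.Dual K V) r) (h : r + n = n') (f : N →ₗ[K] N')
    (z : symDeg K (Module.Dual K V) n ⊗[K] N) :
    TensorProduct.AlgebraTensorModule.map
      (LinearMap.mulLeft (SymmetricAlgebra K (Module.Dual K V)) a) f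
      ((symDeg K (Module.Dual K V) n).subtype.rTensor N z) ∈
      LinearMap.range ((symDeg K (Module.Dual K V) n').subtype.rTensor N') := by
  induction z with
  | zero =>
    rw [map_zero, map_zero]
    exact zero_mem _
  | add x y hx hy =>
    rw [map_add, map_add]
    exact add_mem hx hy
  | tmul s y =>
    exact ⟨(⟨a * s.1, h ▸ symDeg_mul K _ ha s.2⟩ : symDeg K (Module.Dual K V) n') ⊗ₜ f y, rfl⟩

variable (K V) in
/-- The map `S ⊗ N → S ⊗ N'`, `s ⊗ p ↦ a s ⊗ f p`, for `a` in `S` homogeneous of degree `r` and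
`N`, `N'` concentrated in degrees `d = d' + r`, `d'`. -/
noncomputable def tensorSMap {N N' : Type u} [AddCommGroup N] [Module K N] [AddCommGroup N']
    [Module K N'] [Module.Finite K N] [Module.Finite K N'] {r d d' : ℤ}
    {a : SymmetricAlgebra K (Module.Dual K V)} (ha : a ∈ symDeg K (Module.Dual K V) r)
    (hd : d' + r = d) (f : N →ₗ[K] N') : tensorS K V N d ⟶ tensorS K V N' d' :=
  GrMod.ofLin
    (TensorProduct.AlgebraTensorModule.map
      (LinearMap.mulLeft (SymmetricAlgebra K (Module.Dual K V)) a) f)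
    (by
      rintro n _ ⟨z, rfl⟩
      exact tensorSMap_mem ha (by omega) f z)

lemma tensorS_hom_ext {N : Type u} [AddCommGroup N] [Module K N] [Module.Finite K N] {d : ℤ}
    {M : SMod K V} {f g : tensorS K V N d ⟶ M}
    (h : ∀ (s : SymmetricAlgebra K (Module.Dual K V)) (y : N),
      GrMod.Hom.lin f (s ⊗ₜ[K] y : SymmetricAlgebra K (Module.Dual K V) ⊗[K] N) =
        GrMod.Hom.lin g (s ⊗ₜ[K] y : SymmetricAlgebra K (Module.Dual K V) ⊗[K] N)) : f = g := by
  refine GrMod.hom_ext fun z => ?_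
  induction z using TensorProduct.induction_on with
  | zero => exact (map_zero (GrMod.Hom.lin f)).trans (map_zero (GrMod.Hom.lin g)).symm
  | tmul s y => exact h s y
  | add x y hx hy =>
    exact (map_add (GrMod.Hom.lin f) x y).trans
      ((congrArg₂ (· + ·) hx hy).trans (map_add (GrMod.Hom.lin g) x y).symm)

end TensorS

variable [FiniteDimensional K V]

instance (M : SMod K V) (j : ℤ) : Module.Finite K (M.deg j) :=
  M.finite_deg (symDeg_isInternal K _) j

instance (P : EMod K V) (j : ℤ) : Module.Finite K (P.deg j) :=
  P.finite_deg (extDeg_isInternal K _) j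

variable (K V) in
/-- The elements `e_k` of a basis of `V`, as elements of `E`. -/
noncomputable def e (k : Fin (Module.finrank K V)) : ExteriorAlgebra K V :=
  ExteriorAlgebra.ι K (Module.finBasis K V k)

variable (K V) in
/-- The elements `x_k` of the dual basis of `W`, as elements of `S`. -/
noncomputable def x (k : Fin (Module.finrank K V)) : SymmetricAlgebra K (Module.Dual K V) :=
  SymmetricAlgebra.ι K (Module.Dual K V) ((Module.finBasis K V).coord k)

variable (K V) in
lemma e_mem (k : Fin (Module.finrank K V)) : e K V k ∈ extDeg K V (-1) := ι_mem_extDeg K V _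

variable (K V) in
lemma x_mem (k : Fin (Module.finrank K V)) : x K V k ∈ symDeg K (Module.Dual K V) 1 :=
  ι_mem_symDeg K _ _

lemma e_mul_self (k : Fin (Module.finrank K V)) : e K V k * e K V k = 0 :=
  ExteriorAlgebra.ι_sq_zero _

lemma e_mul_add_swap (k l : Fin (Module.finrank K V)) :
    e K V k * e K V l + e K V l * e K V k = 0 :=
  ExteriorAlgebra.ι_add_mul_swap _ _

lemma sum_sum_eq_zero {n : ℕ} {B : Type*} [AddCommGroup B] (f : Fin n → Fin n → B)
    (hd : ∀ k, f k k = 0) (ha : ∀ k l, f k l + f l k = 0) : ∑ k, ∑ l, f k l = 0 := by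
  classical
  rw [← Fintype.sum_prod_type']
  refine Finset.sum_involution (fun p _ => p.swap) (fun p _ => ha p.1 p.2) ?_
    (fun _ _ => Finset.mem_univ _) (fun _ _ => rfl)
  rintro ⟨k, l⟩ _ h h'
  obtain rfl : l = k := congrArg Prod.fst h'
  exact h (hd l)

/-- The map `Hom_K(E, M_i) → Hom_K(E, M_j)`, `j = i + 1`, that sends `α` to
`b ↦ ∑ x_k α(e_k b)`. -/
noncomputable def RdFun (M : SMod K V) {i j : ℤ} (h : i + 1 = j)
    (α : ExteriorAlgebra K V →ₗ[K] M.deg i) : ExteriorAlgebra K V →ₗ[K] M.deg j :=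
  ∑ k, M.act (x_mem K V k) (by omega : 1 + i = j) ∘ₗ α ∘ₗ LinearMap.mulLeft K (e K V k)

lemma RdFun_apply (M : SMod K V) {i j : ℤ} (h : i + 1 = j)
    (α : ExteriorAlgebra K V →ₗ[K] M.deg i) (b : ExteriorAlgebra K V) :
    RdFun M h α b = ∑ k, M.act (x_mem K V k) (by omega : 1 + i = j) (α (e K V k * b)) := by
  simp [RdFun, LinearMap.sum_apply]

/-- The differential of the complex `R(M)`. -/
noncomputable def Rd (M : SMod K V) {i j : ℤ} (h : i + 1 = j) :
    (homE (M.deg i) i : EMod K V) ⟶ homE (M.deg j) j :=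
  GrMod.ofLin
    { toFun := fun α => HomE.of (RdFun M h (HomE.fn α))
      map_add' := fun α β => HomE.ext fun b => by
        change RdFun M h (HomE.fn α + HomE.fn β) b =
          RdFun M h (HomE.fn α) b + RdFun M h (HomE.fn β) b
        simp [RdFun_apply, Finset.sum_add_distrib]
      map_smul' := fun a α => HomE.ext fun b => by
        refine (RdFun_apply M h _ b).trans (Eq.trans ?_ (RdFun_apply M h _ (b * a)).symm)
        refine Finset.sum_congr rfl fun k _ => congrArg (M.act _ _) ?_
        exact congrArg (HomE.fn α) (mul_assoc (e K V k) b a) }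
    (by
      intro t α hα s hs b hb
      refine (RdFun_apply M h _ b).trans (Finset.sum_eq_zero fun k _ => ?_)
      have : HomE.fn α (e K V k * b) = 0 :=
        hα (-1 + s) (by omega) _ (extDeg_mul K V (e_mem K V k) hb)
      rw [this, map_zero])

lemma Rd_apply (M : SMod K V) {i j : ℤ} (h : i + 1 = j) (α : HomE K V (M.deg i))
    (b : ExteriorAlgebra K V) :
    ((HomE.fn (GrMod.Hom.lin (Rd M h) α) b : M.deg j) : M.carrier) =
      ∑ k, x K V k • ((HomE.fn α (e K V k * b) : M.deg i) : M.carrier) := by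
  refine (congrArg Subtype.val (RdFun_apply M h _ b)).trans ?_
  rw [AddSubmonoidClass.coe_finsetSum]
  rfl

lemma Rd_comp (M : SMod K V) {i j l : ℤ} (h : i + 1 = j) (h' : j + 1 = l) :
    Rd M h ≫ Rd M h' = 0 := by
  refine GrMod.hom_ext fun α => HomE.ext fun b => Subtype.ext ?_
  refine (Rd_apply M h' _ b).trans ?_
  have (k : Fin (Module.finrank K V)) := Rd_apply M h α (e K V k * b)
  refine (Finset.sum_congr rfl fun k _ => congrArg (x K V k • ·) (this k)).trans ?_
  simp only [Finset.smul_sum, smul_smul, ← mul_assoc]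
  refine sum_sum_eq_zero _ (fun k => ?_) fun k l => ?_
  · rw [e_mul_self]
    simp
  · rw [mul_comm (x K V l), ← smul_add, ← Submodule.coe_add, ← map_add, ← add_mul,
      e_mul_add_swap]
    simp

/-- The complex `R(M)` of a module `M`: the term in cohomological degree `d` is
`Hom_K(E, M_d)`. -/
noncomputable def Robj (M : SMod K V) : CochainComplex (EMod K V) ℤ where
  X d := homE (M.deg d) d
  d i j := if h : i + 1 = j then Rd M h else 0
  shape i j h := dif_neg h
  d_comp_d' i j l h h' := by
    change i + 1 = j at h
    change j + 1 = l at h'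
    rw [dif_pos h, dif_pos h', Rd_comp]

/-- The functor `R` on modules. -/
noncomputable def R₀ : SMod K V ⥤ CochainComplex (EMod K V) ℤ where
  obj M := Robj M
  map {M N} f :=
    { f := fun d => homEMap (GrMod.Hom.onDeg f d) d
      comm' := fun i j h => by
        change i + 1 = j at h
        simp only [Robj, dif_pos h]
        refine GrMod.hom_ext fun α => HomE.ext fun b => Subtype.ext ?_
        refine (Rd_apply N h _ b).trans ?_
        refine Eq.trans ?_ (congrArg (GrMod.Hom.lin f) (Rd_apply M h α b)).symm
        rw [map_sum]
        exact Finset.sum_congr rfl fun k _ => ((GrMod.Hom.lin f).map_smul _ _).symm }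
  map_id _ := rfl
  map_comp _ _ := rfl

instance : (R₀ : SMod K V ⥤ _).Additive where
  map_add := rfl

/-- The differential `S ⊗ P_{-i} → S ⊗ P_{-j}`, `j = i + 1`, of the complex `L(P)`, that sends
`s ⊗ p` to `∑ x_k s ⊗ e_k p`. -/
noncomputable def Ld (P : EMod K V) {i j : ℤ} (h : i + 1 = j) :
    tensorS K V (P.deg (-i)) (-i) ⟶ tensorS K V (P.deg (-j)) (-j) :=
  ∑ k, tensorSMap K V (x_mem K V k) (by omega) (P.act (e_mem K V k) (by omega : -1 + -i = -j))

lemma Ld_comp (P : EMod K V) {i j l : ℤ} (h : i + 1 = j) (h' : j + 1 = l) :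
    Ld P h ≫ Ld P h' = 0 := by
  rw [Ld, Ld, Preadditive.sum_comp]
  simp only [Preadditive.comp_sum]
  have key : ∀ k m, tensorSMap K V (d := -i) (d' := -j) (x_mem K V k) (by omega)
      (P.act (e_mem K V k) (by omega : -1 + -i = -j)) ≫
      tensorSMap K V (d := -j) (d' := -l) (x_mem K V m) (by omega)
      (P.act (e_mem K V m) (by omega : -1 + -j = -l)) =
      tensorSMap K V (d := -i) (d' := -l) (symDeg_mul K _ (x_mem K V m) (x_mem K V k)) (by omega)
      (P.act (extDeg_mul K V (e_mem K V m) (e_mem K V k)) (by omega : (-1 + -1) + -i = -l)) := by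
    intro k m
    refine tensorS_hom_ext fun s y => ?_
    exact congrArg₂ (fun a b => a ⊗ₜ[K] b) (mul_assoc _ _ _).symm
      (Subtype.ext (smul_smul _ _ _))
  refine (Finset.sum_congr rfl fun k _ => Finset.sum_congr rfl fun m _ => key k m).trans ?_
  refine sum_sum_eq_zero _ (fun k => ?_) fun k m => ?_
  · refine tensorS_hom_ext fun s y => ?_
    refine Eq.trans ?_ (TensorProduct.tmul_zero _ (x K V k * x K V k * s))
    refine congrArg₂ (fun a b => a ⊗ₜ[K] b) rfl (Subtype.ext ?_)
    change (e K V k * e K V k) • (y : P.carrier) = 0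
    rw [e_mul_self, zero_smul]
  · refine tensorS_hom_ext fun s y => ?_
    change (x K V m * x K V k * s) ⊗ₜ[K] (P.act _ _ y : P.deg (-l)) +
      (x K V k * x K V m * s) ⊗ₜ[K] (P.act _ _ y : P.deg (-l)) = 0
    rw [mul_comm (x K V k), ← TensorProduct.tmul_add]
    refine Eq.trans ?_ (TensorProduct.tmul_zero _ (x K V m * x K V k * s))
    refine congrArg₂ (fun a b => a ⊗ₜ[K] b) rfl (Subtype.ext ?_)
    change (e K V m * e K V k) • (y : P.carrier) + (e K V k * e K V m) • (y : P.carrier) = 0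
    rw [← add_smul, e_mul_add_swap, zero_smul]

/-- The complex `L(P)` of a module `P`: the term in cohomological degree `d` is `S ⊗ P_{-d}`. -/
noncomputable def Lobj (P : EMod K V) : CochainComplex (SMod K V) ℤ where
  X d := tensorS K V (P.deg (-d)) (-d)
  d i j := if h : i + 1 = j then Ld P h else 0
  shape i j h := dif_neg h
  d_comp_d' i j l h h' := by
    change i + 1 = j at h
    change j + 1 = l at h'
    rw [dif_pos h, dif_pos h', Ld_comp]

/-- The map `S ⊗ N → S ⊗ N'` induced by a map `N → N'`. -/
noncomputable def tensorSLift {N N' : Type u} [AddCommGroup N] [Module K N] [AddCommGroup N']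
    [Module K N'] [Module.Finite K N] [Module.Finite K N'] (f : N →ₗ[K] N') (d : ℤ) :
    tensorS K V N d ⟶ tensorS K V N' d :=
  GrMod.ofLin (TensorProduct.AlgebraTensorModule.map LinearMap.id f) (by
    rintro n _ ⟨z, rfl⟩
    have := tensorSMap_mem (n' := n - d) (one_mem_symDeg K (Module.Dual K V)) (zero_add _) f z
    rwa [LinearMap.mulLeft_one] at this)

/-- The functor `L` on modules. -/
noncomputable def L₀ : EMod K V ⥤ CochainComplex (SMod K V) ℤ where
  obj P := Lobj P
  map {P Q} f :=
    { f := fun d => tensorSLift (GrMod.Hom.onDeg f (-d)) (-d)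
      comm' := fun i j h => by
        change i + 1 = j at h
        simp only [Lobj, dif_pos h, Ld, Preadditive.comp_sum, Preadditive.sum_comp]
        refine Finset.sum_congr rfl fun k _ => tensorS_hom_ext fun s y => ?_
        refine congrArg₂ (fun a b => a ⊗ₜ[K] b) rfl (Subtype.ext ?_)
        exact ((GrMod.Hom.lin f).map_smul _ _).symm }
  map_id P := by
    ext d : 1
    exact tensorS_hom_ext fun s y => rfl
  map_comp f g := by
    ext d : 1
    exact tensorS_hom_ext fun s y => rfl

instance : (L₀ : EMod K V ⥤ _).Additive where
  map_add {P Q f g} := by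
    ext d : 1
    exact tensorS_hom_ext fun s y => 
      TensorProduct.tmul_add s (GrMod.Hom.onDeg f (-d) y) (GrMod.Hom.onDeg g (-d) y)

end Functors

/-! ### The functors on bounded complexes and the derived categories -/

section Complexes

/-- The full subcategory of bounded complexes. -/
def bounded (C : Type*) [Category* C] [HasZeroMorphisms C] : ObjectProperty (CochainComplex C ℤ) :=
  fun F => ∃ a b : ℤ, F.IsStrictlyGE a ∧ F.IsStrictlyLE b

lemma hasCoproduct_of_finite {C : Type*} [Category* C] [HasZeroMorphisms C]
    [HasFiniteCoproducts C] {J : Type*} (X : J → C) (T : Set J) [Finite T]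
    (h : ∀ j, j ∉ T → IsZero (X j)) : HasCoproduct X := by
  classical
  let Y : T → C := fun t => X t
  let c : Cofan X := Cofan.mk (∐ Y) fun j =>
    if hj : j ∈ T then Limits.Sigma.ι Y ⟨j, hj⟩ else 0
  have hc : ∀ t : T, c.inj t = Limits.Sigma.ι Y t := fun t => dif_pos t.2
  let desc : ∀ s : Cofan X, c.pt ⟶ s.pt := fun s =>
    Limits.Sigma.desc (fun t : T => (s.inj t : Y t ⟶ s.pt))
  refine ⟨⟨c, Cofan.IsColimit.mk c desc ?_ ?_⟩⟩
  · intro s j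
    by_cases hj : j ∈ T
    · exact (congrArg (· ≫ desc s) (hc ⟨j, hj⟩)).trans
        (Limits.Sigma.ι_desc (fun t : T => (s.inj t : Y t ⟶ s.pt)) ⟨j, hj⟩)
    · exact (h j hj).eq_of_src _ _
  · intro s m hm
    refine Limits.Sigma.hom_ext (f := Y) _ _ fun t => ?_
    exact ((congrArg (· ≫ m) (hc t)).symm.trans (hm t)).trans
      (Limits.Sigma.ι_desc (fun t : T => (s.inj t : Y t ⟶ s.pt)) t).symm

/-- For a functor from objects to complexes, the double complex obtained from a bounded complex
has a total complex. -/
lemma hasTotal_of_bounded {C D : Type*} [Category* C] [Category* D] [Preadditive C] [Preadditive D]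
    [HasFiniteCoproducts D] (Φ : C ⥤ CochainComplex D ℤ) [Φ.Additive] (F : CochainComplex C ℤ)
    (hF : bounded C F) :
    HomologicalComplex₂.HasTotal
      ((Φ.mapHomologicalComplex (ComplexShape.up ℤ)).obj F) (ComplexShape.up ℤ) := by
  obtain ⟨a, b, ha, hb⟩ := hF
  intro k
  have : Finite {p : ComplexShape.π (ComplexShape.up ℤ) (ComplexShape.up ℤ) (ComplexShape.up ℤ) ⁻¹'
      {k} | a ≤ p.1.1 ∧ p.1.1 ≤ b} := by
    refine Finite.of_injective (β := Set.Icc a b) (fun p => ⟨p.1.1.1, p.2⟩) ?_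
    rintro ⟨⟨⟨i, j⟩, h : i + j = k⟩, hp⟩ ⟨⟨⟨i', j'⟩, h' : i' + j' = k⟩, hp'⟩ heq
    obtain rfl : i = i' := congrArg Subtype.val heq
    obtain rfl : j = j' := by omega
    rfl
  refine hasCoproduct_of_finite _ {p | a ≤ p.1.1 ∧ p.1.1 ≤ b} ?_
  rintro ⟨⟨i, j⟩, h⟩ hp
  have hz : IsZero (F.X i) := by
    by_cases hi : a ≤ i
    · exact F.isZero_of_isStrictlyLE b i (not_le.1 fun hi' => hp ⟨hi, hi'⟩)
    · exact F.isZero_of_isStrictlyGE a i (not_le.1 hi)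
  exact (HomologicalComplex.eval D _ j).map_isZero (Φ.map_isZero hz)

/-- The extension of a functor `Φ` from objects to complexes to a functor on bounded complexes:
`Φ` is applied to every term of a complex, and the total complex of the resulting double complex
is taken. -/
noncomputable def totalize {C D : Type*} [Category* C] [Category* D] [Preadditive C] [Preadditive D]
    [HasFiniteCoproducts D] (Φ : C ⥤ CochainComplex D ℤ) [Φ.Additive] :
    (bounded C).FullSubcategory ⥤ CochainComplex D ℤ where
  obj F :=
    haveI := hasTotal_of_bounded Φ F.obj F.property
    HomologicalComplex₂.total ((Φ.mapHomologicalComplex (ComplexShape.up ℤ)).obj F.obj)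
      (ComplexShape.up ℤ)
  map {F G} f :=
    haveI := hasTotal_of_bounded Φ F.obj F.property
    haveI := hasTotal_of_bounded Φ G.obj G.property
    HomologicalComplex₂.total.map ((Φ.mapHomologicalComplex (ComplexShape.up ℤ)).map f.hom)
      (ComplexShape.up ℤ)
  map_id F := by
    have := hasTotal_of_bounded Φ F.obj F.property
    exact (congrArg (fun f => HomologicalComplex₂.total.map f (ComplexShape.up ℤ))
      ((Φ.mapHomologicalComplex (ComplexShape.up ℤ)).map_id F.obj)).trans
      (HomologicalComplex₂.total.map_id _ _)
  map_comp {F G H} f g := by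
    have := hasTotal_of_bounded Φ F.obj F.property
    have := hasTotal_of_bounded Φ G.obj G.property
    have := hasTotal_of_bounded Φ H.obj H.property
    exact (congrArg (fun f => HomologicalComplex₂.total.map f (ComplexShape.up ℤ))
      ((Φ.mapHomologicalComplex (ComplexShape.up ℤ)).map_comp f.hom g.hom)).trans
      (HomologicalComplex₂.total.map_comp _ _ _)

/-- The functor from bounded complexes to the bounded derived category. -/
noncomputable def boundedQ (C : Type*) [Category* C] [Abelian C] [HasDerivedCategory.{w} C] :
    (bounded C).FullSubcategory ⥤ DerivedCategory.Bounded C :=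
  ObjectProperty.lift _ ((bounded C).ι ⋙ DerivedCategory.Q) fun F => by
    obtain ⟨F, a, b, ha, hb⟩ := F
    exact ⟨⟨a, inferInstanceAs ((DerivedCategory.Q.obj F).IsGE a)⟩,
      ⟨b, inferInstanceAs ((DerivedCategory.Q.obj F).IsLE b)⟩⟩

variable {K : Type u} [Field K] {V : Type u} [AddCommGroup V] [Module K V] [FiniteDimensional K V]

variable (K V) in
/-- The functor `R` on bounded complexes of finitely generated graded `S`-modules. -/
noncomputable def R : (bounded (SMod K V)).FullSubcategory ⥤ CochainComplex (EMod K V) ℤ :=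
  totalize R₀

variable (K V) in
/-- The functor `L` on bounded complexes of finitely generated graded `E`-modules. -/
noncomputable def L : (bounded (EMod K V)).FullSubcategory ⥤ CochainComplex (SMod K V) ℤ :=
  totalize L₀

end Complexes

end BGG

set_option linter.unusedSectionVars false

/-! On modules, `R₀` and `L₀` are exact in every degree, because `Hom` and `⊗` over a field are
exact. Hence the total complexes of bounded complexes respect short exact sequences, mapping cones
and shifts, and preserve quasi-isomorphisms (`totalize_shortExact`, `totalConeIso`,
`quasiIso_totalize`). The bounded derived category is the localization of the category of bounded
complexes at the quasi-isomorphisms, so both functors induce triangulated functors (`derived`) as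
soon as their values have bounded cohomology. For `L` this holds because finitely generated
`E`-modules are finite-dimensional. The complex `R(M)` may be unbounded above, but its cohomology is
Koszul cohomology: cycles modulo boundaries form a finitely generated `S`-module that is annihilated
by every `x_k`, hence a finite-dimensional space, and so it vanishes in high degrees (`R₀_exactAt`).

Three facts then carry the equivalence.

The unit `G ⟶ R(L(G))` is a natural quasi-isomorphism (`quasiIso_unit`). By dévissage it suffices to
treat a single module that is a vector space `N` in one internal degree. In that case `L(G)` is `S ⊗
N` in one cohomological degree, and `R(S ⊗ N)` is a Koszul complex whose only cohomology is `N`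
(`R₀_tensorS_exactAt`, `exists_socle_eq`).

The functor `R` reflects quasi-isomorphisms (`quasiIso_of_quasiIso_R`). By passing to cones, it
suffices that `F` is acyclic if `R(F)` is. A graded Nakayama argument shows that the last
differential of `F` is surjective (`exists_eq_d_of_acyclic`), after which truncation shortens `F`.

Every bounded `F` is quasi-isomorphic to some `L(G)` (`exists_quasiIso_LB`). For `G` take a
truncation of `R(F)`. The quasi-isomorphism `G ⟶ R(F)` corresponds to a morphism `L(G) ⟶ F` that
becomes a quasi-isomorphism under `R`, hence is one.

The rest is formal: a triangulated functor `R` that reflects isomorphisms and satisfies `R ∘ L ≅ id`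
with `L` essentially surjective is an equivalence (`isEquivalence_of_essSurj`), and `L` is then its
quasi-inverse. No counit has to be constructed. -/

namespace BGG

section

/-! ### Total complexes of bounded complexes of complexes -/

section Totalize

variable {C D : Type*} [Category* C] [Category* D] [Preadditive C] [Preadditive D]
  [HasFiniteCoproducts D] (Φ : C ⥤ CochainComplex D ℤ) [Φ.Additive]

/-- The category of bounded complexes. -/
abbrev BddCx (C : Type*) [Category* C] [HasZeroMorphisms C] := (bounded C).FullSubcategory

variable (F G H : BddCx C)

/-- The inclusion of a summand of the total complex. -/
noncomputable def totalι (i j n : ℤ) (h : i + j = n) :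
    (Φ.obj (F.obj.X i)).X j ⟶ ((totalize Φ).obj F).X n :=
  haveI := hasTotal_of_bounded Φ F.obj F.property
  HomologicalComplex₂.ιTotal ((Φ.mapHomologicalComplex (ComplexShape.up ℤ)).obj F.obj)
    (ComplexShape.up ℤ) i j n h

variable {F G H}

/-- A morphism from a term of the total complex, given by its restrictions to the summands. -/
noncomputable def totalDesc {n : ℤ} {A : D}
    (f : ∀ i j (_ : i + j = n), (Φ.obj (F.obj.X i)).X j ⟶ A) :
    ((totalize Φ).obj F).X n ⟶ A :=
  haveI := hasTotal_of_bounded Φ F.obj F.property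
  HomologicalComplex₂.totalDesc
    ((Φ.mapHomologicalComplex (ComplexShape.up ℤ)).obj F.obj) f

@[simp] lemma totalι_desc {n : ℤ} {A : D}
    (f : ∀ i j (_ : i + j = n), (Φ.obj (F.obj.X i)).X j ⟶ A) (i j : ℤ) (h : i + j = n) :
    totalι Φ F i j n h ≫ totalDesc Φ f = f i j h :=
  haveI := hasTotal_of_bounded Φ F.obj F.property
  HomologicalComplex₂.ι_totalDesc (c₁₂ := ComplexShape.up ℤ)
    ((Φ.mapHomologicalComplex (ComplexShape.up ℤ)).obj F.obj) f i j h

@[simp] lemma totalι_desc_assoc {n : ℤ} {A B : D}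
    (f : ∀ i j (_ : i + j = n), (Φ.obj (F.obj.X i)).X j ⟶ A) (i j : ℤ) (h : i + j = n)
    (g : A ⟶ B) :
    totalι Φ F i j n h ≫ totalDesc Φ f ≫ g = f i j h ≫ g := by
  rw [← Category.assoc, totalι_desc]

variable {Φ} in
lemma total_hom_ext {n : ℤ} {A : D} {f g : ((totalize Φ).obj F).X n ⟶ A}
    (h : ∀ i j (h : i + j = n), totalι Φ F i j n h ≫ f = totalι Φ F i j n h ≫ g) : f = g :=
  haveI := hasTotal_of_bounded Φ F.obj F.property
  HomologicalComplex₂.total.hom_ext (ComplexShape.up ℤ)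
    (K := (Φ.mapHomologicalComplex (ComplexShape.up ℤ)).obj F.obj) h

lemma totalι_map (f : F ⟶ G) (i j n : ℤ) (h : i + j = n) :
    totalι Φ F i j n h ≫ ((totalize Φ).map f).f n =
      (Φ.map (f.hom.f i)).f j ≫ totalι Φ G i j n h :=
  haveI := hasTotal_of_bounded Φ F.obj F.property
  haveI := hasTotal_of_bounded Φ G.obj G.property
  HomologicalComplex₂.ιTotal_map
    (K := (Φ.mapHomologicalComplex (ComplexShape.up ℤ)).obj F.obj)
    (L := (Φ.mapHomologicalComplex (ComplexShape.up ℤ)).obj G.obj)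
    ((Φ.mapHomologicalComplex (ComplexShape.up ℤ)).map f.hom)
    (ComplexShape.up ℤ) i j n h

lemma totalι_map_assoc (f : F ⟶ G) (i j n : ℤ) (h : i + j = n) {A : D}
    (g : ((totalize Φ).obj G).X n ⟶ A) :
    totalι Φ F i j n h ≫ ((totalize Φ).map f).f n ≫ g =
      (Φ.map (f.hom.f i)).f j ≫ totalι Φ G i j n h ≫ g := by
  rw [← Category.assoc, totalι_map, Category.assoc]

/-- The sign convention on which all later sign computations rest: the differential of `F` enters
without a sign, the differential of `Φ` with the sign `(-1)^i`, where `i` is the degree in `F`. -/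
lemma totalι_d (i j n i' j' n' : ℤ) (h : i + j = n) (hi : i + 1 = i') (hj : j + 1 = j')
    (hn : n + 1 = n') :
    totalι Φ F i j n h ≫ ((totalize Φ).obj F).d n n' =
      (Φ.map (F.obj.d i i')).f j ≫ totalι Φ F i' j n' (by omega) +
      i.negOnePow • ((Φ.obj (F.obj.X i)).d j j' ≫ totalι Φ F i j' n' (by omega)) := by
  have := hasTotal_of_bounded Φ F.obj F.property
  let K : HomologicalComplex₂ D (ComplexShape.up ℤ) (ComplexShape.up ℤ) :=
    (Φ.mapHomologicalComplex (ComplexShape.up ℤ)).obj F.obj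
  have h₁ : K.ιTotal (ComplexShape.up ℤ) i j n h ≫ K.D₁ (ComplexShape.up ℤ) n n' =
      (Φ.map (F.obj.d i i')).f j ≫ totalι Φ F i' j n' (by omega) := by
    rw [K.ι_D₁, K.d₁_eq (ComplexShape.up ℤ) (show (ComplexShape.up ℤ).Rel i i' from hi) j n'
      (show i' + j = n' by omega)]
    exact one_smul _ _
  have h₂ : K.ιTotal (ComplexShape.up ℤ) i j n h ≫ K.D₂ (ComplexShape.up ℤ) n n' =
      i.negOnePow • ((Φ.obj (F.obj.X i)).d j j' ≫ totalι Φ F i j' n' (by omega)) := by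
    rw [K.ι_D₂, K.d₂_eq (ComplexShape.up ℤ) i (show (ComplexShape.up ℤ).Rel j j' from hj) n'
      (show i + j' = n' by omega)]
    rfl
  refine Eq.trans ?_ (congrArg₂ (· + ·) h₁ h₂)
  exact Preadditive.comp_add _ _ _ _ _ _

variable (F) in
/-- The projection to a summand of the total complex. -/
noncomputable def totalπ (i j n : ℤ) (_ : i + j = n) :
    ((totalize Φ).obj F).X n ⟶ (Φ.obj (F.obj.X i)).X j :=
  totalDesc Φ fun i' j' _ => if hi : i' = i then
    eqToHom (by subst hi; obtain rfl : j = j' := by omega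
                rfl) else 0

@[simp] lemma totalι_π (i j n : ℤ) (h : i + j = n) :
    totalι Φ F i j n h ≫ totalπ Φ F i j n h = 𝟙 _ := by
  rw [totalπ, totalι_desc, dif_pos rfl]
  rfl

lemma totalι_π_of_ne (i j i' j' n : ℤ) (h : i + j = n) (h' : i' + j' = n) (hi : i ≠ i') :
    totalι Φ F i j n h ≫ totalπ Φ F i' j' n h' = 0 := by
  rw [totalπ, totalι_desc, dif_neg hi]

lemma isZero_totalX {i j : ℤ} (h : IsZero (F.obj.X i)) : IsZero ((Φ.obj (F.obj.X i)).X j) :=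
  (HomologicalComplex.eval D _ j).map_isZero (Φ.map_isZero h)

variable (F) in
/-- A finite set of degrees that contains the degrees of the nonzero terms of `F`. -/
noncomputable def supp : Finset ℤ := Finset.Icc F.property.choose F.property.choose_spec.choose

lemma isZero_of_notMem_supp {i : ℤ} (hi : i ∉ supp F) : IsZero (F.obj.X i) := by
  obtain ⟨ha, hb⟩ := F.property.choose_spec.choose_spec
  rw [supp, Finset.mem_Icc, not_and_or] at hi
  rcases hi with hi | hi
  · exact F.obj.isZero_of_isStrictlyGE _ i (not_le.1 hi)
  · exact F.obj.isZero_of_isStrictlyLE _ i (not_le.1 hi)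

/-- A morphism to a term of the total complex, given by its components. -/
noncomputable def totalLift {n : ℤ} {A : D}
    (f : ∀ i j (_ : i + j = n), A ⟶ (Φ.obj (F.obj.X i)).X j) :
    A ⟶ ((totalize Φ).obj F).X n :=
  ∑ i ∈ supp F, f i (n - i) (by omega) ≫ totalι Φ F i (n - i) n (by omega)

@[simp] lemma totalLift_π {n : ℤ} {A : D}
    (f : ∀ i j (_ : i + j = n), A ⟶ (Φ.obj (F.obj.X i)).X j) (i j : ℤ) (h : i + j = n) :
    totalLift Φ f ≫ totalπ Φ F i j n h = f i j h := by
  obtain rfl : j = n - i := by omega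
  rw [totalLift, Preadditive.sum_comp]
  by_cases hi : i ∈ supp F
  · rw [Finset.sum_eq_single_of_mem i hi, Category.assoc, totalι_π, Category.comp_id]
    intro i' _ hi'
    rw [Category.assoc, totalι_π_of_ne _ _ _ _ _ _ _ _ hi', comp_zero]
  · exact (isZero_totalX Φ (isZero_of_notMem_supp hi)).eq_of_tgt _ _

/-- Only finitely many summands are nonzero, so a term of the total complex is a biproduct of them.
This is what allows morphisms into it to be compared through projections. -/
lemma total_sum (n : ℤ) :
    ∑ i ∈ supp F, totalπ Φ F i (n - i) n (by omega) ≫ totalι Φ F i (n - i) n (by omega) = 𝟙 _ := by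
  refine total_hom_ext fun i j h => ?_
  obtain rfl : j = n - i := by omega
  rw [Category.comp_id, Preadditive.comp_sum]
  by_cases hi : i ∈ supp F
  · rw [Finset.sum_eq_single_of_mem i hi, ← Category.assoc, totalι_π, Category.id_comp]
    intro i' _ hi'
    rw [← Category.assoc, totalι_π_of_ne _ _ _ _ _ _ _ _ hi'.symm, zero_comp]
  · exact (isZero_totalX Φ (isZero_of_notMem_supp hi)).eq_of_src _ _

variable {Φ} in
lemma total_hom_ext_to {n : ℤ} {A : D} {f g : A ⟶ ((totalize Φ).obj F).X n}
    (h : ∀ i j (h : i + j = n), f ≫ totalπ Φ F i j n h = g ≫ totalπ Φ F i j n h) : f = g := by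
  rw [← Category.comp_id f, ← Category.comp_id g, ← total_sum]
  simp only [Preadditive.comp_sum, ← Category.assoc, h]

lemma total_map_π (f : F ⟶ G) (i j n : ℤ) (h : i + j = n) :
    ((totalize Φ).map f).f n ≫ totalπ Φ G i j n h =
      totalπ Φ F i j n h ≫ (Φ.map (f.hom.f i)).f j := by
  refine total_hom_ext fun i' j' h' => ?_
  rw [totalι_map_assoc]
  by_cases hi : i' = i
  · subst hi
    obtain rfl : j = j' := by omega
    rw [totalι_π, ← Category.assoc, totalι_π, Category.comp_id, Category.id_comp]
  · rw [totalι_π_of_ne _ _ _ _ _ _ _ _ hi, ← Category.assoc, totalι_π_of_ne _ _ _ _ _ _ _ _ hi,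
      comp_zero, zero_comp]

lemma total_d_π (i j n i' j' n' : ℤ) (h : i' + j' = n') (hi : i + 1 = i') (hj : j + 1 = j')
    (hn : n + 1 = n') :
    ((totalize Φ).obj F).d n n' ≫ totalπ Φ F i' j' n' h =
      totalπ Φ F i j' n (by omega) ≫ (Φ.map (F.obj.d i i')).f j' +
      i'.negOnePow • (totalπ Φ F i' j n (by omega) ≫ (Φ.obj (F.obj.X i')).d j j') := by
  refine total_hom_ext fun k l hkl => ?_
  rw [← Category.assoc, totalι_d Φ k l n (k + 1) (l + 1) n' hkl rfl rfl hn, Preadditive.add_comp,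
    Preadditive.comp_add, Linear.units_smul_comp, Linear.comp_units_smul]
  simp only [Category.assoc]
  congr 1
  · by_cases hk : k = i
    · subst hk
      obtain rfl : l = j' := by omega
      subst hi
      rw [totalι_π, ← Category.assoc, totalι_π, Category.comp_id, Category.id_comp]
    · rw [totalι_π_of_ne _ _ _ _ _ _ _ _ (by omega), ← Category.assoc,
        totalι_π_of_ne _ _ _ _ _ _ _ _ hk, comp_zero, zero_comp]
  · by_cases hk : k = i'
    · subst hk
      obtain rfl : l = j := by omega
      subst hj
      rw [totalι_π, ← Category.assoc, totalι_π, Category.comp_id, Category.id_comp]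
    · rw [totalι_π_of_ne _ _ _ _ _ _ _ _ hk, ← Category.assoc,
        totalι_π_of_ne _ _ _ _ _ _ _ _ hk, comp_zero, zero_comp, smul_zero, smul_zero]

instance : (totalize Φ).Additive where
  map_add {F G f g} := by
    ext n : 1
    refine total_hom_ext fun i j h => ?_
    rw [totalι_map, HomologicalComplex.add_f_apply, Preadditive.comp_add, totalι_map, totalι_map,
      ← Preadditive.add_comp, ← HomologicalComplex.add_f_apply, ← Φ.map_add]
    rfl

end Totalize

end

section

set_option linter.unusedSimpArgs false

/-! ### Cochains between total complexes, and total complexes of mapping cones -/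

section TotalCochain

open CochainComplex CochainComplex.HomComplex

variable {C D : Type*} [Category* C] [Category* D] [Preadditive C] [Preadditive D]
  [HasFiniteCoproducts D] (Φ : C ⥤ CochainComplex D ℤ) [Φ.Additive] {F G H : BddCx C}

/-- The cochain between total complexes that is induced by a cochain. -/
noncomputable def totalCochain {k : ℤ} (z : Cochain F.obj G.obj k) :
    Cochain ((totalize Φ).obj F) ((totalize Φ).obj G) k :=
  Cochain.mk fun p q hpq => totalDesc Φ fun i j h =>
    (Φ.map (z.v i (i + k) rfl)).f j ≫ totalι Φ G (i + k) j q (by omega)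

lemma totalι_totalCochain {k : ℤ} (z : Cochain F.obj G.obj k) {i j n i' n' : ℤ} (h : i + j = n)
    (hi : i + k = i') (hn : n + k = n') :
    totalι Φ F i j n h ≫ (totalCochain Φ z).v n n' hn =
      (Φ.map (z.v i i' hi)).f j ≫ totalι Φ G i' j n' (by omega) := by
  subst hi
  rw [totalCochain, Cochain.mk_v, totalι_desc]

lemma totalCochain_comp {k l m : ℤ} (z : Cochain F.obj G.obj k) (y : Cochain G.obj H.obj l)
    (h : k + l = m) :
    totalCochain Φ (z.comp y h) = (totalCochain Φ z).comp (totalCochain Φ y) h := by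
  refine Cochain.ext _ _ fun p q hpq => total_hom_ext fun i j hij => ?_
  rw [totalι_totalCochain Φ _ hij rfl, Cochain.comp_v _ _ h p (p + k) q rfl (by omega),
    ← Category.assoc, totalι_totalCochain Φ z hij rfl, Category.assoc,
    totalι_totalCochain Φ y (by omega) (show i + k + l = i + m by omega),
    Cochain.comp_v _ _ h i (i + k) (i + m) rfl (by omega), Φ.map_comp, HomologicalComplex.comp_f,
    Category.assoc]

lemma totalCochain_add {k : ℤ} (z y : Cochain F.obj G.obj k) :
    totalCochain Φ (z + y) = totalCochain Φ z + totalCochain Φ y := by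
  refine Cochain.ext _ _ fun p q hpq => total_hom_ext fun i j hij => ?_
  rw [Cochain.add_v, Preadditive.comp_add]
  simp only [totalι_totalCochain Φ _ hij rfl, Cochain.add_v, Φ.map_add,
    HomologicalComplex.add_f_apply, Preadditive.add_comp]

lemma totalCochain_zero {k : ℤ} : totalCochain Φ (0 : Cochain F.obj G.obj k) = 0 := by
  simpa using totalCochain_add Φ (0 : Cochain F.obj G.obj k) 0

lemma totalCochain_ofHom (f : F ⟶ G) :
    totalCochain Φ (Cochain.ofHom f.hom) = Cochain.ofHom ((totalize Φ).map f) := by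
  refine Cochain.ext₀ _ _ fun p => total_hom_ext fun i j hij => ?_
  rw [totalι_totalCochain Φ _ hij (add_zero i), Cochain.ofHom_v, Cochain.ofHom_v, totalι_map]

lemma totalCochain_id (F : BddCx C) :
    totalCochain Φ (Cochain.ofHom (𝟙 F : F ⟶ F).hom) = Cochain.ofHom (𝟙 ((totalize Φ).obj F)) := by
  rw [totalCochain_ofHom, CategoryTheory.Functor.map_id]

/-- `Φ(z)` commutes with the differential of `Φ`, and the two terms that contain this differential
have the opposite signs `(-1)^(i+k)` and `(-1)^(k+1) (-1)^i`. They cancel, and what remains is `Φ`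
applied to `δ z`. -/
lemma δ_totalCochain {k l : ℤ} (z : Cochain F.obj G.obj k) (h : k + 1 = l) :
    δ k l (totalCochain Φ z) = totalCochain Φ (δ k l z) := by
  refine Cochain.ext _ _ fun p q hpq => total_hom_ext fun i j hij => ?_
  rw [δ_v k l h _ p q hpq (p + k) (p + 1) (by omega) rfl, Preadditive.comp_add, ← Category.assoc,
    totalι_totalCochain Φ z hij rfl, Category.assoc,
    totalι_d Φ (i + k) j (p + k) (i + l) (j + 1) q (by omega) (by omega) rfl (by omega),
    Linear.comp_units_smul, ← Category.assoc,
    totalι_d Φ i j p (i + 1) (j + 1) (p + 1) hij rfl rfl rfl,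
    totalι_totalCochain Φ (δ k l z) hij rfl,
    δ_v k l h z i (i + l) rfl (i + k) (i + 1) (by omega) rfl]
  simp only [Preadditive.add_comp, Preadditive.comp_add, Category.assoc, smul_add,
    Linear.comp_units_smul, Linear.units_smul_comp,
    totalι_totalCochain Φ z (show i + 1 + j = p + 1 by omega) (show i + 1 + k = i + l by omega)
      (show p + 1 + k = q by omega),
    totalι_totalCochain Φ z (show i + (j + 1) = p + 1 by omega) rfl
      (show p + 1 + k = q by omega)]
  have e : (Φ.map (z.v i (i + k) rfl)).f j ≫ (Φ.obj (G.obj.X (i + k))).d j (j + 1) ≫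
      totalι Φ G (i + k) (j + 1) q (by omega) = (Φ.obj (F.obj.X i)).d j (j + 1) ≫
      (Φ.map (z.v i (i + k) rfl)).f (j + 1) ≫ totalι Φ G (i + k) (j + 1) q (by omega) := by
    rw [HomologicalComplex.Hom.comm_assoc]
  have e' : Φ.map (l.negOnePow • F.obj.d i (i + 1) ≫ z.v (i + 1) (i + l) (by omega)) =
      l.negOnePow • Φ.map (F.obj.d i (i + 1)) ≫ Φ.map (z.v (i + 1) (i + l) (by omega)) := by
    rw [← Φ.map_comp, ← Functor.map_units_smul]
  rw [e, Φ.map_add, e', Φ.map_comp]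
  simp only [HomologicalComplex.add_f_apply, Preadditive.add_comp,
    HomologicalComplex.units_smul_f_apply, HomologicalComplex.comp_f, Linear.units_smul_comp,
    Category.assoc, smul_smul]
  rw [add_assoc]
  congr 1
  have hs : (i + k).negOnePow = -(l.negOnePow * i.negOnePow) := by
    rw [← h, Int.negOnePow_succ, Int.negOnePow_add, neg_mul, neg_neg, mul_comm]
  rw [add_comm (l.negOnePow • _), ← add_assoc, hs, Units.neg_smul, neg_add_cancel, zero_add]

section Cone

variable [HasZeroObject C] [HasBinaryBiproducts C] [HasBinaryBiproducts D]

lemma bounded_mappingCone (f : F ⟶ G) : bounded C (mappingCone f.hom) := by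
  obtain ⟨F, a, b, ha, hb⟩ := F
  obtain ⟨G, a', b', ha', hb'⟩ := G
  -- The term of degree `i` of the cone is made of `F^{i+1}` and `G^i`, whence the shift by one for
  -- `F`.
  refine ⟨min (a - 1) a', max (b - 1) b', ?_, ?_⟩
  · rw [isStrictlyGE_iff]
    intro i hi
    rw [mappingCone.isZero_X_iff]
    exact ⟨F.isZero_of_isStrictlyGE a _ (by omega), G.isZero_of_isStrictlyGE a' _ (by omega)⟩
  · rw [isStrictlyLE_iff]
    intro i hi
    rw [mappingCone.isZero_X_iff]
    exact ⟨F.isZero_of_isStrictlyLE b _ (by omega), G.isZero_of_isStrictlyLE b' _ (by omega)⟩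

/-- The mapping cone of a morphism of bounded complexes. -/
noncomputable def coneB (f : F ⟶ G) : BddCx C := ⟨mappingCone f.hom, bounded_mappingCone f⟩

/-- The inclusion of the target in the mapping cone. -/
noncomputable def coneInr (f : F ⟶ G) : G ⟶ coneB f := ObjectProperty.homMk (mappingCone.inr f.hom)

/-- The inclusion of the source in the mapping cone. -/
noncomputable def coneInl (f : F ⟶ G) : Cochain F.obj (coneB f).obj (-1) := mappingCone.inl f.hom

/-- The projection of the mapping cone to the source. -/
noncomputable def coneFst (f : F ⟶ G) : Cochain (coneB f).obj F.obj 1 := (mappingCone.fst f.hom).1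

/-- The projection of the mapping cone to the target. -/
noncomputable def coneSnd (f : F ⟶ G) : Cochain (coneB f).obj G.obj 0 := mappingCone.snd f.hom

lemma coneInl_fst (f : F ⟶ G) :
    (coneInl f).comp (coneFst f) (neg_add_cancel 1) = Cochain.ofHom (𝟙 F : F ⟶ F).hom :=
  mappingCone.inl_fst f.hom

lemma coneInl_snd (f : F ⟶ G) : (coneInl f).comp (coneSnd f) (add_zero (-1)) = 0 :=
  mappingCone.inl_snd f.hom

lemma coneInr_fst (f : F ⟶ G) :
    (Cochain.ofHom (coneInr f).hom).comp (coneFst f) (zero_add 1) = 0 :=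
  mappingCone.inr_fst f.hom

lemma coneInr_snd (f : F ⟶ G) :
    (Cochain.ofHom (coneInr f).hom).comp (coneSnd f) (zero_add 0) =
      Cochain.ofHom (𝟙 G : G ⟶ G).hom :=
  mappingCone.inr_snd f.hom

lemma cone_id (f : F ⟶ G) :
    (coneFst f).comp (coneInl f) (add_neg_cancel 1) +
      (coneSnd f).comp (Cochain.ofHom (coneInr f).hom) (add_zero 0) =
        Cochain.ofHom (𝟙 (coneB f) : coneB f ⟶ coneB f).hom :=
  mappingCone.id f.hom

lemma δ_coneInl (f : F ⟶ G) : δ (-1) 0 (coneInl f) = Cochain.ofHom (f ≫ coneInr f).hom :=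
  mappingCone.δ_inl f.hom

lemma δ_coneFst (f : F ⟶ G) : δ 1 2 (coneFst f) = 0 := (mappingCone.fst f.hom).δ_eq_zero 2

lemma δ_coneSnd (f : F ⟶ G) :
    δ 0 1 (coneSnd f) = -(coneFst f).comp (Cochain.ofHom f.hom) (add_zero 1) :=
  mappingCone.δ_snd f.hom

lemma δ_totalCochain_coneSnd (f : F ⟶ G) :
    δ 0 1 (totalCochain Φ (coneSnd f)) +
      (totalCochain Φ (coneFst f)).comp
        (Cochain.ofHom ((totalize Φ).map f)) (add_zero 1) = 0 := by
  rw [δ_totalCochain Φ _ (zero_add 1), ← totalCochain_ofHom, ← totalCochain_comp,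
    ← totalCochain_add, δ_coneSnd, neg_add_cancel, totalCochain_zero]

/-- The image of the projection to the source of a mapping cone. -/
noncomputable def totalConeFst (f : F ⟶ G) :
    Cocycle ((totalize Φ).obj (coneB f)) ((totalize Φ).obj F) 1 :=
  Cocycle.mk (totalCochain Φ (coneFst f)) 2 (by norm_num) (by
    rw [δ_totalCochain Φ _ (by norm_num), δ_coneFst, totalCochain_zero])

/-- The comparison of the mapping cone of total complexes with the total complex of the mapping
cone. -/
noncomputable def totalConeHom (f : F ⟶ G) :
    mappingCone ((totalize Φ).map f) ⟶ (totalize Φ).obj (coneB f) :=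
  mappingCone.desc _ (totalCochain Φ (coneInl f)) ((totalize Φ).map (coneInr f)) (by
    rw [δ_totalCochain Φ _ (neg_add_cancel 1), ← Functor.map_comp, ← totalCochain_ofHom,
      δ_coneInl])

/-- The inverse of `totalConeHom`. -/
noncomputable def totalConeInv (f : F ⟶ G) :
    (totalize Φ).obj (coneB f) ⟶ mappingCone ((totalize Φ).map f) :=
  mappingCone.lift _ (totalConeFst Φ f) (totalCochain Φ (coneSnd f))
    (by exact δ_totalCochain_coneSnd Φ f)

lemma inl_totalConeHom (f : F ⟶ G) :
    (mappingCone.inl ((totalize Φ).map f)).comp (Cochain.ofHom (totalConeHom Φ f)) (add_zero _) =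
      totalCochain Φ (coneInl f) :=
  mappingCone.inl_desc _ _ _ _

lemma inr_totalConeHom (f : F ⟶ G) :
    mappingCone.inr ((totalize Φ).map f) ≫ totalConeHom Φ f = (totalize Φ).map (coneInr f) :=
  mappingCone.inr_desc _ _ _ _

lemma totalConeInv_fst (f : F ⟶ G) :
    (Cochain.ofHom (totalConeInv Φ f)).comp (mappingCone.fst ((totalize Φ).map f)).1 (zero_add 1) =
      totalCochain Φ (coneFst f) :=
  mappingCone.lift_fst _ _ _ _

lemma totalConeInv_snd (f : F ⟶ G) :
    (Cochain.ofHom (totalConeInv Φ f)).comp (mappingCone.snd ((totalize Φ).map f)) (zero_add 0) =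
      totalCochain Φ (coneSnd f) :=
  mappingCone.lift_snd _ _ _ _

/-- The total complex of a mapping cone is the mapping cone of the total complexes. -/
noncomputable def totalConeIso (f : F ⟶ G) :
    mappingCone ((totalize Φ).map f) ≅ (totalize Φ).obj (coneB f) where
  hom := totalConeHom Φ f
  inv := totalConeInv Φ f
  hom_inv_id := by
    apply Cochain.ofHom_injective
    -- An endomorphism of a cone is a matrix with four entries. Each entry is `totalCochain` of one
    -- of the relations between the inclusions and the projections of the cone of `f`.
    rw [mappingCone.ext_cochain_from_iff _ (-1) 0 (neg_add_cancel 1)]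
    rw [mappingCone.ext_cochain_to_iff _ (-1) 0 (neg_add_cancel 1),
      mappingCone.ext_cochain_to_iff _ 0 1 (zero_add 1)]
    rw [Cochain.ofHom_comp, ← Cochain.comp_assoc_of_second_is_zero_cochain, inl_totalConeHom,
      ← Cochain.comp_assoc_of_first_is_zero_cochain, ← Cochain.ofHom_comp, inr_totalConeHom]
    simp only [Cochain.comp_assoc_of_second_is_zero_cochain,
      Cochain.comp_assoc_of_first_is_zero_cochain, totalConeInv_fst, totalConeInv_snd,
      ← totalCochain_comp, ← totalCochain_ofHom,
      coneInl_fst, coneInl_snd, coneInr_fst, coneInr_snd, totalCochain_zero, totalCochain_id]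
    simp
  inv_hom_id := by
    apply Cochain.ofHom_injective
    -- The identity of the cone is inserted between the two maps and written as `fst · inl + snd ·
    -- inr`. The composite then becomes `totalCochain` of the same decomposition for `coneB f`.
    rw [← Category.id_comp (totalConeHom Φ f), Cochain.ofHom_comp, Cochain.ofHom_comp,
      ← mappingCone.id, Cochain.add_comp, Cochain.comp_add,
      Cochain.comp_assoc _ _ _ (add_neg_cancel 1) (add_zero (-1)) (by norm_num), inl_totalConeHom,
      Cochain.comp_assoc_of_third_is_zero_cochain, ← Cochain.ofHom_comp, inr_totalConeHom,
      ← Cochain.comp_assoc_of_first_is_zero_cochain,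
      ← Cochain.comp_assoc_of_first_is_zero_cochain, totalConeInv_fst, totalConeInv_snd,
      ← totalCochain_ofHom, ← totalCochain_comp, ← totalCochain_comp, ← totalCochain_add, cone_id,
      totalCochain_id]

end Cone

end TotalCochain

end

section

/-! ### Total complexes of short exact sequences -/

section Exactness

open CochainComplex CochainComplex.HomComplex

variable {C D : Type*} [Category* C] [Category* D] [Abelian C] [Abelian D]
  (Φ : C ⥤ CochainComplex D ℤ) [Φ.Additive]

/-- In the homotopy category, the quasi-isomorphisms are the morphisms whose cone lies in the
triangulated subcategory of acyclic complexes. -/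
lemma quasiIso_iff_acyclic_mappingCone {F G : CochainComplex C ℤ} (f : F ⟶ G) :
    QuasiIso f ↔ (mappingCone f).Acyclic := by
  rw [← HomotopyCategory.quotient_obj_mem_subcategoryAcyclic_iff_acyclic,
    ← HomologicalComplex.mem_quasiIso_iff, ← HomotopyCategory.quotient_map_mem_quasiIso_iff,
    HomotopyCategory.quasiIso_eq_trW_subcategoryAcyclic]
  exact ObjectProperty.trW_iff_of_distinguished _ _
    (HomotopyCategory.mappingCone_triangleh_distinguished f)

section ShortExact

variable {S : ShortComplex (CochainComplex C ℤ)} (hS : S.ShortExact)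
include hS

lemma acyclic_X₂_of_shortExact (h₁ : S.X₁.Acyclic) (h₃ : S.X₃.Acyclic) : S.X₂.Acyclic := by
  intro n
  rw [HomologicalComplex.exactAt_iff_isZero_homology]
  refine (hS.homology_exact₂ n).isZero_of_both_zeros ?_ ?_
  · exact ((HomologicalComplex.exactAt_iff_isZero_homology _ _).1 (h₁ _)).eq_of_src _ _
  · exact ((HomologicalComplex.exactAt_iff_isZero_homology _ _).1 (h₃ _)).eq_of_tgt _ _

end ShortExact

/-- A functor to complexes that is exact in every degree. -/
def DegreewiseExact : Prop := ∀ (S : ShortComplex C), S.ShortExact → ∀ j : ℤ,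
  (S.map (Φ ⋙ HomologicalComplex.eval D (ComplexShape.up ℤ) j)).ShortExact

variable {Φ}

/-- In each degree the sequence is a finite direct sum of short exact sequences. The projections
detect monomorphisms, the inclusions detect epimorphisms. -/
lemma totalize_shortExact (hΦ : DegreewiseExact Φ) (S : ShortComplex (BddCx C))
    (hS : (S.map (bounded C).ι).ShortExact) : (S.map (totalize Φ)).ShortExact := by
  refine HomologicalComplex.shortExact_of_degreewise_shortExact _ fun n => ?_
  have h (i j : ℤ) : (ShortComplex.mk ((Φ.map (S.f.hom.f i)).f j) ((Φ.map (S.g.hom.f i)).f j)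
      (by rw [← HomologicalComplex.comp_f, ← Φ.map_comp, ← HomologicalComplex.comp_f,
        ← ObjectProperty.FullSubcategory.comp_hom, S.zero]
          exact (congrArg (fun t => HomologicalComplex.Hom.f t j) (Φ.map_zero _ _)))).ShortExact :=
    hΦ _ (hS.map_of_exact (HomologicalComplex.eval C (ComplexShape.up ℤ) i)) j
  let f := ((totalize Φ).map S.f).f n
  let g := ((totalize Φ).map S.g).f n
  have w : f ≫ g = 0 := by
    rw [← HomologicalComplex.comp_f, ← Functor.map_comp, S.zero, Functor.map_zero]
    rfl
  change (ShortComplex.mk f g w).ShortExact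
  have hf : Mono f := Preadditive.mono_of_cancel_zero _ fun x hx => total_hom_ext_to fun i j hij => by
    have := (h i j).mono_f
    rw [← cancel_mono ((Φ.map (S.f.hom.f i)).f j), zero_comp, zero_comp, Category.assoc,
      ← total_map_π, ← Category.assoc, hx, zero_comp]
  have hg : Epi g := Preadditive.epi_of_cancel_zero _ fun x hx => total_hom_ext fun i j hij => by
    have := (h i j).epi_g
    rw [← cancel_epi ((Φ.map (S.g.hom.f i)).f j), comp_zero, comp_zero, ← totalι_map_assoc, hx,
      comp_zero]
  refine { exact := ShortComplex.exact_of_f_is_kernel _ (KernelFork.IsLimit.ofι' f w fun x hx => ?_) }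
  have hx' (i j : ℤ) (hij : i + j = n) : (x ≫ totalπ Φ S.X₂ i j n hij) ≫ (Φ.map (S.g.hom.f i)).f j = 0 := by
    rw [Category.assoc, ← total_map_π, ← Category.assoc, hx, zero_comp]
  -- The factorization through the kernel is assembled from the factorizations in the summands.
  refine ⟨totalLift Φ fun i j hij => (h i j).fIsKernel.lift (KernelFork.ofι _ (hx' i j hij)), ?_⟩
  refine total_hom_ext_to fun i j hij => ?_
  rw [Category.assoc, total_map_π, ← Category.assoc, totalLift_π]
  exact (h i j).fIsKernel.fac (KernelFork.ofι _ (hx' i j hij)) WalkingParallelPair.zero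

end Exactness

end

section

/-! ### Total complexes preserve quasi-isomorphisms -/

section Devissage

open CochainComplex CochainComplex.HomComplex

variable {C D : Type*} [Category* C] [Category* D] [Abelian C] [Abelian D]

lemma acyclic_X₃_of_shortExact {S : ShortComplex (CochainComplex C ℤ)} (hS : S.ShortExact)
    (h₁ : S.X₁.Acyclic) (h₂ : S.X₂.Acyclic) : S.X₃.Acyclic := by
  intro n
  rw [HomologicalComplex.exactAt_iff_isZero_homology]
  refine (hS.homology_exact₃ n (n + 1) (by simp)).isZero_of_both_zeros ?_ ?_
  · exact ((HomologicalComplex.exactAt_iff_isZero_homology _ _).1 (h₂ _)).eq_of_src _ _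
  · exact ((HomologicalComplex.exactAt_iff_isZero_homology _ _).1 (h₁ _)).eq_of_tgt _ _

lemma exactAt_iff_exact (F : CochainComplex C ℤ) (i j k : ℤ) (h : i + 1 = j) (h' : j + 1 = k) :
    F.ExactAt j ↔ (ShortComplex.mk (F.d i j) (F.d j k) (F.d_comp_d i j k)).Exact :=
  F.exactAt_iff' i j k (by simp; omega) (by simp; omega)

lemma acyclic_of_isZero {F : CochainComplex C ℤ} (h : ∀ i, IsZero (F.X i)) : F.Acyclic := by
  intro n
  exact ShortComplex.exact_of_isZero_X₂ _ (h n)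

/-- A complex whose identity is the boundary of a cochain is acyclic. -/
lemma acyclic_of_δ_eq_id {F : CochainComplex C ℤ} (z : Cochain F F (-1))
    (hz : δ (-1) 0 z = Cochain.ofHom (𝟙 F)) : F.Acyclic := by
  have ho : Homotopy (𝟙 F) (0 : F ⟶ F) := (Cochain.equivHomotopy _ _).symm
    ⟨z, by rw [hz, Cochain.ofHom_zero, add_zero]⟩
  intro n
  rw [HomologicalComplex.exactAt_iff_isZero_homology, IsZero.iff_id_eq_zero]
  rw [← HomologicalComplex.homologyMap_id, ho.homologyMap_eq, HomologicalComplex.homologyMap_zero]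

/-- An acyclic complex concentrated in two degrees is contractible. -/
lemma exists_δ_eq_id (F : CochainComplex C ℤ) (a b : ℤ) (hab : a + 1 = b) [F.IsStrictlyGE a]
    [F.IsStrictlyLE b] (hF : F.Acyclic) :
    ∃ z : Cochain F F (-1), δ (-1) 0 z = Cochain.ofHom (𝟙 F) := by
  have h₁ : Mono (F.d a b) :=
    ((exactAt_iff_exact F (a - 1) a b (by omega) hab).1 (hF a)).mono_g
      ((F.isZero_of_isStrictlyGE a _ (by omega)).eq_of_src _ _)
  have h₂ : Epi (F.d a b) :=
    ((exactAt_iff_exact F a b (b + 1) hab rfl).1 (hF b)).epi_f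
      ((F.isZero_of_isStrictlyLE b _ (by omega)).eq_of_tgt _ _)
  have : IsIso (F.d a b) := isIso_of_mono_of_epi _
  -- The only differential between nonzero terms is invertible, and its inverse is the contraction.
  refine ⟨Cochain.single (inv (F.d a b)) (-1), Cochain.ext₀ _ _ fun p => ?_⟩
  rw [Cochain.ofHom_v]
  by_cases hp : p = b
  · subst hp
    rw [δ_v (-1) 0 (by norm_num) _ p p (by omega) a (p + 1) (by omega) rfl, Cochain.single_v,
      Cochain.single_v_eq_zero _ _ _ _ _ (by omega), IsIso.inv_hom_id, comp_zero, smul_zero,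
      add_zero]
    rfl
  · by_cases hp' : p = a
    · subst hp'
      rw [δ_v (-1) 0 (by norm_num) _ p p (by omega) (p - 1) b rfl (by omega), Cochain.single_v,
        Cochain.single_v_eq_zero _ _ _ _ _ (by omega), IsIso.hom_inv_id, zero_comp, zero_add,
        Int.negOnePow_zero, one_smul]
      rfl
    · rcases lt_or_gt_of_ne hp with h | h
      · exact (F.isZero_of_isStrictlyGE a p (by omega)).eq_of_src _ _
      · exact (F.isZero_of_isStrictlyLE b p (by omega)).eq_of_src _ _

variable (Φ : C ⥤ CochainComplex D ℤ) [Φ.Additive]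

/-- Truncation alters a complex only from degree `n` on. Since `truncLE` is dual to `truncGE`, the
claim is checked in the opposite category, at an index `n - k` with `k > 0` that is not on the
boundary of the embedding. -/
lemma isIso_ιTruncLE_f (F : CochainComplex C ℤ) (n i : ℤ) (hi : i < n) :
    IsIso ((F.ιTruncLE n).f i) := by
  obtain ⟨k, rfl⟩ : ∃ k : ℕ, i = n - k := ⟨(n - i).toNat, by omega⟩
  have hk : ¬ (ComplexShape.embeddingUpIntLE n).BoundaryLE k := by
    rw [ComplexShape.boundaryLE_embeddingUpIntLE_iff]
    omega
  have : IsIso ((HomologicalComplex.πTruncGE (HomologicalComplex.op F)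
      (ComplexShape.embeddingUpIntLE n).op).f (n - k)) := by
    have := (HomologicalComplex.op F).isIso_restrictionToTruncGE'
      (ComplexShape.embeddingUpIntLE n).op k (by simpa using hk)
    exact ((ComplexShape.embeddingUpIntLE n).op.isIso_liftExtend_f_iff
      (i := k) (i' := n - k) _ _ rfl).2 this
  exact inferInstanceAs (IsIso ((HomologicalComplex.πTruncGE (HomologicalComplex.op F)
      (ComplexShape.embeddingUpIntLE n).op).f (n - k)).unop)

variable {Φ}

/-- Induction on the length of `F`. The truncation at `b - 1` is acyclic and shorter. The quotient
by it is acyclic and lives in the degrees `b - 1` and `b`, so it has a contraction, which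
`totalCochain` carries over to the total complex. -/
lemma acyclic_totalize (hΦ : DegreewiseExact Φ) (F : BddCx C) (hF : F.obj.Acyclic) :
    ((totalize Φ).obj F).Acyclic := by
  obtain ⟨a, b, ha, hb⟩ := id F.property
  obtain ⟨n, hn⟩ : ∃ n : ℕ, b - a < n := ⟨(b - a + 1).toNat, by omega⟩
  induction n generalizing F b with
  | zero =>
    refine acyclic_of_isZero fun k => (IsZero.iff_id_eq_zero _).2 (total_hom_ext fun i j h => ?_)
    refine (isZero_totalX Φ ?_).eq_of_src _ _
    by_cases hi : i < a
    · exact F.obj.isZero_of_isStrictlyGE a _ hi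
    · exact F.obj.isZero_of_isStrictlyLE b _ (by push_cast at hn; omega)
  | succ n ih =>
    let S := F.obj.shortComplexTruncLE (b - 1)
    have hS : S.ShortExact := F.obj.shortComplexTruncLE_shortExact (b - 1)
    have ha₁ : S.X₁.IsStrictlyGE a := inferInstanceAs ((F.obj.truncLE (b - 1)).IsStrictlyGE a)
    have hb₁ : S.X₁.IsStrictlyLE (b - 1) :=
      inferInstanceAs ((F.obj.truncLE (b - 1)).IsStrictlyLE (b - 1))
    have hb₃ : S.X₃.IsStrictlyLE b := by
      rw [isStrictlyLE_iff]
      intro i hi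
      have : Epi (S.g.f i) := (hS.map_of_exact
        (HomologicalComplex.eval C (ComplexShape.up ℤ) i)).epi_g
      exact IsZero.of_epi (S.g.f i) (F.obj.isZero_of_isStrictlyLE b i hi)
    -- Below `b - 1` the inclusion of the truncation is an isomorphism, so the quotient vanishes
    -- there.
    have ha₃ : S.X₃.IsStrictlyGE (b - 1) := by
      rw [isStrictlyGE_iff]
      intro i hi
      have h := hS.map_of_exact (HomologicalComplex.eval C (ComplexShape.up ℤ) i)
      have : Epi (S.g.f i) := h.epi_g
      have : IsIso (S.f.f i) := isIso_ιTruncLE_f F.obj (b - 1) i hi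
      refine IsZero.of_epi_eq_zero (S.g.f i) ?_
      rw [← cancel_epi (S.f.f i), comp_zero, ← HomologicalComplex.comp_f, S.zero]
      rfl
    have hA₁ : S.X₁.Acyclic := HomologicalComplex.Acyclic.truncLE hF _
    have hA₃ := acyclic_X₃_of_shortExact hS hA₁ hF
    let T : ShortComplex (BddCx C) := ShortComplex.mk
      (X₁ := ⟨S.X₁, a, b - 1, ha₁, hb₁⟩) (X₂ := F) (X₃ := ⟨S.X₃, b - 1, b, ha₃, hb₃⟩)
      (ObjectProperty.homMk S.f) (ObjectProperty.homMk S.g)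
      (by ext1; exact S.zero)
    refine acyclic_X₂_of_shortExact (totalize_shortExact hΦ T hS) ?_ ?_
    · exact ih T.X₁ hA₁ (b - 1) ha₁ hb₁ (by push_cast at hn; omega)
    · obtain ⟨z, hz⟩ := exists_δ_eq_id S.X₃ (b - 1) b (by omega) hA₃
      refine acyclic_of_δ_eq_id (totalCochain Φ (F := T.X₃) (G := T.X₃) z) ?_
      refine (δ_totalCochain Φ (F := T.X₃) (G := T.X₃) z (by norm_num)).trans ?_
      exact (congrArg (totalCochain Φ (F := T.X₃) (G := T.X₃)) hz).trans (totalCochain_id Φ T.X₃)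

/-- Total complexes preserve quasi-isomorphisms. -/
lemma quasiIso_totalize (hΦ : DegreewiseExact Φ) {F G : BddCx C} (f : F ⟶ G)
    (hf : QuasiIso f.hom) : QuasiIso ((totalize Φ).map f) := by
  rw [quasiIso_iff_acyclic_mappingCone] at hf ⊢
  exact fun i => (acyclic_totalize hΦ (coneB f) hf i).of_iso (totalConeIso Φ f).symm

/-- The filtration of a complex by its lowest term. -/
lemma exists_shortExact_single (F : BddCx C) (a b : ℤ) (ha : F.obj.IsStrictlyGE a)
    (hb : F.obj.IsStrictlyLE b) (hab : a ≤ b) :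
    ∃ (S : ShortComplex (BddCx C)), S.X₂ = F ∧ (S.map (bounded C).ι).ShortExact ∧
      S.X₁.obj.IsStrictlyGE (a + 1) ∧ S.X₁.obj.IsStrictlyLE b ∧
      S.X₃.obj = (HomologicalComplex.single C (ComplexShape.up ℤ) a).obj (F.obj.X a) := by
  -- The lowest term is a quotient of the complex, since no nonzero term maps to it. The kernel
  -- consists of the terms above it.
  let p : F.obj ⟶ (HomologicalComplex.single C (ComplexShape.up ℤ) a).obj (F.obj.X a) :=
    HomologicalComplex.mkHomToSingle (𝟙 _) fun i hi =>
      (F.obj.isZero_of_isStrictlyGE a i (by simp at hi; omega)).eq_of_src _ _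
  have hp (i : ℤ) : Epi (p.f i) := by
    by_cases hi : i = a
    · subst hi
      rw [HomologicalComplex.mkHomToSingle_f]
      infer_instance
    · exact ⟨fun _ _ _ => (HomologicalComplex.isZero_single_obj_X _ _ _ _ hi).eq_of_src _ _⟩
  have hp' : Epi p := HomologicalComplex.epi_of_epi_f p hp
  have hS : (ShortComplex.mk (kernel.ι p) p (kernel.condition p)).ShortExact :=
    { exact := ShortComplex.exact_kernel p }
  have hm (i : ℤ) : Mono ((kernel.ι p).f i) := inferInstance
  have h₁ : (kernel p).IsStrictlyLE b := by
    rw [isStrictlyLE_iff]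
    exact fun i hi => IsZero.of_mono ((kernel.ι p).f i) (F.obj.isZero_of_isStrictlyLE b i hi)
  have h₂ : (kernel p).IsStrictlyGE (a + 1) := by
    rw [isStrictlyGE_iff]
    intro i hi
    by_cases hi' : i = a
    · subst hi'
      refine IsZero.of_mono_eq_zero ((kernel.ι p).f i) ?_
      have : Mono (p.f i) := by
        rw [HomologicalComplex.mkHomToSingle_f]
        infer_instance
      rw [← cancel_mono (p.f i), zero_comp, ← HomologicalComplex.comp_f, kernel.condition]
      rfl
    · exact IsZero.of_mono ((kernel.ι p).f i) (F.obj.isZero_of_isStrictlyGE a i (by omega))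
  refine ⟨ShortComplex.mk (X₁ := ⟨kernel p, a + 1, b, h₂, h₁⟩) (X₂ := F)
    (X₃ := ⟨_, a, a, inferInstance, inferInstance⟩) (ObjectProperty.homMk (kernel.ι p))
    (ObjectProperty.homMk p) (by ext1; exact kernel.condition p), rfl, hS, h₂, h₁, rfl⟩

end Devissage

end

section

/-! ### The bounded derived category as a localization of the category of bounded complexes -/

section BoundedHomotopy

open CochainComplex Pretriangulated Triangulated HomotopicalAlgebra

section

variable (C : Type*) [Category* C] [Preadditive C]

/-- The bounded complexes among the complexes that are bounded below, up to homotopy. -/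
def bddAbove : ObjectProperty (HomotopyCategory.Plus C) := fun K =>
  ∃ L : BddCx C, Nonempty ((HomotopyCategory.quotient C (ComplexShape.up ℤ)).obj L.obj ≅ K.obj)

lemma bounded_shift (K : BddCx C) (n : ℤ) :
    bounded C ((CategoryTheory.shiftFunctor (CochainComplex C ℤ) n).obj K.obj) := by
  obtain ⟨K, a, b, ha, hb⟩ := K
  exact ⟨a - n, b - n, K.isStrictlyGE_shift a n (a - n) (by lia),
    K.isStrictlyLE_shift b n (b - n) (by lia)⟩

instance : (bounded C).IsStableUnderShift ℤ where
  isStableUnderShiftBy n := { le_shift := fun K hK => bounded_shift C ⟨K, hK⟩ n }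

lemma plus_quotient (K : BddCx C) :
    HomotopyCategory.plus C ((HomotopyCategory.quotient C (ComplexShape.up ℤ)).obj K.obj) := by
  obtain ⟨K, a, b, ha, hb⟩ := K
  exact (HomotopyCategory.plus_quotient_obj_iff K).2 ⟨a, ha⟩

open ZeroObject in
instance [HasZeroObject C] : (bddAbove C).ContainsZero where
  exists_zero := by
    let Z : BddCx C := ⟨(0 : CochainComplex C ℤ), 0, 0, inferInstance, inferInstance⟩
    have hZ : IsZero ((HomotopyCategory.quotient C (ComplexShape.up ℤ)).obj Z.obj) :=
      Functor.map_isZero _ (isZero_zero (CochainComplex C ℤ))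
    exact ⟨⟨_, plus_quotient C Z⟩, (IsZero.iff_id_eq_zero _).2
      ((HomotopyCategory.Plus.ι C).map_injective (hZ.eq_of_src _ _)), Z, ⟨Iso.refl _⟩⟩

instance : (bddAbove C).IsStableUnderShift ℤ where
  isStableUnderShiftBy n :=
    { le_shift := by
        rintro K ⟨L, ⟨e⟩⟩
        exact ⟨⟨_, bounded_shift C L n⟩,
          ⟨((HomotopyCategory.quotient C (ComplexShape.up ℤ)).commShiftIso n).app L.obj ≪≫
            (CategoryTheory.shiftFunctor (HomotopyCategory C (ComplexShape.up ℤ)) n).mapIso e ≪≫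
              (((HomotopyCategory.Plus.ι C).commShiftIso n).symm.app K)⟩⟩ }

/-- A morphism of the homotopy category between bounded complexes lifts to a morphism of complexes,
whose cone is again bounded. -/
instance [HasZeroObject C] [HasBinaryBiproducts C] : (bddAbove C).IsTriangulatedClosed₃ where
  ext₃' T hT := by
    rintro ⟨L₁, ⟨e₁⟩⟩ ⟨L₂, ⟨e₂⟩⟩
    obtain ⟨f : L₁.obj ⟶ L₂.obj, hf⟩ :=
      (HomotopyCategory.quotient C (ComplexShape.up ℤ)).map_surjective
        (e₁.hom ≫ T.mor₁.hom ≫ e₂.inv)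
    refine ⟨_, ⟨coneB (ObjectProperty.homMk f), ⟨?_⟩⟩, ⟨Iso.refl _⟩⟩
    exact Triangle.π₃.mapIso (isoTriangleOfIso₁₂ _ _
      (HomotopyCategory.mappingCone_triangleh_distinguished f)
      ((HomotopyCategory.Plus.ι C).map_distinguished T hT) e₁ e₂ (by
        change (HomotopyCategory.quotient C (ComplexShape.up ℤ)).map f ≫ e₂.hom =
          e₁.hom ≫ T.mor₁.hom
        rw [hf, Category.assoc, Category.assoc, Iso.inv_hom_id, Category.comp_id]))

instance [HasZeroObject C] [HasBinaryBiproducts C] : (bddAbove C).IsTriangulated where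
  toIsTriangulatedClosed₂ := .of_isTriangulatedClosed₃

/-- The homotopy category of bounded complexes. -/
abbrev BddHo := (bddAbove C).FullSubcategory

/-- The functor to the homotopy category. -/
noncomputable def quotientB : BddCx C ⥤ BddHo C :=
  (bddAbove C).lift ((HomotopyCategory.plus C).lift
    ((bounded C).ι ⋙ HomotopyCategory.quotient C (ComplexShape.up ℤ)) (plus_quotient C))
    fun K => ⟨K, ⟨Iso.refl _⟩⟩

instance : (quotientB C).EssSurj where
  mem_essImage K := by
    obtain ⟨L, ⟨e⟩⟩ := K.property
    exact ⟨L, ⟨(bddAbove C).ι.preimageIso ((HomotopyCategory.Plus.ι C).preimageIso e)⟩⟩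

instance : (quotientB C).Full where
  map_surjective {K L} f := by
    obtain ⟨g, hg⟩ := (HomotopyCategory.quotient C (ComplexShape.up ℤ)).map_surjective f.hom.hom
    exact ⟨ObjectProperty.homMk g, by ext; exact hg⟩

variable {C} in
lemma isIso_quotientB_map_iff {K L : BddCx C} (f : K ⟶ L) :
    IsIso ((quotientB C).map f) ↔
      HomologicalComplex.homotopyEquivalences C (ComplexShape.up ℤ) f.hom := by
  rw [← isIso_iff_of_reflects_iso _ (bddAbove C).ι,
    ← isIso_iff_of_reflects_iso _ (HomotopyCategory.Plus.ι C),
    ← HomotopyCategory.inverseImage_quotient_isomorphisms]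
  rfl

lemma bounded_cylinder [HasBinaryBiproducts C] (K : BddCx C) :
    bounded C (HomologicalComplex.cylinder K.obj) := by
  obtain ⟨K, a, b, ha, hb⟩ := K
  obtain ⟨n, hn⟩ := plus_cylinder K ⟨a, ha⟩
  refine ⟨n, b, hn, ?_⟩
  rw [CochainComplex.isStrictlyLE_iff]
  intro i hi
  -- The term of degree `i` of the cylinder is made of two copies of `K^i` and one of `K^{i+1}`.
  refine HomologicalComplex.homotopyCofiber.isZero_X
    (biprod.lift (𝟙 K) (-𝟙 K)) i ?_ (fun j hj => ?_)
  · refine IsZero.of_iso ?_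
      ((HomologicalComplex.eval C (ComplexShape.up ℤ) i).mapBiprod _ _)
    exact (biprod_isZero_iff _ _).2 ⟨K.isZero_of_isStrictlyLE b i hi,
      K.isZero_of_isStrictlyLE b i hi⟩
  · simp only [ComplexShape.up_Rel] at hj
    exact K.isZero_of_isStrictlyLE b _ (by lia)

/-- Homotopic morphisms factor through a cylinder that is itself bounded, so inverting homotopy
equivalences already identifies them. As `quotientB` is full and essentially surjective, it is the
localization. -/
instance [HasZeroObject C] [HasBinaryBiproducts C] : (quotientB C).IsLocalization
    ((HomologicalComplex.homotopyEquivalences C (ComplexShape.up ℤ)).inverseImage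
      (bounded C).ι) :=
  Functor.isLocalization_of_essSurj_of_full_of_exists_cylinders _ _
    (fun _ _ f hf => (isIso_quotientB_map_iff f).2 hf) (by
    rintro K L f₀ f₁ hf
    have hf' := HomotopyCategory.homotopyOfEq f₀.hom f₁.hom
      (((bddAbove C).ι ⋙ HomotopyCategory.Plus.ι C).congr_map hf)
    let P : Precylinder K := K.obj.precylinder.toFullSubcategory (bounded_cylinder C K)
    exact ⟨P,
      { h := ObjectProperty.homMk (HomologicalComplex.cylinder.desc _ _ hf')
        h₀ := by ext1; exact HomologicalComplex.cylinder.ι₀_desc _ _ _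
        h₁ := by ext1; exact HomologicalComplex.cylinder.ι₁_desc _ _ _ },
      ⟨HomologicalComplex.cylinder.homotopyEquiv _ (fun n => ⟨n - 1, by simp⟩), rfl⟩⟩)

end

section

variable (C : Type*) [Category* C] [Abelian C]

/-- Verdier's criterion for the localization of bounded complexes to embed in that of the bounded
below ones: a morphism from a bounded complex to an acyclic one factors through a truncation of the
target, which is acyclic and bounded. -/
instance : (bddAbove C).IsVerdierLeftLocalizing (HomotopyCategory.Plus.subcategoryAcyclic C) where
  fac {K L} φ hK hL := by
    obtain ⟨K', ⟨e⟩⟩ := hK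
    obtain ⟨_, n, _, hn⟩ := id K'.property
    obtain ⟨a, ha⟩ : CochainComplex.plus C L.obj.as := by
      rw [← HomotopyCategory.plus_quotient_obj_iff]
      exact L.property
    obtain ⟨f : K'.obj ⟶ L.obj.as, hf⟩ :=
      (HomotopyCategory.quotient C (ComplexShape.up ℤ)).map_surjective (e.hom ≫ φ.hom)
    have hL' : HomologicalComplex.Acyclic L.obj.as :=
      (HomotopyCategory.quotient_obj_mem_subcategoryAcyclic_iff_acyclic _).1 hL
    let L' : CochainComplex C ℤ := L.obj.as
    have : L'.IsStrictlyGE a := ha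
    let Z : BddCx C := ⟨L'.truncLE n, a, n, inferInstance, inferInstance⟩
    -- Here `n` is an upper bound for the degrees of `K'`, so `K'` coincides with its truncation and
    -- maps to the truncation of `L'`.
    refine ⟨⟨_, plus_quotient C Z⟩, ObjectProperty.homMk (e.inv ≫
      (HomotopyCategory.quotient _ _).map (inv (K'.obj.ιTruncLE n) ≫ CochainComplex.truncLEMap f n)),
      ObjectProperty.homMk ((HomotopyCategory.quotient _ _).map (L'.ιTruncLE n)),
      ⟨Z, ⟨Iso.refl _⟩⟩, ?_, ?_⟩
    · exact (HomotopyCategory.quotient_obj_mem_subcategoryAcyclic_iff_acyclic _).2 (hL'.truncLE _)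
    · ext
      change (e.inv ≫ (HomotopyCategory.quotient _ _).map _) ≫
        (HomotopyCategory.quotient _ _).map _ = φ.hom
      rw [Category.assoc, ← Functor.map_comp, Category.assoc, CochainComplex.ιTruncLE_naturality,
        IsIso.inv_hom_id_assoc, hf]
      exact e.inv_hom_id_assoc φ.hom

variable [HasDerivedCategory.{w} C]

/-- The functor from the homotopy category of bounded complexes to the derived category. -/
noncomputable def boundedQh : BddHo C ⥤ DerivedCategory.Bounded C :=
  ObjectProperty.lift _ ((bddAbove C).ι ⋙ HomotopyCategory.Plus.ι C ⋙ DerivedCategory.Qh) (by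
    rintro ⟨X, K, ⟨e⟩⟩
    obtain ⟨a, b, ha, hb⟩ := id K.property
    let e' : DerivedCategory.Q.obj K.obj ≅ DerivedCategory.Qh.obj X.obj :=
      (DerivedCategory.quotientCompQhIso C).symm.app K.obj ≪≫ DerivedCategory.Qh.mapIso e
    exact ⟨⟨a, DerivedCategory.TStructure.t.isGE_of_iso e' a⟩,
      ⟨b, DerivedCategory.TStructure.t.isLE_of_iso e' b⟩⟩)

/-- The bounded derived category is contained in the bounded below derived category. -/
noncomputable def boundedToPlus : DerivedCategory.Bounded C ⥤ DerivedCategory.Plus C :=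
  ObjectProperty.lift _ DerivedCategory.Bounded.ι fun X => X.property.1

instance : (boundedToPlus C).Full := by dsimp only [boundedToPlus]; infer_instance
instance : (boundedToPlus C).Faithful := by dsimp only [boundedToPlus]; infer_instance

instance : (boundedQ C).EssSurj where
  mem_essImage := by
    rintro ⟨X, ⟨a, ha⟩, ⟨b, hb⟩⟩
    obtain ⟨K, e, hK⟩ := ha
    have h : (DerivedCategory.Q.obj K).IsLE b := DerivedCategory.TStructure.t.isLE_of_iso e b
    rw [DerivedCategory.isLE_Q_obj_iff] at h
    let K' : BddCx C := ⟨K.truncLE b, a, b, inferInstance, inferInstance⟩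
    have : IsIso (DerivedCategory.Q.map (CochainComplex.ιTruncLE K b)) :=
      (DerivedCategory.isIso_Q_map_iff_quasiIso C _).2 ((K.quasiIso_ιTruncLE_iff b).2 h)
    exact ⟨K', ⟨DerivedCategory.Bounded.ι.preimageIso
      (@asIso _ _ _ _ _ this ≪≫ e.symm)⟩⟩

/-- The factorization of `boundedQ` through the homotopy category. -/
noncomputable def quotientBCompQh : quotientB C ⋙ boundedQh C ≅ boundedQ C :=
  (ObjectProperty.fullyFaithfulι _ |>.whiskeringRight _).preimageIso
    (Functor.isoWhiskerLeft (bounded C).ι (DerivedCategory.quotientCompQhIso C))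

instance : (boundedQh C).EssSurj where
  mem_essImage X := ⟨_, ⟨(quotientBCompQh C).app ((boundedQ C).objPreimage X) ≪≫
    (boundedQ C).objObjPreimageIso X⟩⟩

/-- By the Verdier condition the localized inclusion into the bounded below derived category is
fully faithful, as is `boundedToPlus`; and `boundedQh` is essentially surjective. -/
instance : (boundedQh C).IsLocalization
    ((HomotopyCategory.Plus.subcategoryAcyclic C).inverseImage (bddAbove C).ι).trW :=
  ((bddAbove C).triangulatedLocalizerMorphism
    (HomotopyCategory.Plus.subcategoryAcyclic C)).isLocalization_of_isLocalizedFullyFaithful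
      (L₂ := DerivedCategory.Plus.Qh) (L₁ := boundedQh C) (F := boundedToPlus C) (Iso.refl _)

instance : (boundedQh C).mapArrow.EssSurj :=
  Localization.essSurj_mapArrow _
    ((HomotopyCategory.Plus.subcategoryAcyclic C).inverseImage (bddAbove C).ι).trW

/-- The quasi-isomorphisms of bounded complexes. -/
def quasiIsoB : MorphismProperty (BddCx C) :=
  (HomologicalComplex.quasiIso C (ComplexShape.up ℤ)).inverseImage (bounded C).ι

variable {C} in
lemma isIso_boundedQ_map_iff {K L : BddCx C} (f : K ⟶ L) :
    IsIso ((boundedQ C).map f) ↔ quasiIsoB C f := by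
  rw [← isIso_iff_of_reflects_iso _ DerivedCategory.Bounded.ι]
  exact DerivedCategory.isIso_Q_map_iff_quasiIso C f.hom

/-- The localization is performed in two stages, first at the homotopy equivalences and then in the
homotopy category. -/
instance : (boundedQ C).IsLocalization (quasiIsoB C) := by
  have : (quotientB C ⋙ boundedQh C).IsLocalization (quasiIsoB C) := by
    refine Functor.IsLocalization.comp (quotientB C) (boundedQh C)
      ((HomologicalComplex.homotopyEquivalences C (ComplexShape.up ℤ)).inverseImage (bounded C).ι)
      ((HomotopyCategory.Plus.subcategoryAcyclic C).inverseImage (bddAbove C).ι).trW _ ?_ ?_ ?_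
    · intro K L f hf
      rw [← NatIso.isIso_map_iff (quotientBCompQh C).symm, isIso_boundedQ_map_iff]
      exact hf
    · intro K L f hf
      rw [← isIso_boundedQ_map_iff, NatIso.isIso_map_iff (quotientBCompQh C).symm]
      have := (isIso_quotientB_map_iff f).2 hf
      dsimp only [Functor.comp_map]
      infer_instance
    -- By fullness of `quotientB`, a morphism inverted in the second stage is isomorphic, as an
    -- arrow, to the image of a quasi-isomorphism of bounded complexes.
    · intro K L f hf
      have hf' := Localization.inverts (boundedQh C) _ f hf
      let e := (quotientB C).objObjPreimageIso
      obtain ⟨g, hg⟩ := (quotientB C).map_surjective ((e K).hom ≫ f ≫ (e L).inv)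
      refine ⟨_, _, g, ?_, ⟨Arrow.isoMk (e K) (e L) ?_⟩⟩
      · rw [← isIso_boundedQ_map_iff, NatIso.isIso_map_iff (quotientBCompQh C).symm]
        dsimp only [Functor.comp_map]
        rw [hg, Functor.map_comp, Functor.map_comp]
        infer_instance
      · dsimp
        rw [hg]
        simp
  exact Functor.IsLocalization.of_iso _ (quotientBCompQh C)

end

end BoundedHomotopy

end

section

/-! ### Total complexes and shifts -/

section Shift

variable {C D : Type*} [Category* C] [Category* D] [Preadditive C] [Preadditive D]
  [HasFiniteCoproducts D] (Φ : C ⥤ CochainComplex D ℤ) [Φ.Additive] {F G : BddCx C}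

/-- The shift of a bounded complex, with the shift of complexes as the underlying complex. -/
noncomputable def shiftB (F : BddCx C) (n : ℤ) : BddCx C := ⟨_, bounded_shift C F n⟩

/-- The shift of a morphism of bounded complexes. -/
noncomputable def shiftBMap (f : F ⟶ G) (n : ℤ) : shiftB F n ⟶ shiftB G n :=
  ObjectProperty.homMk ((shiftFunctor (CochainComplex C ℤ) n).map f.hom)

/-- The comparison with the shift on the full subcategory. -/
noncomputable def shiftBIso (F : BddCx C) (n : ℤ) : F⟦n⟧ ≅ shiftB F n :=
  (bounded C).fullyFaithfulι.preimageIso (((bounded C).ι.commShiftIso n).app F)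

/-- The isomorphism between equal terms of a bounded complex. -/
noncomputable def eqTerm (F : BddCx C) {i i' : ℤ} (h : i = i') : F.obj.X i ⟶ F.obj.X i' :=
  (F.obj.XIsoOfEq h).hom

lemma totalι_eqTerm {i i' j n n' : ℤ} (hi : i = i') (h : i + j = n) (h' : i' + j = n')
    (hn : n = n') :
    (Φ.map (eqTerm F hi)).f j ≫ totalι Φ F i' j n' h' =
      totalι Φ F i j n h ≫ (((totalize Φ).obj F).XIsoOfEq hn).hom := by
  subst hi hn
  rw [eqTerm, HomologicalComplex.XIsoOfEq_rfl, HomologicalComplex.XIsoOfEq_rfl]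
  simp

variable (F) in
/-- The inclusion of a summand of the total complex of a shifted complex. -/
noncomputable def shiftι (n i j k : ℤ) (h : i + j = k) :
    (Φ.obj (F.obj.X (i + n))).X j ⟶ ((totalize Φ).obj (shiftB F n)).X k :=
  totalι Φ (shiftB F n) i j k h

/-- A morphism from the total complex of a shifted complex, given by its restrictions to the
summands. -/
noncomputable def shiftDesc {n k : ℤ} {A : D}
    (f : ∀ i j (_ : i + j = k), (Φ.obj (F.obj.X (i + n))).X j ⟶ A) :
    ((totalize Φ).obj (shiftB F n)).X k ⟶ A :=
  totalDesc Φ (F := shiftB F n) f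

lemma shiftι_desc {n k : ℤ} {A : D}
    (f : ∀ i j (_ : i + j = k), (Φ.obj (F.obj.X (i + n))).X j ⟶ A) (i j : ℤ) (h : i + j = k) :
    shiftι Φ F n i j k h ≫ shiftDesc Φ f = f i j h :=
  totalι_desc Φ (F := shiftB F n) f i j h

lemma shiftι_desc_assoc {n k : ℤ} {A B : D}
    (f : ∀ i j (_ : i + j = k), (Φ.obj (F.obj.X (i + n))).X j ⟶ A) (i j : ℤ) (h : i + j = k)
    (g : A ⟶ B) : shiftι Φ F n i j k h ≫ shiftDesc Φ f ≫ g = f i j h ≫ g := by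
  rw [← Category.assoc, shiftι_desc]

variable {Φ} in
lemma shift_hom_ext {n k : ℤ} {A : D} {f g : ((totalize Φ).obj (shiftB F n)).X k ⟶ A}
    (h : ∀ i j (h : i + j = k), shiftι Φ F n i j k h ≫ f = shiftι Φ F n i j k h ≫ g) : f = g :=
  total_hom_ext (F := shiftB F n) h

lemma shiftι_d (n i j k i' j' k' : ℤ) (h : i + j = k) (hi : i + 1 = i') (hj : j + 1 = j')
    (hk : k + 1 = k') :
    shiftι Φ F n i j k h ≫ ((totalize Φ).obj (shiftB F n)).d k k' =
      n.negOnePow • ((Φ.map (F.obj.d (i + n) (i' + n))).f j ≫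
        shiftι Φ F n i' j k' (by omega)) +
      i.negOnePow • ((Φ.obj (F.obj.X (i + n))).d j j' ≫ shiftι Φ F n i j' k' (by omega)) := by
  refine (totalι_d Φ (F := shiftB F n) i j k i' j' k' h hi hj hk).trans ?_
  congr 1
  have : Φ.map (n.negOnePow • F.obj.d (i + n) (i' + n)) =
      n.negOnePow • Φ.map (F.obj.d (i + n) (i' + n)) := Functor.map_units_smul _ _ _
  refine (congrArg (fun t : Φ.obj (F.obj.X (i + n)) ⟶ Φ.obj (F.obj.X (i' + n)) =>
    t.f j ≫ shiftι Φ F n i' j k' (by omega)) this).trans ?_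
  rw [HomologicalComplex.units_smul_f_apply, Linear.units_smul_comp]

lemma shiftι_shiftBMap (f : F ⟶ G) (n i j k : ℤ) (h : i + j = k) :
    shiftι Φ F n i j k h ≫ ((totalize Φ).map (shiftBMap f n)).f k =
      (Φ.map (f.hom.f (i + n))).f j ≫ shiftι Φ G n i j k h :=
  totalι_map Φ (shiftBMap f n) i j k h

/-- The components of the compatibility of total complexes with shifts. -/
noncomputable def totalShiftX (F : BddCx C) (n k : ℤ) :
    ((totalize Φ).obj (shiftB F n)).X k ≅ ((totalize Φ).obj F).X (k + n) where
  hom := shiftDesc Φ fun i j h => totalι Φ F (i + n) j (k + n) (by omega)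
  inv := totalDesc Φ fun i j h =>
    (Φ.map (eqTerm F (show i = i - n + n by omega))).f j ≫ shiftι Φ F n (i - n) j k (by omega)
  hom_inv_id := by
    refine shift_hom_ext fun i j h => ?_
    rw [shiftι_desc_assoc, totalι_desc, Category.comp_id]
    refine (totalι_eqTerm Φ (F := shiftB F n) (show i = i + n - n by omega) h _ rfl).trans ?_
    rw [HomologicalComplex.XIsoOfEq_rfl]
    exact Category.comp_id _
  inv_hom_id := by
    refine total_hom_ext fun i j h => ?_
    rw [totalι_desc_assoc, Category.assoc, shiftι_desc, Category.comp_id,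
      totalι_eqTerm Φ _ h _ rfl, HomologicalComplex.XIsoOfEq_rfl]
    exact Category.comp_id _

lemma shiftι_totalShiftX (n i j k : ℤ) (h : i + j = k) :
    shiftι Φ F n i j k h ≫ (totalShiftX Φ F n k).hom =
      totalι Φ F (i + n) j (k + n) (by omega) :=
  shiftι_desc Φ (fun i j h => totalι Φ F (i + n) j (k + n) (by omega)) i j h

/-- The identification of the terms needs no sign: `(-1)^n` times the sign `(-1)^(i+n)` of the total
complex of `F` is the sign `(-1)^i` of the total complex of the shift. -/
lemma totalShiftX_d (F : BddCx C) (n k k' : ℤ) (hk : k + 1 = k') :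
    (totalShiftX Φ F n k).hom ≫ (n.negOnePow • ((totalize Φ).obj F).d (k + n) (k' + n)) =
      ((totalize Φ).obj (shiftB F n)).d k k' ≫ (totalShiftX Φ F n k').hom := by
  refine shift_hom_ext fun i j h => ?_
  rw [← Category.assoc, shiftι_totalShiftX, ← Category.assoc,
    shiftι_d Φ n i j k (i + 1) (j + 1) k' h rfl rfl hk, Linear.comp_units_smul,
    totalι_d Φ (i + n) j (k + n) (i + 1 + n) (j + 1) (k' + n) _ (by omega) rfl (by omega),
    Preadditive.add_comp, Linear.units_smul_comp, Linear.units_smul_comp, Category.assoc,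
    Category.assoc, shiftι_totalShiftX, shiftι_totalShiftX, smul_add, smul_smul]
  congr 2
  rw [Int.negOnePow_add, mul_left_comm, Int.units_mul_self, mul_one]

/-- The compatibility of total complexes with shifts. -/
noncomputable def totalShift (F : BddCx C) (n : ℤ) :
    (totalize Φ).obj (shiftB F n) ≅ ((totalize Φ).obj F)⟦n⟧ :=
  HomologicalComplex.Hom.isoOfComponents (fun k => totalShiftX Φ F n k)
    fun k k' hk => totalShiftX_d Φ F n k k' hk

lemma shiftι_totalShift (n i j k : ℤ) (h : i + j = k) :
    shiftι Φ F n i j k h ≫ (totalShift Φ F n).hom.f k =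
      totalι Φ F (i + n) j (k + n) (by omega) :=
  shiftι_desc Φ (fun i j h => totalι Φ F (i + n) j (k + n) (by omega)) i j h

lemma totalShift_naturality (f : F ⟶ G) (n : ℤ) :
    (totalize Φ).map (shiftBMap f n) ≫ (totalShift Φ G n).hom =
      (totalShift Φ F n).hom ≫ ((totalize Φ).map f)⟦n⟧' := by
  ext k
  refine shift_hom_ext fun i j h => ?_
  refine Eq.trans (b := (Φ.map (f.hom.f (i + n))).f j ≫ totalι Φ G (i + n) j (k + n) (by omega))
    ?_ ?_
  · rw [HomologicalComplex.comp_f, ← Category.assoc, shiftι_shiftBMap, Category.assoc]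
    exact congrArg _ (shiftι_totalShift Φ n i j k h)
  · rw [HomologicalComplex.comp_f, ← Category.assoc]
    refine Eq.trans ?_ (congrArg (· ≫ ((totalize Φ).map f).f (k + n))
      (shiftι_totalShift Φ n i j k h).symm)
    exact (totalι_map Φ f _ _ _ _).symm

/-- The comparison of the unshifted complex with the complex shifted by zero. -/
noncomputable def shiftBZero (F : BddCx C) : shiftB F 0 ⟶ F :=
  ObjectProperty.homMk ((shiftFunctorZero (CochainComplex C ℤ) ℤ).hom.app F.obj)

lemma shiftBIso_zero (F : BddCx C) :
    (shiftBIso F 0).hom ≫ shiftBZero F = (shiftFunctorZero (BddCx C) ℤ).hom.app F := by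
  apply (bounded C).ι.map_injective
  have := NatTrans.congr_app (congrArg Iso.hom ((bounded C).ι.commShiftIso_zero ℤ)) F
  rw [Functor.CommShift.isoZero_hom_app] at this
  refine (congrArg (· ≫ (shiftFunctorZero (CochainComplex C ℤ) ℤ).hom.app F.obj) this).trans ?_
  exact (Category.assoc _ _ _).trans ((congrArg _
    ((shiftFunctorZero (CochainComplex C ℤ) ℤ).inv_hom_id_app F.obj)).trans (Category.comp_id _))

lemma totalShift_zero (F : BddCx C) :
    (totalShift Φ F 0).hom = (totalize Φ).map (shiftBZero F) ≫
      (shiftFunctorZero (CochainComplex D ℤ) ℤ).inv.app ((totalize Φ).obj F) := by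
  ext k
  change (totalShiftX Φ F 0 k).hom = ((totalize Φ).map (shiftBZero F)).f k ≫
    (((totalize Φ).obj F).XIsoOfEq (add_zero k).symm).hom
  refine shift_hom_ext fun i j h => ?_
  have h₁ : shiftι Φ F 0 i j k h ≫ ((totalize Φ).map (shiftBZero F)).f k =
      (Φ.map (eqTerm F (add_zero i))).f j ≫ totalι Φ F i j k h := by
    refine (totalι_map Φ (shiftBZero F) i j k h).trans ?_
    refine congrArg (fun t : F.obj.X (i + 0) ⟶ F.obj.X i => (Φ.map t).f j ≫ totalι Φ F i j k h) ?_
    exact CochainComplex.shiftFunctorZero_hom_app_f F.obj i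
  rw [shiftι_totalShiftX, reassoc_of% h₁, ← Category.assoc,
    totalι_eqTerm Φ (add_zero i) (show i + 0 + j = k + 0 by omega) h (add_zero k), Category.assoc,
    HomologicalComplex.XIsoOfEq_hom_comp_XIsoOfEq_hom, HomologicalComplex.XIsoOfEq_rfl,
    Iso.refl_hom, Category.comp_id]

/-- The comparison of iterated shifts with a single shift. -/
noncomputable def shiftBAdd (F : BddCx C) (a b : ℤ) : shiftB F (a + b) ⟶ shiftB (shiftB F a) b :=
  ObjectProperty.homMk ((shiftFunctorAdd (CochainComplex C ℤ) a b).hom.app F.obj)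

lemma shiftBIso_add (F : BddCx C) (a b : ℤ) :
    (shiftBIso F (a + b)).hom ≫ shiftBAdd F a b =
      (shiftFunctorAdd (BddCx C) a b).hom.app F ≫ (shiftBIso (F⟦a⟧) b).hom ≫
        shiftBMap (shiftBIso F a).hom b := by
  apply (bounded C).ι.map_injective
  have := NatTrans.congr_app (congrArg Iso.hom ((bounded C).ι.commShiftIso_add a b)) F
  rw [Functor.CommShift.isoAdd_hom_app] at this
  refine (congrArg (· ≫ (shiftFunctorAdd (CochainComplex C ℤ) a b).hom.app F.obj) this).trans ?_
  exact (Category.assoc _ _ _).trans (congrArg _ ((Category.assoc _ _ _).trans (congrArg _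
    ((Category.assoc _ _ _).trans ((congrArg _
    ((shiftFunctorAdd (CochainComplex C ℤ) a b).inv_hom_id_app F.obj)).trans
      (Category.comp_id _))))))

lemma totalShift_add (F : BddCx C) (a b : ℤ) :
    (totalShift Φ F (a + b)).hom = (totalize Φ).map (shiftBAdd F a b) ≫
      (totalShift Φ (shiftB F a) b).hom ≫ ((totalShift Φ F a).hom)⟦b⟧' ≫
      (shiftFunctorAdd (CochainComplex D ℤ) a b).inv.app ((totalize Φ).obj F) := by
  ext k
  change (totalShiftX Φ F (a + b) k).hom = ((totalize Φ).map (shiftBAdd F a b)).f k ≫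
    (totalShiftX Φ (shiftB F a) b k).hom ≫ (totalShiftX Φ F a (k + b)).hom ≫
    (((totalize Φ).obj F).XIsoOfEq (show k + b + a = k + (a + b) by omega)).hom
  refine shift_hom_ext fun i j h => ?_
  -- The morphism `σ` is the inclusion of a summand for the twofold shift. Its source is written as
  -- a term of `F`, so that only transports along equalities of indices remain to be compared.
  obtain ⟨σ, h₁, h₂⟩ : ∃ σ : (Φ.obj (F.obj.X (i + b + a))).X j ⟶
      ((totalize Φ).obj (shiftB (shiftB F a) b)).X k,
      shiftι Φ F (a + b) i j k h ≫ ((totalize Φ).map (shiftBAdd F a b)).f k =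
        (Φ.map (eqTerm F (show i + (a + b) = i + b + a by omega))).f j ≫ σ ∧
      σ ≫ (totalShiftX Φ (shiftB F a) b k).hom ≫ (totalShiftX Φ F a (k + b)).hom =
        totalι Φ F (i + b + a) j (k + b + a) (by omega) := by
    refine ⟨shiftι Φ (shiftB F a) b i j k h, ?_, ?_⟩
    · refine (totalι_map Φ (shiftBAdd F a b) i j k h).trans ?_
      refine congrArg (fun t : F.obj.X (i + (a + b)) ⟶ F.obj.X (i + b + a) =>
        (Φ.map t).f j ≫ shiftι Φ (shiftB F a) b i j k h) ?_
      exact CochainComplex.shiftFunctorAdd_hom_app_f F.obj a b i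
    · refine (Category.assoc _ _ _).symm.trans ((congrArg (· ≫ (totalShiftX Φ F a (k + b)).hom)
        (shiftι_totalShiftX Φ (F := shiftB F a) b i j k h)).trans ?_)
      exact shiftι_totalShiftX Φ a (i + b) j (k + b) (by omega)
  rw [shiftι_totalShiftX, reassoc_of% h₁, reassoc_of% h₂, ← Category.assoc,
    totalι_eqTerm Φ _ (show i + (a + b) + j = k + (a + b) by omega) _
      (show k + (a + b) = k + b + a by omega), Category.assoc,
    HomologicalComplex.XIsoOfEq_hom_comp_XIsoOfEq_hom, HomologicalComplex.XIsoOfEq_rfl,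
    Iso.refl_hom, Category.comp_id]

/-- The shift of `BddCx C` is first replaced by the termwise shift `shiftB`. The coherence
conditions then follow from `totalShift_zero`, `totalShift_add` and the compatibilities of
`shiftBIso`. -/
noncomputable instance : (totalize Φ).CommShift ℤ where
  commShiftIso n := NatIso.ofComponents
    (fun F => (totalize Φ).mapIso (shiftBIso F n) ≪≫ totalShift Φ F n) fun {F G} f => by
      have : (shiftFunctor (BddCx C) n).map f ≫ (shiftBIso G n).hom =
          (shiftBIso F n).hom ≫ shiftBMap f n :=
        (bounded C).ι.map_injective (((bounded C).ι.commShiftIso n).hom.naturality f)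
      dsimp only [Iso.trans_hom, Functor.mapIso_hom, Functor.comp_map]
      rw [← Functor.map_comp_assoc, this, Functor.map_comp_assoc, totalShift_naturality,
        Category.assoc]
  commShiftIso_zero := by
    ext F : 3
    rw [Functor.CommShift.isoZero_hom_app, ← shiftBIso_zero, Functor.map_comp, Category.assoc,
      ← totalShift_zero]
    rfl
  commShiftIso_add a b := by
    ext F : 3
    rw [Functor.CommShift.isoAdd_hom_app]
    change (totalize Φ).map (shiftBIso F (a + b)).hom ≫ (totalShift Φ F (a + b)).hom =
      (totalize Φ).map ((shiftFunctorAdd (BddCx C) a b).hom.app F) ≫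
        ((totalize Φ).map (shiftBIso (F⟦a⟧) b).hom ≫ (totalShift Φ (F⟦a⟧) b).hom) ≫
        ((totalize Φ).map (shiftBIso F a).hom ≫ (totalShift Φ F a).hom)⟦b⟧' ≫
        (shiftFunctorAdd (CochainComplex D ℤ) a b).inv.app ((totalize Φ).obj F)
    have h := totalShift_naturality Φ (shiftBIso F a).hom b
    rw [totalShift_add, ← Functor.map_comp_assoc, shiftBIso_add]
    simp only [Functor.map_comp, Category.assoc]
    rw [reassoc_of% h]

end Shift

end

section

/-! ### Triangles of mapping cones -/

section ConeTriangle

open CochainComplex HomComplex Pretriangulated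

section

variable {C : Type*} [Category* C] [Preadditive C] [HasZeroObject C] [HasBinaryBiproducts C]
  {F G : BddCx C}

/-- The third morphism of the triangle of a mapping cone. -/
noncomputable def coneTo (f : F ⟶ G) : coneB f ⟶ shiftB F 1 :=
  ObjectProperty.homMk (mappingCone.triangle f.hom).mor₃

variable {𝒟 𝒟' : Type*} [Category* 𝒟] [Category* 𝒟'] [HasShift 𝒟 ℤ] [HasShift 𝒟' ℤ]

/-- The image under a functor of the triangle of a mapping cone. -/
noncomputable def coneTriangle (H : BddCx C ⥤ 𝒟) [H.CommShift ℤ] (f : F ⟶ G) : Triangle 𝒟 :=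
  Triangle.mk (H.map f) (H.map (coneInr f))
    (H.map (coneTo f ≫ (shiftBIso F 1).inv) ≫ (H.commShiftIso (1 : ℤ)).hom.app F)

/-- Triangles of mapping cones and composition of functors. -/
noncomputable def coneTriangleComp (H : BddCx C ⥤ 𝒟) [H.CommShift ℤ] (E : 𝒟 ⥤ 𝒟')
    [E.CommShift ℤ] (f : F ⟶ G) :
    E.mapTriangle.obj (coneTriangle H f) ≅ coneTriangle (H ⋙ E) f :=
  Triangle.isoMk _ _ (Iso.refl _) (Iso.refl _) (Iso.refl _)
    ((Category.comp_id _).trans (Category.id_comp _).symm)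
    ((Category.comp_id _).trans (Category.id_comp _).symm) (by
      change (E.map (H.map _ ≫ (H.commShiftIso (1 : ℤ)).hom.app F) ≫
        (E.commShiftIso (1 : ℤ)).hom.app (H.obj F)) ≫
        (CategoryTheory.shiftFunctor 𝒟' (1 : ℤ)).map (𝟙 _) =
        𝟙 _ ≫ E.map (H.map _) ≫ ((H ⋙ E).commShiftIso (1 : ℤ)).hom.app F
      rw [CategoryTheory.Functor.map_id, Functor.commShiftIso_comp_hom_app, Functor.map_comp]
      exact (Category.comp_id _).trans ((Category.assoc _ _ _).trans (Category.id_comp _).symm))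

/-- Triangles of mapping cones and isomorphisms of functors. -/
noncomputable def coneTriangleCongr {H H' : BddCx C ⥤ 𝒟} [H.CommShift ℤ] [H'.CommShift ℤ]
    (e : H ≅ H') [NatTrans.CommShift e.hom ℤ] (f : F ⟶ G) :
    coneTriangle H f ≅ coneTriangle H' f :=
  Triangle.isoMk _ _ (e.app F) (e.app G) (e.app (coneB f)) (e.hom.naturality f)
    (e.hom.naturality (coneInr f)) (by
      change (H.map _ ≫ (H.commShiftIso (1 : ℤ)).hom.app F) ≫ (e.hom.app F)⟦(1 : ℤ)⟧' =
        e.hom.app _ ≫ H'.map _ ≫ (H'.commShiftIso (1 : ℤ)).hom.app F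
      rw [Category.assoc, NatTrans.shift_app_comm, NatTrans.naturality_assoc])

variable [HasZeroObject 𝒟] [Preadditive 𝒟] [∀ n : ℤ, (CategoryTheory.shiftFunctor 𝒟 n).Additive]
  [Pretriangulated 𝒟]

lemma coneTriangle_lift_distinguished (P : ObjectProperty 𝒟) [P.IsTriangulated]
    (H : BddCx C ⥤ 𝒟) [H.CommShift ℤ] (hP : ∀ F, P (H.obj F)) (f : F ⟶ G)
    (hf : coneTriangle H f ∈ distTriang 𝒟) :
    coneTriangle (P.lift H hP) f ∈ distTriang P.FullSubcategory := by
  rw [← P.ι.map_distinguished_iff]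
  exact isomorphic_distinguished _ hf _ (coneTriangleComp _ _ _ ≪≫
    coneTriangleCongr (P.liftCompιIso H hP) f)

end

section

variable {C D : Type*} [Category* C] [Category* D] [Preadditive C] [Preadditive D]
  [HasZeroObject C] [HasBinaryBiproducts C] [HasBinaryBiproducts D] [HasFiniteCoproducts D]
  (Φ : C ⥤ CochainComplex D ℤ) [Φ.Additive] {F G : BddCx C}

/-- The sign comes from the third morphism of the triangle of a mapping cone, which is minus the
projection to the source. -/
lemma totalι_coneInl_coneTo (f : F ⟶ G) (i i' j p p' : ℤ) (h : i + j = p) (hi : i + (-1) = i')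
    (hp : p + (-1) = p') :
    totalι Φ F i j p h ≫ (totalCochain Φ (coneInl f)).v p p' hp ≫
      ((totalize Φ).map (coneTo f)).f p' ≫ (totalShift Φ F 1).hom.f p' =
    -(totalι Φ F i j p h ≫ (((totalize Φ).obj F).XIsoOfEq (show p = p' + 1 by omega)).hom) := by
  have h₀ : totalι Φ (coneB f) i' j p' (by omega) ≫ ((totalize Φ).map (coneTo f)).f p' =
      (Φ.map ((coneTo f).hom.f i' : _ ⟶ F.obj.X (i' + 1))).f j ≫
        shiftι Φ F 1 i' j p' (by omega) :=
    totalι_map Φ (coneTo f) i' j p' _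
  have h₁ : (mappingCone.inl f.hom).v i i' hi ≫ ((coneTo f).hom.f i' : _ ⟶ F.obj.X (i' + 1)) =
      -eqTerm F (show i = i' + 1 by omega) :=
    mappingCone.inl_v_triangle_mor₃_f f.hom i i' hi
  have h₂ : totalι Φ (coneB f) i' j p' (by omega) ≫ ((totalize Φ).map (coneTo f)).f p' ≫
      (totalShift Φ F 1).hom.f p' = (Φ.map ((coneTo f).hom.f i' : _ ⟶ F.obj.X (i' + 1))).f j ≫
        totalι Φ F (i' + 1) j (p' + 1) (by omega) :=
    (Category.assoc _ _ _).symm.trans ((congrArg (· ≫ (totalShift Φ F 1).hom.f p') h₀).trans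
      ((Category.assoc _ _ _).trans (congrArg _ (shiftι_totalShift Φ (F := F) 1 i' j p' _))))
  have h₃ : (Φ.map ((mappingCone.inl f.hom).v i i' hi)).f j ≫
      (Φ.map ((coneTo f).hom.f i' : _ ⟶ F.obj.X (i' + 1))).f j =
      -(Φ.map (eqTerm F (show i = i' + 1 by omega))).f j := by
    have h₄ : Φ.map ((mappingCone.inl f.hom).v i i' hi) ≫
        Φ.map ((coneTo f).hom.f i' : _ ⟶ F.obj.X (i' + 1)) =
        -Φ.map (eqTerm F (show i = i' + 1 by omega)) :=
      (Φ.map_comp _ _).symm.trans ((congrArg (fun t : F.obj.X i ⟶ F.obj.X (i' + 1) => Φ.map t)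
        h₁).trans Φ.map_neg)
    exact HomologicalComplex.congr_hom h₄ j
  rw [← Category.assoc, totalι_totalCochain Φ _ h hi hp]
  refine (Category.assoc _ _ _).trans ((congrArg _ h₂).trans ((Category.assoc _ _ _).symm.trans
    ((congrArg (· ≫ totalι Φ F (i' + 1) j (p' + 1) (by omega)) h₃).trans ?_)))
  rw [← totalι_eqTerm Φ (show i = i' + 1 by omega) h (by omega : i' + 1 + j = p' + 1)
    (show p = p' + 1 by omega)]
  exact Preadditive.neg_comp _ _

/-- With this compatibility, `totalConeIso` becomes an isomorphism of triangles. It is checked on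
the two summands of the cone, the one of the target being sent to zero. -/
lemma totalConeHom_coneTo (f : F ⟶ G) :
    totalConeHom Φ f ≫ (totalize Φ).map (coneTo f) ≫ (totalShift Φ F 1).hom =
      (mappingCone.triangle ((totalize Φ).map f)).mor₃ := by
  ext p
  refine mappingCone.ext_from _ (p + 1) p rfl ?_ ?_
  · have h := Cochain.congr_v (inl_totalConeHom Φ f) (p + 1) p (by omega)
    rw [Cochain.comp_zero_cochain_v, Cochain.ofHom_v] at h
    refine Eq.trans ?_ (mappingCone.inl_v_triangle_mor₃_f _ (p + 1) p (by omega)).symm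
    refine (Category.assoc _ _ _).symm.trans ((congrArg (· ≫ (((totalize Φ).map (coneTo f)).f p ≫
      (totalShift Φ F 1).hom.f p)) h).trans ?_)
    refine total_hom_ext fun i j hij => ?_
    refine (totalι_coneInl_coneTo Φ f i (i + (-1)) j (p + 1) p hij rfl (by omega)).trans ?_
    exact (Preadditive.comp_neg _ _).symm
  · refine Eq.trans ?_ (mappingCone.inr_f_triangle_mor₃_f _ p).symm
    have h := HomologicalComplex.congr_hom (inr_totalConeHom Φ f) p
    have h' : coneInr f ≫ coneTo f = 0 :=
      (bounded C).ι.map_injective (mappingCone.inr_triangleδ f.hom)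
    have h'' := congrArg (fun t => ((totalize Φ).map t).f p) h'
    rw [Functor.map_comp, Functor.map_zero] at h''
    refine (Category.assoc _ _ _).symm.trans ((congrArg (· ≫ (((totalize Φ).map (coneTo f)).f p ≫
      (totalShift Φ F 1).hom.f p)) h).trans ?_)
    refine (Category.assoc _ _ _).symm.trans ((congrArg (· ≫ (totalShift Φ F 1).hom.f p) h'').trans
      zero_comp)

/-- The total complexes of the triangle of a mapping cone. -/
noncomputable def coneTriangleTotalize (f : F ⟶ G) :
    coneTriangle (totalize Φ) f ≅ mappingCone.triangle ((totalize Φ).map f) :=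
  (Triangle.isoMk (mappingCone.triangle ((totalize Φ).map f)) (coneTriangle (totalize Φ) f)
    (Iso.refl _) (Iso.refl _) (totalConeIso Φ f)
    ((Category.comp_id _).trans (Category.id_comp _).symm)
    ((inr_totalConeHom Φ f).trans (Category.id_comp _).symm) (by
      change (mappingCone.triangle ((totalize Φ).map f)).mor₃ ≫
        (CategoryTheory.shiftFunctor (CochainComplex D ℤ) (1 : ℤ)).map (𝟙 _) =
        totalConeHom Φ f ≫ (totalize Φ).map (coneTo f ≫ (shiftBIso F 1).inv) ≫
        (totalize Φ).map (shiftBIso F 1).hom ≫ (totalShift Φ F 1).hom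
      rw [CategoryTheory.Functor.map_id, ← totalConeHom_coneTo, ← Functor.map_comp_assoc,
        Category.assoc, Iso.inv_hom_id, Category.comp_id]
      exact Category.comp_id _)).symm

end

/-! ### Functors that are defined by total complexes on bounded derived categories -/

section Derived

variable {C : Type*} [Category* C] [Abelian C] [HasDerivedCategory.{w} C]

noncomputable instance : (boundedQ C).CommShift ℤ :=
  inferInstanceAs ((ObjectProperty.lift _ ((bounded C).ι ⋙ DerivedCategory.Q) _).CommShift ℤ)

lemma coneTriangle_boundedQ_distinguished {F G : BddCx C} (f : F ⟶ G) :
    coneTriangle (boundedQ C) f ∈ distTriang (DerivedCategory.Bounded C) := by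
  refine coneTriangle_lift_distinguished _ ((bounded C).ι ⋙ DerivedCategory.Q) _ f ?_
  refine isomorphic_distinguished _ (DerivedCategory.mappingCone_triangle_distinguished f.hom) _
    ((coneTriangleComp _ _ _).symm ≪≫ DerivedCategory.Q.mapTriangle.mapIso ?_)
  exact Triangle.isoMk _ _ (Iso.refl _) (Iso.refl _) (Iso.refl _)
    ((Category.comp_id _).trans (Category.id_comp _).symm)
    ((Category.comp_id _).trans (Category.id_comp _).symm) (by
      -- The two comparisons between the shift of `BddCx C` and the shift of complexes are inverse
      -- to each other.
      have h : ((shiftBIso F 1).inv).hom ≫ ((bounded C).ι.commShiftIso (1 : ℤ)).hom.app F = 𝟙 _ :=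
        ((bounded C).ι.commShiftIso (1 : ℤ)).inv_hom_id_app F
      change (((mappingCone.triangle f.hom).mor₃ ≫ ((shiftBIso F 1).inv).hom) ≫
        ((bounded C).ι.commShiftIso (1 : ℤ)).hom.app F) ≫
        (CategoryTheory.shiftFunctor (CochainComplex C ℤ) (1 : ℤ)).map (𝟙 F.obj) =
        𝟙 _ ≫ (mappingCone.triangle f.hom).mor₃
      refine (congrArg (fun t => (((mappingCone.triangle f.hom).mor₃ ≫ ((shiftBIso F 1).inv).hom) ≫
        ((bounded C).ι.commShiftIso (1 : ℤ)).hom.app F) ≫ t)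
        ((CategoryTheory.shiftFunctor (CochainComplex C ℤ) (1 : ℤ)).map_id F.obj)).trans ?_
      refine (Category.comp_id _).trans ((Category.assoc _ _ _).trans ((congrArg
        (fun t => (mappingCone.triangle f.hom).mor₃ ≫ t) h).trans ?_))
      exact (Category.comp_id _).trans (Category.id_comp _).symm)

/-- Roofs can be straightened: localizing at a class with a calculus of fractions is essentially
surjective on arrows, and arrows of the homotopy category lift to morphisms of complexes. -/
lemma exists_arrow_iso {X Y : DerivedCategory.Bounded C} (f : X ⟶ Y) :
    ∃ (F G : BddCx C) (g : F ⟶ G) (e₁ : (boundedQ C).obj F ≅ X) (e₂ : (boundedQ C).obj G ≅ Y),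
      (boundedQ C).map g ≫ e₂.hom = e₁.hom ≫ f := by
  let φ := (boundedQh C).mapArrow.objPreimage (Arrow.mk f)
  let e := (boundedQh C).mapArrow.objObjPreimageIso (Arrow.mk f)
  let el : (boundedQh C).obj φ.left ≅ X := Arrow.leftFunc.mapIso e
  let er : (boundedQh C).obj φ.right ≅ Y := Arrow.rightFunc.mapIso e
  let F := (quotientB C).objPreimage φ.left
  let G := (quotientB C).objPreimage φ.right
  let a : (quotientB C).obj F ≅ φ.left := (quotientB C).objObjPreimageIso φ.left
  let b : (quotientB C).obj G ≅ φ.right := (quotientB C).objObjPreimageIso φ.right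
  obtain ⟨g, hg⟩ := (quotientB C).map_surjective (a.hom ≫ φ.hom ≫ b.inv)
  refine ⟨F, G, g, (quotientBCompQh C).symm.app F ≪≫ (boundedQh C).mapIso a ≪≫
    el, (quotientBCompQh C).symm.app G ≪≫ (boundedQh C).mapIso b ≪≫
    er, ?_⟩
  have h₁ : (boundedQ C).map g ≫ (quotientBCompQh C).inv.app G =
    (quotientBCompQh C).inv.app F ≫ (boundedQh C).map ((quotientB C).map g) :=
    (quotientBCompQh C).inv.naturality g
  have h₂ : (boundedQh C).map φ.hom ≫ er.hom = el.hom ≫ f := e.hom.w.symm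
  have h₃ : (boundedQh C).map ((quotientB C).map g) ≫ (boundedQh C).map b.hom =
      (boundedQh C).map a.hom ≫ (boundedQh C).map φ.hom := by
    rw [hg, ← Functor.map_comp, ← Functor.map_comp, Category.assoc, Category.assoc,
      Iso.inv_hom_id, Category.comp_id]
  change (boundedQ C).map g ≫ (quotientBCompQh C).inv.app G ≫ (boundedQh C).map b.hom ≫
    er.hom = ((quotientBCompQh C).inv.app F ≫ (boundedQh C).map a.hom ≫ el.hom) ≫ f
  rw [reassoc_of% h₁, reassoc_of% h₃, Category.assoc, Category.assoc, h₂]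

/-- By `exists_arrow_iso`, every distinguished triangle is isomorphic to the triangle of the cone of
a morphism of bounded complexes. -/
lemma isTriangulated_of_coneTriangle {𝒟 : Type*} [Category* 𝒟] [HasShift 𝒟 ℤ] [HasZeroObject 𝒟]
    [Preadditive 𝒟] [∀ n : ℤ, (CategoryTheory.shiftFunctor 𝒟 n).Additive] [Pretriangulated 𝒟]
    (E : DerivedCategory.Bounded C ⥤ 𝒟) [E.CommShift ℤ]
    (hE : ∀ {F G : BddCx C} (f : F ⟶ G), coneTriangle (boundedQ C ⋙ E) f ∈ distTriang 𝒟) :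
    E.IsTriangulated where
  map_distinguished T hT := by
    obtain ⟨F, G, f, e₁, e₂, h⟩ := exists_arrow_iso T.mor₁
    exact isomorphic_distinguished _ (hE f) _ ((coneTriangleComp _ _ _).symm ≪≫
      E.mapTriangle.mapIso
        (isoTriangleOfIso₁₂ _ _ (coneTriangle_boundedQ_distinguished f) hT e₁ e₂ h)).symm

variable {D : Type*} [Category* D] [Abelian D] [HasDerivedCategory.{w'} D]
  (Φ : C ⥤ CochainComplex D ℤ) [Φ.Additive]

/-- The functor to the bounded derived category that is given by total complexes. -/
noncomputable def totalQ
    (hB : ∀ F, DerivedCategory.TStructure.t.bounded (DerivedCategory.Q.obj ((totalize Φ).obj F))) :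
    BddCx C ⥤ DerivedCategory.Bounded D :=
  ObjectProperty.lift _ (totalize Φ ⋙ DerivedCategory.Q) hB

variable {Φ} (hB : ∀ F, DerivedCategory.TStructure.t.bounded (DerivedCategory.Q.obj ((totalize Φ).obj F)))

noncomputable instance : (totalQ Φ hB).CommShift ℤ :=
  inferInstanceAs ((ObjectProperty.lift _ (totalize Φ ⋙ DerivedCategory.Q) _).CommShift ℤ)

lemma coneTriangle_totalQ_distinguished {F G : BddCx C} (f : F ⟶ G) :
    coneTriangle (totalQ Φ hB) f ∈ distTriang (DerivedCategory.Bounded D) := by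
  refine coneTriangle_lift_distinguished _ (totalize Φ ⋙ DerivedCategory.Q) _ f ?_
  exact isomorphic_distinguished _
    (DerivedCategory.mappingCone_triangle_distinguished ((totalize Φ).map f)) _
    ((coneTriangleComp _ _ _).symm ≪≫
      DerivedCategory.Q.mapTriangle.mapIso (coneTriangleTotalize Φ f))

lemma isIso_totalQ_map (hΦ : DegreewiseExact Φ) {F G : BddCx C} (f : F ⟶ G) (hf : quasiIsoB C f) :
    IsIso ((totalQ Φ hB).map f) := by
  rw [← isIso_iff_of_reflects_iso _ DerivedCategory.Bounded.ι]
  have := quasiIso_totalize hΦ f hf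
  exact (DerivedCategory.isIso_Q_map_iff_quasiIso D _).2 this

variable (hΦ : DegreewiseExact Φ)

/-- The functor between bounded derived categories that is given by total complexes. -/
noncomputable def derived : DerivedCategory.Bounded C ⥤ DerivedCategory.Bounded D :=
  Localization.lift (totalQ Φ hB) (fun _ _ f hf => isIso_totalQ_map hB hΦ f hf) (boundedQ C)

/-- The functor `derived` is computed by total complexes. -/
noncomputable def boundedQCompDerived : boundedQ C ⋙ derived hB hΦ ≅ totalQ Φ hB :=
  Localization.fac _ _ _

noncomputable instance : Localization.Lifting (boundedQ C) (quasiIsoB C) (totalQ Φ hB)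
    (derived hB hΦ) := ⟨boundedQCompDerived hB hΦ⟩

noncomputable instance : (derived hB hΦ).CommShift ℤ :=
  Functor.commShiftOfLocalization (boundedQ C) (quasiIsoB C) ℤ (totalQ Φ hB) (derived hB hΦ)

instance : NatTrans.CommShift (boundedQCompDerived hB hΦ).hom ℤ :=
  NatTrans.commShift_iso_hom_of_localization (boundedQ C) (quasiIsoB C) ℤ (totalQ Φ hB)
    (derived hB hΦ)

instance : (derived hB hΦ).IsTriangulated :=
  isTriangulated_of_coneTriangle _ fun f =>
    isomorphic_distinguished _ (coneTriangle_totalQ_distinguished hB f) _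
      (coneTriangleCongr (boundedQCompDerived hB hΦ) f)

end Derived

end ConeTriangle

end

section

/-! ### Exactness of sequences of graded modules -/

namespace GrMod

section Exact

variable {K : Type u} [Field K] {A : Type u} [Ring A] [Algebra K A] {𝒜 : ℤ → Submodule K A}
  {M N P : GrMod 𝒜}

lemma isZero_of_forall (h : ∀ x : M.carrier, x = 0) : IsZero M :=
  (IsZero.iff_id_eq_zero _).2 (hom_ext h)

lemma mono_of_injective (f : M ⟶ N) (hf : Function.Injective (Hom.lin f)) : Mono f where
  right_cancellation _ _ h := hom_ext fun x => hf (congrArg (fun k => Hom.lin k x) h)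

lemma epi_of_surjective (f : M ⟶ N) (hf : Function.Surjective (Hom.lin f)) : Epi f where
  left_cancellation _ _ h := hom_ext fun y => by
    obtain ⟨x, rfl⟩ := hf y
    exact congrArg (fun k => Hom.lin k x) h

variable [IsNoetherianRing A]

/-- Elements are not morphisms from a fixed object here, so exactness is used up to refinements: a
cycle is an element of the kernel, and epimorphisms onto the kernel are surjective. -/
lemma exact_iff (S : ShortComplex (GrMod 𝒜)) :
    S.Exact ↔ ∀ y : S.X₂.carrier, Hom.lin S.g y = 0 → ∃ x, Hom.lin S.f x = y := by
  rw [S.exact_iff_exact_up_to_refinements]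
  constructor
  · intro h y hy
    obtain ⟨T, π, hπ, z, hz⟩ := h (kerι S.g) (kerι_comp S.g)
    obtain ⟨t, ht⟩ := surjective_of_epi π (⟨y, hy⟩ : LinearMap.ker (Hom.lin S.g))
    refine ⟨Hom.lin z t, ?_⟩
    refine (congrArg (fun k => Hom.lin k t) hz).symm.trans ?_
    exact congrArg (Hom.lin (kerι S.g)) ht
  · intro h T y hy
    let φ : S.X₁ ⟶ ker S.g := ofLin ((Hom.lin S.f).codRestrict _
      fun x => congrArg (fun k => Hom.lin k x) S.zero) fun _ _ hx => Hom.map_mem S.f hx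
    let ψ : T ⟶ ker S.g := ofLin ((Hom.lin y).codRestrict _
      fun x => congrArg (fun k => Hom.lin k x) hy) fun _ _ hx => Hom.map_mem y hx
    have : Epi φ := epi_of_surjective φ fun z => by
      obtain ⟨x, hx⟩ := h z.1 z.2
      exact ⟨x, Subtype.ext hx⟩
    obtain ⟨T', π, hπ, x, hx⟩ := surjective_up_to_refinements_of_epi φ ψ
    exact ⟨T', π, hπ, x, congrArg (· ≫ kerι S.g) hx⟩

lemma onDeg_injective (f : M ⟶ N) [Mono f] (j : ℤ) : Function.Injective (Hom.onDeg f j) :=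
  fun _ _ h => Subtype.ext (injective_of_mono f (congrArg Subtype.val h))

lemma onDeg_surjective (f : M ⟶ N) [Epi f] (j : ℤ) : Function.Surjective (Hom.onDeg f j) := by
  intro y
  obtain ⟨x, hx, h⟩ := exists_lift_of_surjective f (surjective_of_epi f) y.2
  exact ⟨⟨x, hx⟩, Subtype.ext h⟩

lemma onDeg_exact {S : ShortComplex (GrMod 𝒜)} (hS : S.Exact) (j : ℤ) :
    Function.Exact (Hom.onDeg S.f j) (Hom.onDeg S.g j) := by
  intro y
  constructor
  · intro hy
    obtain ⟨x, hx⟩ := (exact_iff S).1 hS y.1 (congrArg Subtype.val hy)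
    refine ⟨⟨S.X₁.proj j x, component_mem S.X₁.isInternal j x⟩, Subtype.ext ?_⟩
    refine (proj_hom S.f j x).symm.trans ?_
    rw [hx]
    exact component_of_mem S.X₂.isInternal y.2
  · rintro ⟨x, rfl⟩
    exact Subtype.ext (congrArg (fun k => Hom.lin k x.1) S.zero)

end Exact

end GrMod

/-! ### Exactness of `R₀` and `L₀` -/

section DegreewiseExact

variable {K : Type u} [Field K] {V : Type u} [AddCommGroup V] [Module K V] [FiniteDimensional K V]

/-- Taking components of a fixed degree is exact, and over a field injections have retractions and
surjections have sections, through which elements of `Hom_K(E, -)` are lifted. -/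
lemma degreewiseExact_R₀ : DegreewiseExact (C := SMod K V) (D := EMod K V) R₀ := by
  intro S hS j
  have := hS.mono_f
  have := hS.epi_g
  have hf := GrMod.onDeg_injective S.f j
  have hg := GrMod.onDeg_surjective S.g j
  have he := GrMod.onDeg_exact hS.exact j
  refine @ShortComplex.ShortExact.mk _ _ _ _ ?_ ?_ ?_
  · rw [GrMod.exact_iff]
    intro α hα
    obtain ⟨r, hr⟩ := LinearMap.exists_leftInverse_of_injective _ (LinearMap.ker_eq_bot.2 hf)
    refine ⟨HomE.of (r ∘ₗ HomE.fn α), HomE.ext fun b => ?_⟩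
    obtain ⟨x, hx⟩ := (he (HomE.fn α b)).1 (congrArg (fun β => HomE.fn β b) hα)
    change GrMod.Hom.onDeg S.f j (r (HomE.fn α b)) = HomE.fn α b
    rw [← hx]
    exact congrArg (GrMod.Hom.onDeg S.f j) (LinearMap.congr_fun hr x)
  · refine GrMod.mono_of_injective _ fun α β h => HomE.ext fun b => hf ?_
    exact congrArg (fun γ => HomE.fn γ b) h
  · refine GrMod.epi_of_surjective _ fun α => ?_
    obtain ⟨s, hs⟩ := LinearMap.exists_rightInverse_of_surjective _ (LinearMap.range_eq_top.2 hg)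
    refine ⟨HomE.of (s ∘ₗ HomE.fn α), HomE.ext fun b => ?_⟩
    exact LinearMap.congr_fun hs (HomE.fn α b)

/-- Taking components is exact, and `S` is flat over the field `K`. -/
lemma degreewiseExact_L₀ : DegreewiseExact (C := EMod K V) (D := SMod K V) L₀ := by
  intro S hS j
  have := hS.mono_f
  have := hS.epi_g
  have hf := GrMod.onDeg_injective S.f (-j)
  have hg := GrMod.onDeg_surjective S.g (-j)
  have he := GrMod.onDeg_exact hS.exact (-j)
  refine @ShortComplex.ShortExact.mk _ _ _ _ ?_ ?_ ?_
  · rw [GrMod.exact_iff]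
    exact fun z hz => (lTensor_exact (SymmetricAlgebra K (Module.Dual K V)) he hg z).1 hz
  · exact GrMod.mono_of_injective _ (Module.Flat.lTensor_preserves_injective_linearMap
      (M := SymmetricAlgebra K (Module.Dual K V)) (GrMod.Hom.onDeg S.f (-j)) hf)
  · exact GrMod.epi_of_surjective _ (LinearMap.lTensor_surjective
      (SymmetricAlgebra K (Module.Dual K V)) hg)

end DegreewiseExact

end

section

/-! ### Complexes that are concentrated in one degree -/

section Column

variable {C D : Type*} [Category* C] [Category* D] [Preadditive C] [Preadditive D]
  [HasFiniteCoproducts D] (Φ : C ⥤ CochainComplex D ℤ) [Φ.Additive] {F : BddCx C} {a : ℤ}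

/-- The terms of the total complex of a complex that is concentrated in one degree. -/
noncomputable def totalColumnIso (hF : ∀ i, i ≠ a → IsZero (F.obj.X i)) (j n : ℤ) (h : a + j = n) :
    (Φ.obj (F.obj.X a)).X j ≅ ((totalize Φ).obj F).X n where
  hom := totalι Φ F a j n h
  inv := totalπ Φ F a j n h
  hom_inv_id := totalι_π Φ a j n h
  inv_hom_id := by
    refine total_hom_ext fun i k hk => ?_
    by_cases hi : i = a
    · subst hi
      obtain rfl : k = j := by omega
      rw [← Category.assoc, totalι_π, Category.id_comp, Category.comp_id]
    · exact (isZero_totalX Φ (hF i hi)).eq_of_src _ _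

lemma totalι_d_column (hF : ∀ i, i ≠ a → IsZero (F.obj.X i)) (j n j' n' : ℤ) (h : a + j = n)
    (hj : j + 1 = j') (hn : n + 1 = n') :
    totalι Φ F a j n h ≫ ((totalize Φ).obj F).d n n' =
      a.negOnePow • ((Φ.obj (F.obj.X a)).d j j' ≫ totalι Φ F a j' n' (by omega)) := by
  rw [totalι_d Φ a j n (a + 1) j' n' h rfl hj hn,
    (hF (a + 1) (by omega)).eq_of_tgt (F.obj.d a (a + 1)) 0, Functor.map_zero,
    HomologicalComplex.zero_f, zero_comp, zero_add]

/-- The total complex is `Φ(F^a)` moved by `a`, with differential multiplied by `(-1)^a`. The sign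
is absorbed by the isomorphism on the middle term. -/
lemma exactAt_totalize_column (hF : ∀ i, i ≠ a → IsZero (F.obj.X i)) (j n : ℤ) (h : a + j = n) :
    (Φ.obj (F.obj.X a)).ExactAt j ↔ ((totalize Φ).obj F).ExactAt n := by
  rw [HomologicalComplex.exactAt_iff' _ (j - 1) j (j + 1) (by simp) (by simp),
    HomologicalComplex.exactAt_iff' _ (n - 1) n (n + 1) (by simp) (by simp)]
  have hs : a.negOnePow * a.negOnePow = 1 := Int.units_mul_self _
  refine ShortComplex.exact_iff_of_iso (ShortComplex.isoMk
    (totalColumnIso Φ hF (j - 1) (n - 1) (by omega))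
    (a.negOnePow • totalColumnIso Φ hF j n h)
    (totalColumnIso Φ hF (j + 1) (n + 1) (by omega)) ?_ ?_)
  · change totalι Φ F a _ _ _ ≫ ((totalize Φ).obj F).d _ _ =
      (Φ.obj (F.obj.X a)).d _ _ ≫ (a.negOnePow • totalι Φ F a _ _ _)
    rw [totalι_d_column Φ hF (j - 1) (n - 1) j n (by omega) (by omega) (by omega),
      Linear.comp_units_smul]
  · change (a.negOnePow • totalι Φ F a _ _ _) ≫ ((totalize Φ).obj F).d _ _ =
      (Φ.obj (F.obj.X a)).d _ _ ≫ totalι Φ F a _ _ _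
    rw [Linear.units_smul_comp, totalι_d_column Φ hF j n (j + 1) (n + 1) h rfl rfl, smul_smul, hs,
      one_smul]

end Column

/-! ### Induction on bounded complexes and bounds for cohomology -/

section Devissage

variable {C D : Type*} [Category* C] [Category* D] [Abelian C] [Abelian D]
  (Φ : C ⥤ CochainComplex D ℤ) [Φ.Additive]

/-- Induction on bounded complexes by means of short exact sequences. -/
lemma bounded_induction (P : BddCx C → Prop)
    (hc : ∀ (a : ℤ) (F : BddCx C), (∀ i, i ≠ a → IsZero (F.obj.X i)) → P F)
    (he : ∀ S : ShortComplex (BddCx C), (S.map (bounded C).ι).ShortExact → P S.X₁ → P S.X₃ → P S.X₂)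
    (F : BddCx C) : P F := by
  obtain ⟨a, b, ha, hb⟩ := id F.property
  obtain ⟨n, hn⟩ : ∃ n : ℕ, b < a + n := ⟨(b - a + 1).toNat, by omega⟩
  induction n generalizing F a with
  | zero =>
    -- Here `b < a`, so `F` is zero and counts as concentrated in any degree.
    refine hc a F fun i hi => ?_
    by_cases h : a ≤ i
    · exact F.obj.isZero_of_isStrictlyLE b i (by omega)
    · exact F.obj.isZero_of_isStrictlyGE a i (by omega)
  | succ n ih =>
    by_cases hab : a ≤ b
    · obtain ⟨S, rfl, hS, h₁, h₁', h₃⟩ := exists_shortExact_single F a b ha hb hab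
      refine he S hS (ih _ (a + 1) h₁ h₁' (by push_cast at hn; omega)) (hc a _ fun i hi => ?_)
      rw [h₃]
      exact HomologicalComplex.isZero_single_obj_X _ _ _ _ hi
    · refine hc a F fun i hi => ?_
      by_cases h : a ≤ i
      · exact F.obj.isZero_of_isStrictlyLE b i (by omega)
      · exact F.obj.isZero_of_isStrictlyGE a i (by omega)

variable {Φ}

lemma totalize_isStrictlyGE (h : ∀ M, ∃ m, (Φ.obj M).IsStrictlyGE m) (F : BddCx C) :
    ∃ m, ((totalize Φ).obj F).IsStrictlyGE m := by
  choose m hm using h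
  obtain ⟨c, hc⟩ : ∃ c : ℤ, ∀ i ∈ supp F, c ≤ i + m (F.obj.X i) := by
    obtain ⟨c, hc⟩ := ((supp F).image fun i => i + m (F.obj.X i)).bddBelow
    exact ⟨c, fun i hi => hc (by simpa using ⟨i, hi, rfl⟩)⟩
  refine ⟨c, (CochainComplex.isStrictlyGE_iff _ _).2 fun n hn => ?_⟩
  rw [IsZero.iff_id_eq_zero]
  refine total_hom_ext fun i j hij => ?_
  refine IsZero.eq_of_src ?_ _ _
  by_cases hi : i ∈ supp F
  · have := hm (F.obj.X i)
    exact (Φ.obj (F.obj.X i)).isZero_of_isStrictlyGE (m (F.obj.X i)) j (by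
      have := hc i hi
      omega)
  · exact isZero_totalX Φ (isZero_of_notMem_supp hi)

lemma totalize_exactAt (hΦ : DegreewiseExact Φ)
    (h : ∀ M, ∃ m : ℤ, ∀ j, m < j → (Φ.obj M).ExactAt j) (F : BddCx C) :
    ∃ m : ℤ, ∀ n, m < n → ((totalize Φ).obj F).ExactAt n := by
  refine bounded_induction (fun F => ∃ m : ℤ, ∀ n, m < n → ((totalize Φ).obj F).ExactAt n)
    (fun a F hF => ?_) (fun S hS h₁ h₃ => ?_) F
  · obtain ⟨m, hm⟩ := h (F.obj.X a)
    exact ⟨a + m, fun n hn => (exactAt_totalize_column Φ hF (n - a) n (by omega)).1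
      (hm _ (by omega))⟩
  · obtain ⟨m₁, h₁⟩ := h₁
    obtain ⟨m₃, h₃⟩ := h₃
    refine ⟨max m₁ m₃, fun n hn => ?_⟩
    rw [HomologicalComplex.exactAt_iff_isZero_homology]
    have := h₁ n (by omega)
    have := h₃ n (by omega)
    refine ((totalize_shortExact hΦ S hS).homology_exact₂ n).isZero_of_both_zeros ?_ ?_
    · exact ((HomologicalComplex.exactAt_iff_isZero_homology _ _).1 (h₁ _ (by omega))).eq_of_src _ _
    · exact ((HomologicalComplex.exactAt_iff_isZero_homology _ _).1 (h₃ _ (by omega))).eq_of_tgt _ _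

/-- In high degrees only exactness is required, not vanishing: the complexes `R(M)` may be unbounded
above. -/
lemma bounded_Q_totalize [HasDerivedCategory.{w'} D] (hΦ : DegreewiseExact Φ)
    (h₁ : ∀ M, ∃ m, (Φ.obj M).IsStrictlyGE m)
    (h₂ : ∀ M, ∃ m : ℤ, ∀ j, m < j → (Φ.obj M).ExactAt j) (F : BddCx C) :
    DerivedCategory.TStructure.t.bounded (DerivedCategory.Q.obj ((totalize Φ).obj F)) := by
  obtain ⟨a, ha⟩ := totalize_isStrictlyGE h₁ F
  obtain ⟨b, hb⟩ := totalize_exactAt hΦ h₂ F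
  have : ((totalize Φ).obj F).IsLE b := (CochainComplex.isLE_iff _ _).2 hb
  exact ⟨⟨a, inferInstanceAs ((DerivedCategory.Q.obj _).IsGE a)⟩,
    ⟨b, inferInstanceAs ((DerivedCategory.Q.obj _).IsLE b)⟩⟩

end Devissage

end

section

namespace GrMod

section Proj

variable {K : Type u} [Field K] {A : Type u} [Ring A] [Algebra K A] {𝒜 : ℤ → Submodule K A}
  (M : GrMod 𝒜)

lemma proj_of_mem {i : ℤ} {y : M.carrier} (h : y ∈ M.deg i) : M.proj i y = y :=
  component_of_mem M.isInternal h

lemma proj_of_mem_ne {i j : ℤ} {y : M.carrier} (h : y ∈ M.deg j) (hij : j ≠ i) : M.proj i y = 0 :=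
  component_of_mem_ne M.isInternal h hij

lemma proj_mem (i : ℤ) (y : M.carrier) : M.proj i y ∈ M.deg i := component_mem M.isInternal i y

lemma proj_smul {s i j : ℤ} {a : A} (ha : a ∈ 𝒜 s) (h : s + i = j) (y : M.carrier) :
    M.proj j (a • y) = a • M.proj i y := by
  subst h
  obtain ⟨T, hT⟩ := exists_eq_sum_component M.isInternal y
  rw [hT, Finset.smul_sum, map_sum, map_sum, Finset.smul_sum]
  refine Finset.sum_congr rfl fun l _ => ?_
  have hl : a • M.proj l y ∈ M.deg (s + l) :=
    SetLike.GradedSMul.smul_mem (B := M.deg) ha (M.proj_mem l y)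
  change M.proj (s + i) (a • M.proj l y) = a • M.proj i (M.proj l y)
  by_cases hil : l = i
  · subst hil
    rw [proj_of_mem M hl, proj_of_mem M (M.proj_mem l y)]
  · rw [proj_of_mem_ne M hl (by omega), proj_of_mem_ne M (M.proj_mem l y) hil, smul_zero]

lemma exists_proj_support (y : M.carrier) :
    ∃ T : Finset ℤ, y = ∑ i ∈ T, M.proj i y ∧ ∀ i ∉ T, M.proj i y = 0 := by
  obtain ⟨T, hT⟩ := exists_eq_sum_component M.isInternal y
  refine ⟨T, hT, fun i hi => ?_⟩
  rw [hT, map_sum]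
  exact Finset.sum_eq_zero fun j hj => M.proj_of_mem_ne (M.proj_mem j y) fun h => hi (h ▸ hj)

end Proj

end GrMod

/-! ### The total complexes of `R` and `L` are bounded in the derived category -/

/-- The symmetric algebra of the dual space. -/
abbrev SymW (K V : Type u) [Field K] [AddCommGroup V] [Module K V] : Type u :=
  SymmetricAlgebra K (Module.Dual K V)

/-- The exterior algebra. -/
abbrev ExtV (K V : Type u) [Field K] [AddCommGroup V] [Module K V] : Type u := ExteriorAlgebra K V

section

variable {K : Type u} [Field K] {V : Type u} [AddCommGroup V] [Module K V] [FiniteDimensional K V]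

/-- Every element of the symmetric algebra is the sum of a scalar and a combination of the
elements of a basis. -/
lemma sym_induction {T : Type*} [AddCommGroup T] [Module (SymW K V) T] [Module K T] [IsScalarTower K (SymW K V) T]
    (Z B : Submodule (SymW K V) T) (h : ∀ k, ∀ z ∈ Z, x K V k • z ∈ B) (s : (SymW K V)) :
    ∃ c : K, ∀ z ∈ Z, s • z - c • z ∈ B := by
  induction s using SymmetricAlgebra.induction with
  | algebraMap c => exact ⟨c, fun z _ => by simp⟩
  | ι w =>
    -- A linear form is a combination of the `x_k`, so it maps `Z` to `B` and its scalar is zero.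
    refine ⟨0, fun z hz => ?_⟩
    rw [zero_smul, sub_zero, ← (Module.finBasis K V).sum_dual_apply_smul_coord w, map_sum,
      Finset.sum_smul]
    refine sum_mem fun k _ => ?_
    rw [map_smul, smul_assoc, ← algebraMap_smul (SymW K V) (w _) (_ • z)]
    exact B.smul_mem _ (h k z hz)
  | mul s t hs ht =>
    obtain ⟨c, hc⟩ := hs
    obtain ⟨d, hd⟩ := ht
    refine ⟨c * d, fun z hz => ?_⟩
    have h₁ := B.smul_mem s (hd z hz)
    have h₂ := B.smul_mem (algebraMap K (SymW K V) d) (hc z hz)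
    have : (s * t) • z - (c * d) • z = s • (t • z - d • z) +
        algebraMap K (SymW K V) d • (s • z - c • z) := by
      simp only [smul_sub, algebraMap_smul, mul_smul]
      rw [smul_comm s d z, smul_comm d c z]
      abel
    rw [this]
    exact add_mem h₁ h₂
  | add s t hs ht =>
    obtain ⟨c, hc⟩ := hs
    obtain ⟨d, hd⟩ := ht
    refine ⟨c + d, fun z hz => ?_⟩
    have : (s + t) • z - (c + d) • z = (s • z - c • z) + (t • z - d • z) := by
      rw [add_smul, add_smul]
      abel
    rw [this]
    exact add_mem (hc z hz) (hd z hz)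

/-! ### Koszul cohomology of finitely generated modules -/

section Koszul

variable (M : Type u) [AddCommGroup M] [Module K M] [Module (SymW K V) M] [IsScalarTower K (SymW K V) M]

/-- The Koszul differential on `Hom_K(E, M)`. -/
noncomputable def koszul : ((ExtV K V) →ₗ[K] M) →ₗ[SymW K V] ((ExtV K V) →ₗ[K] M) :=
  ∑ k, x K V k • LinearMap.lcomp (SymW K V) M (LinearMap.mulLeft K (e K V k))

variable {M}

lemma koszul_apply (α : (ExtV K V) →ₗ[K] M) (b : (ExtV K V)) :
    koszul M α b = ∑ k, x K V k • α (e K V k * b) := by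
  simp [koszul, LinearMap.sum_apply]

instance [Module.Finite (SymW K V) M] : Module.Finite (SymW K V) ((ExtV K V) →ₗ[K] M) :=
  Module.Finite.equiv ((Module.finBasis K (ExtV K V)).constr (SymW K V))

/-- Multiplication by `x_l` is homotopic to zero. -/
lemma koszul_homotopy (l : Fin (Module.finrank K V)) (α : (ExtV K V) →ₗ[K] M) (hα : koszul M α = 0) :
    x K V l • α = koszul M (α ∘ₗ CliffordAlgebra.contractLeft ((Module.finBasis K V).coord l)) := by
  refine LinearMap.ext fun b => ?_
  rw [koszul_apply]
  -- Contraction with the `l`-th coordinate is an antiderivation `c`, with `c(e_k b) = δ_{kl} b -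
  -- e_k c(b)`. The first term gives `x_l α(b)`; the second is the Koszul differential of `α` at
  -- `c(b)`, which vanishes.
  have h (k : Fin (Module.finrank K V)) :
      CliffordAlgebra.contractLeft ((Module.finBasis K V).coord l) (e K V k * b) =
      (Module.finBasis K V).coord l (Module.finBasis K V k) • b -
        e K V k * CliffordAlgebra.contractLeft ((Module.finBasis K V).coord l) b :=
    CliffordAlgebra.contractLeft_ι_mul _ _ _
  have h' := LinearMap.congr_fun hα (CliffordAlgebra.contractLeft ((Module.finBasis K V).coord l) b)
  rw [koszul_apply] at h'
  simp only [LinearMap.comp_apply, h, map_sub, smul_sub, Finset.sum_sub_distrib]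
  rw [h', LinearMap.zero_apply, sub_zero, Finset.sum_eq_single l]
  · simp
  · intro k _ hk
    simp [hk]
  · simp

/-- The cycles form a finitely generated `S`-module, and by `koszul_homotopy` each element of `S`
acts on cycles modulo boundaries as a scalar. So finitely many generators span this quotient over
`K`. Their components vanish in high degrees, hence every cycle with values in a high degree is a
boundary. The maps `p i` play the role of the projections of a grading that is bounded above
elementwise. -/
lemma exists_koszul_eq (p : ℤ → M →ₗ[K] M) [Module.Finite (SymW K V) M]
    (hp : ∀ k i (y : M), p (i + 1) (x K V k • y) = x K V k • p i y)
    (hp' : ∀ y : M, ∃ n : ℤ, ∀ i, n < i → p i y = 0) :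
    ∃ n : ℤ, ∀ i, n < i → ∀ α : (ExtV K V) →ₗ[K] M, koszul M α = 0 → p (i + 1) ∘ₗ α = α →
      ∃ β : (ExtV K V) →ₗ[K] M, koszul M (p i ∘ₗ β) = α := by
  have comm (i : ℤ) (α : (ExtV K V) →ₗ[K] M) : koszul M (p i ∘ₗ α) = p (i + 1) ∘ₗ koszul M α := by
    refine LinearMap.ext fun b => ?_
    rw [LinearMap.comp_apply, koszul_apply, koszul_apply, map_sum]
    exact Finset.sum_congr rfl fun k _ => (hp k i _).symm
  have hα' (α : (ExtV K V) →ₗ[K] M) : ∃ n : ℤ, ∀ i, n < i → p i ∘ₗ α = 0 := by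
    let b := Module.finBasis K (ExtV K V)
    choose n hn using fun k => hp' (α (b k))
    obtain ⟨c, hc⟩ := (Finset.univ.image n).bddAbove
    refine ⟨c, fun i hi => b.ext fun k => hn k i (lt_of_le_of_lt (hc ?_) hi)⟩
    simp
  obtain ⟨G, hG⟩ : (LinearMap.ker (koszul M : _ →ₗ[SymW K V] ((ExtV K V) →ₗ[K] M))).FG := IsNoetherian.noetherian _
  choose n hn using hα'
  -- Above `c` all components of the chosen generators of the module of cycles vanish.
  obtain ⟨c, hc⟩ := (G.image n).bddAbove
  refine ⟨c, fun i hi α hα hpα => ?_⟩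
  have key : ∀ α ∈ Submodule.span (SymW K V) (G : Set ((ExtV K V) →ₗ[K] M)),
      ∃ β : (ExtV K V) →ₗ[K] M, α - koszul M β ∈ Submodule.span K (G : Set ((ExtV K V) →ₗ[K] M)) := by
    intro α hα
    induction hα using Submodule.span_induction with
    | mem α hα => exact ⟨0, by simpa using Submodule.subset_span hα⟩
    | zero => exact ⟨0, by simp⟩
    | add α α' _ _ h h' =>
      obtain ⟨β, hβ⟩ := h
      obtain ⟨β', hβ'⟩ := h'
      exact ⟨β + β', by simpa only [map_add, add_sub_add_comm] using add_mem hβ hβ'⟩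
    | smul s α hα h =>
      obtain ⟨β, hβ⟩ := h
      obtain ⟨d, hd⟩ := sym_induction (LinearMap.ker (koszul M : _ →ₗ[SymW K V] ((ExtV K V) →ₗ[K] M)))
        (LinearMap.range (koszul M : _ →ₗ[SymW K V] ((ExtV K V) →ₗ[K] M)))
        (fun k z hz => ⟨_, (koszul_homotopy k z hz).symm⟩) s
      obtain ⟨γ, hγ⟩ := hd α (hG ▸ hα)
      refine ⟨γ + algebraMap K (SymW K V) d • β, ?_⟩
      have : s • α - koszul M (γ + algebraMap K (SymW K V) d • β) = d • (α - koszul M β) := by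
        rw [map_add, hγ, map_smul, algebraMap_smul, smul_sub]
        abel
      rw [this]
      exact Submodule.smul_mem _ d hβ
  obtain ⟨β, hβ⟩ := key α (hG ▸ hα)
  refine ⟨β, ?_⟩
  have hz : ∀ γ ∈ Submodule.span K (G : Set ((ExtV K V) →ₗ[K] M)), p (i + 1) ∘ₗ γ = 0 := by
    intro γ hγ
    induction hγ using Submodule.span_induction with
    | mem γ hγ => exact hn γ _ (lt_of_le_of_lt (hc (Finset.mem_coe.2
        (Finset.mem_image_of_mem n hγ))) (by omega))
    | zero => exact LinearMap.comp_zero _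
    | add _ _ _ _ h h' => rw [LinearMap.comp_add, h, h', add_zero]
    | smul d _ _ h => rw [LinearMap.comp_smul, h, smul_zero]
  -- Applying `p (i + 1)` to `α - koszul M β` leaves `α` unchanged and kills the difference, which
  -- lies in the `K`-span of `G`.
  rw [comm, ← sub_eq_zero, ← neg_eq_zero, neg_sub]
  conv_lhs => rw [← hpα]
  rw [← LinearMap.comp_sub]
  exact hz _ hβ

end Koszul

/-- A cycle of `R(M)` in degree `j = i + 1` is a Koszul cycle with values in `M_{i+1}`. The
component of degree `i` of a Koszul cochain that bounds it is a cochain of `R(M)`. -/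
lemma R₀_exactAt (M : SMod K V) : ∃ m : ℤ, ∀ j, m < j → ((R₀ : SMod K V ⥤ _).obj M).ExactAt j := by
  obtain ⟨n, hn⟩ := exists_koszul_eq (K := K) (V := V) M.proj
    (fun k i y => M.proj_smul (x_mem K V k) (add_comm 1 i) y) (fun y => by
      obtain ⟨T, -, hT⟩ := M.exists_proj_support y
      obtain ⟨c, hc⟩ := T.bddAbove
      exact ⟨c, fun i hi => hT i fun hi' => not_lt.2 (hc hi') hi⟩)
  refine ⟨n + 1, fun j hj => ?_⟩
  obtain ⟨i, rfl⟩ : ∃ i, j = i + 1 := ⟨j - 1, by omega⟩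
  rw [exactAt_iff_exact _ i (i + 1) (i + 1 + 1) rfl rfl, GrMod.exact_iff]
  intro α hα
  have hd : ∀ i, ((R₀ : SMod K V ⥤ _).obj M).d i (i + 1) = Rd M rfl := fun i => dif_pos rfl
  have hα' : GrMod.Hom.lin (Rd M rfl : homE (M.deg (i + 1)) (i + 1) ⟶ homE (M.deg (i + 1 + 1)) _) α
      = 0 := (congrArg (fun k => GrMod.Hom.lin k α) (hd (i + 1))).symm.trans hα
  obtain ⟨β, hβ⟩ := hn i (by omega) ((M.deg (i + 1)).subtype ∘ₗ HomE.fn α)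
    (LinearMap.ext fun b => (koszul_apply _ b).trans ((Rd_apply M rfl α b).symm.trans
      (congrArg (fun γ : HomE K V (M.deg (i + 1 + 1)) => ((HomE.fn γ b : M.deg _) : M.carrier)) hα')))
    (LinearMap.ext fun b => M.proj_of_mem (HomE.fn α b).2)
  refine ⟨HomE.of ((M.proj i ∘ₗ β).codRestrict (M.deg i) fun b => M.proj_mem _ _), ?_⟩
  refine (congrArg (fun k => GrMod.Hom.lin k _) (hd i)).trans (HomE.ext fun b => Subtype.ext ?_)
  refine (Rd_apply M rfl _ b).trans ((koszul_apply (M := M.carrier) (M.proj i ∘ₗ β) b).symm.trans ?_)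
  exact LinearMap.congr_fun hβ b

/-- As `S` has no elements of negative degree, the elements without components below `c` form a
submodule. It is everything once `c` bounds the degrees of finitely many generators. -/
lemma exists_deg_eq_zero_of_lt (M : SMod K V) : ∃ m : ℤ, ∀ i < m, ∀ y ∈ M.deg i, y = 0 := by
  obtain ⟨G, hG⟩ := (Module.Finite.fg_top : (⊤ : Submodule (SymW K V) M.carrier).FG)
  choose T _ hT using M.exists_proj_support
  obtain ⟨c, hc⟩ := (G.biUnion T).bddBelow
  let N : Submodule (SymW K V) M.carrier :=
    { carrier := {y | ∀ i < c, M.proj i y = 0}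
      add_mem' := fun hy hz i hi => by rw [map_add, hy i hi, hz i hi, add_zero]
      zero_mem' := fun i _ => map_zero _
      smul_mem' := fun s y hy i hi => by
        obtain ⟨U, hU⟩ := exists_eq_sum_component (symDeg_isInternal K (Module.Dual K V)) s
        rw [hU, Finset.sum_smul, map_sum]
        refine Finset.sum_eq_zero fun d _ => ?_
        have hd := component_mem (symDeg_isInternal K (Module.Dual K V)) d s
        by_cases h : 0 ≤ d
        · rw [M.proj_smul hd (show d + (i - d) = i by omega), hy _ (by omega), smul_zero]
        · rw [symDeg, if_neg h, Submodule.mem_bot] at hd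
          rw [hd, zero_smul, map_zero] }
  have hN : N = ⊤ := by
    rw [eq_top_iff, ← hG, Submodule.span_le]
    intro g hg i hi
    refine hT g i fun h => not_lt.2 (hc (Finset.mem_coe.2 (Finset.mem_biUnion.2 ⟨g, hg, h⟩))) hi
  refine ⟨c, fun i hi y hy => ?_⟩
  have : y ∈ N := hN ▸ Submodule.mem_top
  rw [← M.proj_of_mem hy, this i hi]

lemma R₀_isStrictlyGE (M : SMod K V) :
    ∃ m : ℤ, ((R₀ : SMod K V ⥤ _).obj M).IsStrictlyGE m := by
  obtain ⟨m, hm⟩ := exists_deg_eq_zero_of_lt M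
  refine ⟨m, (CochainComplex.isStrictlyGE_iff _ _).2 fun i hi => ?_⟩
  exact GrMod.isZero_of_forall fun α => HomE.ext fun b => Subtype.ext (hm i hi _ (HomE.fn α b).2)

/-- A finitely generated module over the finite-dimensional algebra `E` is finite-dimensional, so it
has only finitely many nonzero components. -/
lemma exists_deg_eq_zero (P : EMod K V) :
    ∃ m n : ℤ, ∀ i, (i < m ∨ n < i) → ∀ y ∈ P.deg i, y = 0 := by
  have : Module.Finite K P.carrier := Module.Finite.trans (ExtV K V) P.carrier
  have h := WellFoundedGT.finite_ne_bot_of_iSupIndep P.isInternal.submodule_iSupIndep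
  obtain ⟨m, hm⟩ := h.bddBelow
  obtain ⟨n, hn⟩ := h.bddAbove
  refine ⟨m, n, fun i hi y hy => ?_⟩
  by_contra hy'
  have : P.deg i ≠ ⊥ := fun h => hy' (by rwa [h, Submodule.mem_bot] at hy)
  have h₁ := hm this
  have h₂ := hn this
  omega

lemma L₀_isStrictly (P : EMod K V) :
    ∃ m n : ℤ, ((L₀ : EMod K V ⥤ _).obj P).IsStrictlyGE m ∧
      ((L₀ : EMod K V ⥤ _).obj P).IsStrictlyLE n := by
  obtain ⟨m, n, h⟩ := exists_deg_eq_zero P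
  have hz (i : ℤ) (hi : i < -n ∨ -m < i) : IsZero (((L₀ : EMod K V ⥤ _).obj P).X i) := by
    have : Subsingleton (P.deg (-i)) := subsingleton_of_forall_eq 0 fun y =>
      Subtype.ext (h (-i) (by omega) y.1 y.2)
    have : Subsingleton (SymW K V ⊗[K] P.deg (-i)) := inferInstance
    exact GrMod.isZero_of_forall fun z => this.elim _ _
  exact ⟨-n, -m, (CochainComplex.isStrictlyGE_iff _ _).2 fun i hi => hz i (Or.inl hi),
    (CochainComplex.isStrictlyLE_iff _ _).2 fun i hi => hz i (Or.inr hi)⟩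

lemma bounded_R [HasDerivedCategory.{w} (EMod K V)] (F : BddCx (SMod K V)) :
    DerivedCategory.TStructure.t.bounded ((DerivedCategory.Q (C := EMod K V)).obj ((R K V).obj F)) :=
  bounded_Q_totalize degreewiseExact_R₀ R₀_isStrictlyGE R₀_exactAt F

lemma bounded_L [HasDerivedCategory.{w} (SMod K V)] (F : BddCx (EMod K V)) :
    DerivedCategory.TStructure.t.bounded ((DerivedCategory.Q (C := SMod K V)).obj ((L K V).obj F)) :=
  bounded_Q_totalize degreewiseExact_L₀
    (fun P => (L₀_isStrictly P).imp fun _ h => h.choose_spec.1)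
    (fun P => by
      obtain ⟨m, n, h₁, h₂⟩ := L₀_isStrictly P
      exact ⟨n, fun j hj => ShortComplex.exact_of_isZero_X₂ _
        (((L₀ : EMod K V ⥤ _).obj P).isZero_of_isStrictlyLE n j hj)⟩) F

end

end

section

/-! ### The functor `R` reflects quasi-isomorphisms -/

section

variable {C D : Type*} [Category* C] [Category* D] [Abelian C] [Abelian D]
  {Φ : C ⥤ CochainComplex D ℤ} [Φ.Additive]

/-- If the last differential is surjective, `F` is quasi-isomorphic to its truncation one degree
lower. The total complex of this truncation is again acyclic because `totalize` preserves
quasi-isomorphisms, and induction on the length applies. -/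
lemma acyclic_of_acyclic_totalize (hΦ : DegreewiseExact Φ)
    (h : ∀ F : BddCx C, ((totalize Φ).obj F).Acyclic → ∀ b c, b + 1 = c →
      IsZero (F.obj.X (c + 1)) → Epi (F.obj.d b c))
    (F : BddCx C) (hF : ((totalize Φ).obj F).Acyclic) : F.obj.Acyclic := by
  obtain ⟨a, b, ha, hb⟩ := id F.property
  obtain ⟨n, hn⟩ : ∃ n : ℕ, b < a + n := ⟨(b - a + 1).toNat, by omega⟩
  induction n generalizing F b with
  | zero =>
    refine acyclic_of_isZero fun i => ?_
    by_cases h : a ≤ i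
    · exact F.obj.isZero_of_isStrictlyLE b i (by omega)
    · exact F.obj.isZero_of_isStrictlyGE a i (by omega)
  | succ n ih =>
    have hz (i : ℤ) (hi : b < i) : IsZero (F.obj.X i) := F.obj.isZero_of_isStrictlyLE b i hi
    have hle : F.obj.IsLE (b - 1) := (CochainComplex.isLE_iff _ _).2 fun i hi => by
      by_cases hib : i = b
      · subst hib
        rw [exactAt_iff_exact _ (i - 1) i (i + 1) (by omega) rfl,
          ShortComplex.exact_iff_epi _ ((hz (i + 1) (by omega)).eq_of_tgt _ _)]
        exact h F hF (i - 1) i (by omega) (hz _ (by omega))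
      · exact ShortComplex.exact_of_isZero_X₂ _ (hz i (by omega))
    let F' : BddCx C := ⟨F.obj.truncLE (b - 1), a, b - 1, inferInstance, inferInstance⟩
    let f : F' ⟶ F := ObjectProperty.homMk (F.obj.ιTruncLE (b - 1))
    have hf : QuasiIso f.hom := (F.obj.quasiIso_ιTruncLE_iff (b - 1)).2 hle
    have hf' : QuasiIso ((totalize Φ).map f) := quasiIso_totalize hΦ f hf
    have := ih F' (fun i => (exactAt_iff_of_quasiIsoAt ((totalize Φ).map f) i).2 (hF i)) (b - 1)
      (inferInstanceAs ((F.obj.truncLE (b - 1)).IsStrictlyGE a))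
      (inferInstanceAs ((F.obj.truncLE (b - 1)).IsStrictlyLE (b - 1))) (by push_cast at hn; omega)
    exact fun i => (exactAt_iff_of_quasiIsoAt f.hom i).1 (this i)

lemma quasiIso_of_quasiIso_totalize (hΦ : DegreewiseExact Φ)
    (h : ∀ F : BddCx C, ((totalize Φ).obj F).Acyclic → ∀ b c, b + 1 = c →
      IsZero (F.obj.X (c + 1)) → Epi (F.obj.d b c)) {F G : BddCx C} (f : F ⟶ G)
    (hf : QuasiIso ((totalize Φ).map f)) : QuasiIso f.hom := by
  rw [quasiIso_iff_acyclic_mappingCone] at hf ⊢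
  refine acyclic_of_acyclic_totalize hΦ h (coneB f) fun i => ?_
  exact (exactAt_iff_of_quasiIsoAt (totalConeIso Φ f).hom i).1 (hf i)

end

section

variable {K : Type u} [Field K] {A : Type u} [Ring A] [Algebra K A] {𝒜 : ℤ → Submodule K A}
  {M N P : GrMod 𝒜}

lemma GrMod.lin_neg (f : M ⟶ N) (y : M.carrier) : Hom.lin (-f) y = -Hom.lin f y := rfl

lemma GrMod.lin_units_smul (s : ℤˣ) (f : M ⟶ N) (y : M.carrier) :
    Hom.lin (s • f) y = s • Hom.lin f y := by
  rcases Int.units_eq_one_or s with rfl | rfl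
  · rw [one_smul, one_smul]
  · rw [Units.neg_smul, one_smul, Units.neg_smul, one_smul, lin_neg]

instance [IsNoetherianRing A] : CategoryWithHomology (GrMod 𝒜) := categoryWithHomology_of_abelian

variable [IsNoetherianRing A] {C : Type*} [Category* C] [Preadditive C]
  (Φ : C ⥤ CochainComplex (GrMod 𝒜) ℤ) [Φ.Additive] {F : BddCx C}

lemma lin_d_totalι (i j n i' j' n' : ℤ) (h : i + j = n) (hi : i + 1 = i') (hj : j + 1 = j')
    (hn : n + 1 = n') (y : ((Φ.obj (F.obj.X i)).X j).carrier) :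
    GrMod.Hom.lin (((totalize Φ).obj F).d n n') (GrMod.Hom.lin (totalι Φ F i j n h) y) =
      GrMod.Hom.lin (totalι Φ F i' j n' (by omega))
        (GrMod.Hom.lin ((Φ.map (F.obj.d i i')).f j) y) +
      i.negOnePow • GrMod.Hom.lin (totalι Φ F i j' n' (by omega))
        (GrMod.Hom.lin ((Φ.obj (F.obj.X i)).d j j') y) :=
  (congrArg (fun k => GrMod.Hom.lin k y) (totalι_d Φ i j n i' j' n' h hi hj hn)).trans
    (congrArg (fun t => GrMod.Hom.lin (totalι Φ F i' j n' (by omega))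
      (GrMod.Hom.lin ((Φ.map (F.obj.d i i')).f j) y) + t) (GrMod.lin_units_smul _ _ _))

lemma lin_totalπ_d (i j n i' j' n' : ℤ) (h : i' + j' = n') (hi : i + 1 = i') (hj : j + 1 = j')
    (hn : n + 1 = n') (y : (((totalize Φ).obj F).X n).carrier) :
    GrMod.Hom.lin (totalπ Φ F i' j' n' h) (GrMod.Hom.lin (((totalize Φ).obj F).d n n') y) =
      GrMod.Hom.lin ((Φ.map (F.obj.d i i')).f j')
        (GrMod.Hom.lin (totalπ Φ F i j' n (by omega)) y) +
      i'.negOnePow • GrMod.Hom.lin ((Φ.obj (F.obj.X i')).d j j')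
        (GrMod.Hom.lin (totalπ Φ F i' j n (by omega)) y) :=
  (congrArg (fun k => GrMod.Hom.lin k y) (total_d_π Φ i j n i' j' n' h hi hj hn)).trans
    (congrArg (fun t => GrMod.Hom.lin ((Φ.map (F.obj.d i i')).f j')
      (GrMod.Hom.lin (totalπ Φ F i j' n (by omega)) y) + t) (GrMod.lin_units_smul _ _ _))

end

section

variable {K : Type u} [Field K] {V : Type u} [AddCommGroup V] [Module K V] [FiniteDimensional K V]

/-- The element of `Hom_K(E, N)` that sends `1` to `y` and elements of other degrees to zero. -/
noncomputable def socle {N : Type u} [AddCommGroup N] [Module K N] (y : N) : HomE K V N :=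
  HomE.of (LinearMap.toSpanSingleton K N y ∘ₗ
    (ExteriorAlgebra.algebraMapInv : ExtV K V →ₐ[K] K).toLinearMap)

/-- The augmentation of `E` kills every product `e_k b`, so each element of this form is a cycle. -/
lemma Rd_socle (M : SMod K V) {i j : ℤ} (h : i + 1 = j) (y : M.deg i) :
    GrMod.Hom.lin (Rd M h) (socle y : HomE K V (M.deg i)) = 0 := by
  refine HomE.ext fun b => Subtype.ext ((Rd_apply M h _ b).trans ?_)
  refine Finset.sum_eq_zero fun k _ => ?_
  have : HomE.fn (socle y : HomE K V (M.deg i)) (e K V k * b) = 0 := by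
    change (ExteriorAlgebra.algebraMapInv (e K V k * b) : K) • y = 0
    rw [map_mul, e, ExteriorAlgebra.algebraMapInv, ExteriorAlgebra.lift_ι_apply]
    simp
  rw [this]
  exact smul_zero _

lemma socle_one {N : Type u} [AddCommGroup N] [Module K N] (y : N) :
    HomE.fn (socle y : HomE K V N) 1 = y := by
  change (ExteriorAlgebra.algebraMapInv (1 : ExtV K V) : K) • y = y
  rw [map_one, one_smul]

lemma R₀_d (M : SMod K V) {i j : ℤ} (h : i + 1 = j) :
    ((R₀ : SMod K V ⥤ _).obj M).d i j = Rd M h := dif_pos h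

lemma L₀_d (P : EMod K V) {i j : ℤ} (h : i + 1 = j) :
    ((L₀ : EMod K V ⥤ _).obj P).d i j = Ld P h := dif_pos h

/-- Evaluation at `1` turns a bounding relation for `socle y` into the statement that `y` is in the
image of `f` modulo multiples of the `x_k`. This is the input of the Nakayama argument. -/
lemma eq_of_socle_eq {M N : SMod K V} (f : N ⟶ M) {i j : ℤ} (h : i + 1 = j) (y : M.deg j)
    (β : HomE K V (N.deg j)) (γ : HomE K V (M.deg i)) (s : ℤˣ)
    (H : (socle y : HomE K V (M.deg j)) = GrMod.Hom.lin (homEMap (GrMod.Hom.onDeg f j) j) β +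
      s • GrMod.Hom.lin (Rd M h) γ) :
    (y : M.carrier) = GrMod.Hom.lin f (HomE.fn β 1) +
      s • ∑ k, x K V k • ((HomE.fn γ (e K V k * 1) : M.deg i) : M.carrier) := by
  let ev : HomE K V (M.deg j) →+ M.carrier :=
    { toFun := fun δ => ((HomE.fn δ 1 : M.deg j) : M.carrier)
      map_zero' := rfl
      map_add' := fun _ _ => rfl }
  have h₁ : ev (GrMod.Hom.lin (Rd M h) γ) = _ := Rd_apply M h γ 1
  have h₂ : ev (socle y) = y := congrArg Subtype.val (socle_one y)
  rw [← h₁, ← h₂, H, Units.smul_def, Units.smul_def]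
  refine (map_add ev _ _).trans ?_
  refine congrArg (ev (GrMod.Hom.lin (homEMap (GrMod.Hom.onDeg f j) j) β) + ·) ?_
  exact map_zsmul ev _ _

/-- Graded Nakayama, by induction on the degree `t` of a homogeneous `y`. Since `F^{c+1} = 0`, the
element `socle y` is a cycle of `R(F)`, hence a boundary. Evaluation at `1` gives `y` as an element
of the image plus a sum of terms `x_k y_k` with `y_k` of degree `t - 1`. The induction starts
because `F^c` vanishes in low degrees. -/
lemma exists_eq_d_of_acyclic (F : BddCx (SMod K V)) (hF : ((R K V).obj F).Acyclic) (b c : ℤ)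
    (hbc : b + 1 = c) (hc : IsZero (F.obj.X (c + 1))) (y : (F.obj.X c).carrier) :
    ∃ z, GrMod.Hom.lin (F.obj.d b c) z = y := by
  obtain ⟨m, hm⟩ := exists_deg_eq_zero_of_lt (F.obj.X c)
  have key (n : ℕ) : ∀ t, t < m + n → ∀ y ∈ (F.obj.X c).deg t,
      y ∈ LinearMap.range (GrMod.Hom.lin (F.obj.d b c)) := by
    induction n with
    | zero => exact fun t ht y hy => by rw [hm t (by simpa using ht) y hy]; exact zero_mem _
    | succ n ih =>
      intro t ht y hy
      let α : (((R₀ : SMod K V ⥤ _).obj (F.obj.X c)).X t).carrier :=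
        (socle ⟨y, hy⟩ : HomE K V ((F.obj.X c).deg t))
      have hα : GrMod.Hom.lin (((R₀ : SMod K V ⥤ _).obj (F.obj.X c)).d t (t + 1)) α = 0 :=
        (congrArg (fun k => GrMod.Hom.lin k α) (R₀_d (F.obj.X c) rfl)).trans
          (Rd_socle _ rfl _)
      let ω : (((R K V).obj F).X (c + t)).carrier :=
        GrMod.Hom.lin (totalι R₀ F c t (c + t) rfl) α
      have hω : GrMod.Hom.lin (((R K V).obj F).d (c + t) (c + t + 1)) ω = 0 := by
        have h₀ : (R₀.map (F.obj.d c (c + 1))).f t = 0 := by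
          rw [hc.eq_of_tgt (F.obj.d c (c + 1)) 0, Functor.map_zero, HomologicalComplex.zero_f]
        refine (lin_d_totalι R₀ c t (c + t) (c + 1) (t + 1) (c + t + 1) rfl rfl rfl rfl α).trans ?_
        rw [hα, h₀, map_zero, smul_zero, add_zero]
        exact map_zero _
      obtain ⟨v, hv⟩ := (GrMod.exact_iff _).1
        ((exactAt_iff_exact _ (c + t - 1) (c + t) (c + t + 1) (by omega) rfl).1 (hF (c + t))) ω hω
      have h₁ : GrMod.Hom.lin (totalπ R₀ F c t (c + t) rfl) ω = α :=
        congrArg (fun k => GrMod.Hom.lin k α) (totalι_π R₀ c t (c + t) rfl)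
      -- Only these two components of `v` contribute to the component of its differential in
      -- position `(c, t)`.
      let β : HomE K V ((F.obj.X b).deg t) :=
        GrMod.Hom.lin (totalπ R₀ F b t (c + t - 1) (by omega)) v
      let γ : HomE K V ((F.obj.X c).deg (t - 1)) :=
        GrMod.Hom.lin (totalπ R₀ F c (t - 1) (c + t - 1) (by omega)) v
      have h₂ : α = GrMod.Hom.lin ((R₀.map (F.obj.d b c)).f t) β +
          c.negOnePow • GrMod.Hom.lin (((R₀ : SMod K V ⥤ _).obj (F.obj.X c)).d (t - 1) t) γ := by
        rw [← h₁, ← hv]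
        exact lin_totalπ_d R₀ b (t - 1) (c + t - 1) c t (c + t) rfl hbc (by omega) (by omega) v
      rw [R₀_d (F.obj.X c) (show t - 1 + 1 = t by omega)] at h₂
      have h₃ := eq_of_socle_eq (F.obj.d b c) (show t - 1 + 1 = t by omega) ⟨y, hy⟩ β γ _ h₂
      change y = _ at h₃
      rw [h₃, Units.smul_def]
      exact add_mem ⟨_, rfl⟩ (zsmul_mem (sum_mem fun k _ => Submodule.smul_mem _ _
        (ih (t - 1) (by push_cast at ht; omega) _ (HomE.fn γ (e K V k * 1)).2)) _)
  obtain ⟨T, hT⟩ := exists_eq_sum_component (F.obj.X c).isInternal y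
  have : y ∈ LinearMap.range (GrMod.Hom.lin (F.obj.d b c)) := by
    rw [hT]
    exact sum_mem fun t _ => key (t - m + 1).toNat t (by omega) _ (component_mem _ _ _)
  exact this

lemma quasiIso_of_quasiIso_R {F G : BddCx (SMod K V)} (f : F ⟶ G)
    (hf : QuasiIso ((R K V).map f)) : QuasiIso f.hom :=
  quasiIso_of_quasiIso_totalize (C := SMod K V) (D := EMod K V) degreewiseExact_R₀
    (fun F hF b c hbc hc => GrMod.epi_of_surjective _ (exists_eq_d_of_acyclic F hF b c hbc hc)) f hf

end

end

section

/-! ### Devissage for natural quasi-isomorphisms -/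

section Devissage

open ComposableArrows HomologicalComplex

variable {C D : Type*} [Category* C] [Category* D] [Abelian C] [Abelian D]

/-- The five lemma, applied to the long exact homology sequences. -/
lemma quasiIso_τ₂ {S₁ S₂ : ShortComplex (CochainComplex C ℤ)} (φ : S₁ ⟶ S₂)
    (hS₁ : S₁.ShortExact) (hS₂ : S₂.ShortExact) (h₁ : QuasiIso φ.τ₁) (h₃ : QuasiIso φ.τ₃) :
    QuasiIso φ.τ₂ := by
  rw [quasiIso_iff]
  intro i
  rw [quasiIsoAt_iff_isIso_homologyMap]
  have hi : (ComplexShape.up ℤ).Rel (i - 1) i := by simp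
  have hi' : (ComplexShape.up ℤ).Rel i (i + 1) := by simp
  have hR {S : ShortComplex (CochainComplex C ℤ)} (hS : S.ShortExact) :
      (mk₄ (hS.δ (i - 1) i hi) (homologyMap S.f i) (homologyMap S.g i)
        (hS.δ i (i + 1) hi')).Exact :=
    exact_of_δ₀ (hS.homology_exact₁ (i - 1) i hi).exact_toComposableArrows
      (exact_of_δ₀ (hS.homology_exact₂ i).exact_toComposableArrows
        (hS.homology_exact₃ i (i + 1) hi').exact_toComposableArrows)
  have hf : homologyMap S₁.f i ≫ homologyMap φ.τ₂ i =
      homologyMap φ.τ₁ i ≫ homologyMap S₂.f i := by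
    rw [← homologyMap_comp, ← homologyMap_comp, φ.comm₁₂]
  have hg : homologyMap S₁.g i ≫ homologyMap φ.τ₃ i =
      homologyMap φ.τ₂ i ≫ homologyMap S₂.g i := by
    rw [← homologyMap_comp, ← homologyMap_comp, φ.comm₂₃]
  let ψ : mk₄ (hS₁.δ (i - 1) i hi) (homologyMap S₁.f i) (homologyMap S₁.g i)
        (hS₁.δ i (i + 1) hi') ⟶ mk₄ (hS₂.δ (i - 1) i hi) (homologyMap S₂.f i)
        (homologyMap S₂.g i) (hS₂.δ i (i + 1) hi') :=
    homMk₄ (homologyMap φ.τ₃ (i - 1)) (homologyMap φ.τ₁ i) (homologyMap φ.τ₂ i)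
      (homologyMap φ.τ₃ i) (homologyMap φ.τ₁ (i + 1))
      (HomologySequence.δ_naturality φ hS₁ hS₂ (i - 1) i hi) hf hg
      (HomologySequence.δ_naturality φ hS₁ hS₂ i (i + 1) hi')
  have e₀ : IsIso (homologyMap φ.τ₃ (i - 1)) := inferInstance
  have e₁ : IsIso (homologyMap φ.τ₁ i) := inferInstance
  have e₃ : IsIso (homologyMap φ.τ₃ i) := inferInstance
  have e₄ : IsIso (homologyMap φ.τ₁ (i + 1)) := inferInstance
  exact Abelian.isIso_of_epi_of_isIso_of_isIso_of_mono (hR hS₁) (hR hS₂) ψ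
    (IsIso.epi_of_iso (homologyMap φ.τ₃ (i - 1))) e₁ e₃
    (IsIso.mono_of_iso (homologyMap φ.τ₁ (i + 1)))

/-- A module, regarded as a complex that is concentrated in one degree. -/
noncomputable def singleB (a : ℤ) : C ⥤ BddCx C :=
  (bounded C).lift (HomologicalComplex.single C (ComplexShape.up ℤ) a)
    fun _ => ⟨a, a, inferInstance, inferInstance⟩

variable {A B : BddCx C ⥤ CochainComplex D ℤ} [A.PreservesZeroMorphisms]
  [B.PreservesZeroMorphisms] (η : A ⟶ B)

/-- The map of short complexes given by a natural transformation. -/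
def shortComplexMap (S : ShortComplex (BddCx C)) : S.map A ⟶ S.map B where
  τ₁ := η.app S.X₁
  τ₂ := η.app S.X₂
  τ₃ := η.app S.X₃
  comm₁₂ := (η.naturality S.f).symm
  comm₂₃ := (η.naturality S.g).symm

variable {η} (hA : ∀ S : ShortComplex (BddCx C), (S.map (bounded C).ι).ShortExact →
    (S.map A).ShortExact)
  (hB : ∀ S : ShortComplex (BddCx C), (S.map (bounded C).ι).ShortExact → (S.map B).ShortExact)

lemma quasiIso_app_of_shortExact (S : ShortComplex (BddCx C))
    (hA : (S.map A).ShortExact) (hB : (S.map B).ShortExact)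
    (h₁ : QuasiIso (η.app S.X₁)) (h₃ : QuasiIso (η.app S.X₃)) : QuasiIso (η.app S.X₂) :=
  quasiIso_τ₂ (shortComplexMap η S) hA hB h₁ h₃

/-- `bounded_induction` splits off one term at a time, and a complex concentrated in one degree is
isomorphic to a `singleB`. -/
lemma quasiIso_app_of_single
    (hA : ∀ S : ShortComplex (BddCx C), (S.map (bounded C).ι).ShortExact → (S.map A).ShortExact)
    (hB : ∀ S : ShortComplex (BddCx C), (S.map (bounded C).ι).ShortExact → (S.map B).ShortExact)
    (h : ∀ a M, QuasiIso (η.app ((singleB a).obj M))) (F : BddCx C) : QuasiIso (η.app F) := by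
  refine bounded_induction (fun F => QuasiIso (η.app F)) (fun a F hF => ?_)
    (fun S hS h₁ h₃ => quasiIso_app_of_shortExact S (hA S hS) (hB S hS) h₁ h₃) F
  have : F.obj.IsStrictlyGE a := (CochainComplex.isStrictlyGE_iff _ _).2
    fun i hi => hF i (by omega)
  have : F.obj.IsStrictlyLE a := (CochainComplex.isStrictlyLE_iff _ _).2
    fun i hi => hF i (by omega)
  obtain ⟨M, ⟨e⟩⟩ := F.obj.exists_iso_single a
  let e' : F ≅ (singleB a).obj M := (bounded C).fullyFaithfulι.preimageIso e
  have := h a M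
  exact (quasiIso_iff_of_arrow_mk_iso _ _ (Arrow.isoMk (A.mapIso e') (B.mapIso e')
    (η.naturality e'.hom))).2 this

lemma quasiIso_app_single_of_shortExact
    (hA : ∀ S : ShortComplex (BddCx C), (S.map (bounded C).ι).ShortExact → (S.map A).ShortExact)
    (hB : ∀ S : ShortComplex (BddCx C), (S.map (bounded C).ι).ShortExact → (S.map B).ShortExact)
    (S : ShortComplex C) (hS : S.ShortExact) (a : ℤ)
    (h₁ : QuasiIso (η.app ((singleB a).obj S.X₁))) (h₃ : QuasiIso (η.app ((singleB a).obj S.X₃))) :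
    QuasiIso (η.app ((singleB a).obj S.X₂)) := by
  let S' : ShortComplex (BddCx C) := ShortComplex.mk ((singleB a).map S.f) ((singleB a).map S.g) (by
    rw [← Functor.map_comp, S.zero]
    exact (bounded C).ι.map_injective
      (Functor.map_zero (HomologicalComplex.single C (ComplexShape.up ℤ) a) _ _))
  have hS' : (S'.map (bounded C).ι).ShortExact :=
    hS.map_of_exact (HomologicalComplex.single C (ComplexShape.up ℤ) a)
  exact quasiIso_app_of_shortExact S' (hA S' hS') (hB S' hS') h₁ h₃

end Devissage

end

section

/-! ### Exactness of the Koszul complex -/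

section KoszulExact

variable {K : Type u} [Field K] {V : Type u} [AddCommGroup V] [Module K V] [FiniteDimensional K V]

variable (K V) in
/-- The identification of the symmetric algebra with a polynomial ring. -/
noncomputable def symEquiv : SymW K V ≃ₐ[K] MvPolynomial (Fin (Module.finrank K V)) K :=
  SymmetricAlgebra.equivMvPolynomial (Module.finBasis K V).dualBasis

lemma symEquiv_x (k : Fin (Module.finrank K V)) : symEquiv K V (x K V k) = MvPolynomial.X k := by
  rw [symEquiv, x, ← (Module.finBasis K V).coe_dualBasis]
  exact SymmetricAlgebra.equivMvPolynomial_ι_apply _ _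

variable (K V) in
/-- Division by the variable `x_k`, which sends the monomials that do not involve `x_k` to zero. -/
noncomputable def divX (k : Fin (Module.finrank K V)) : SymW K V →ₗ[K] SymW K V :=
  (symEquiv K V).symm.toLinearMap ∘ₗ
    { toFun := fun p => p.divMonomial (Finsupp.single k 1)
      map_add' := fun p q => by ext; simp [MvPolynomial.coeff_divMonomial]
      map_smul' := fun c p => by ext; simp [MvPolynomial.coeff_divMonomial] } ∘ₗ
    (symEquiv K V).toLinearMap

lemma divX_apply (k : Fin (Module.finrank K V)) (s : SymW K V) :
    divX K V k s = (symEquiv K V).symm ((symEquiv K V s).divMonomial (Finsupp.single k 1)) := rfl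

lemma divX_x_mul (k : Fin (Module.finrank K V)) (s : SymW K V) :
    divX K V k (x K V k * s) = s := by
  rw [divX_apply, map_mul, symEquiv_x, MvPolynomial.X_mul_divMonomial, AlgEquiv.symm_apply_apply]

lemma divX_x_mul_of_ne {k l : Fin (Module.finrank K V)} (h : k ≠ l) (s : SymW K V) :
    divX K V k (x K V l * s) = x K V l * divX K V k s := by
  apply (symEquiv K V).injective
  rw [divX_apply, divX_apply, map_mul, map_mul, AlgEquiv.apply_symm_apply,
    AlgEquiv.apply_symm_apply, symEquiv_x]
  ext m
  rw [MvPolynomial.coeff_divMonomial, MvPolynomial.coeff_X_mul', MvPolynomial.coeff_X_mul',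
    MvPolynomial.coeff_divMonomial]
  have hs : l ∈ (Finsupp.single k 1 + m).support ↔ l ∈ m.support := by
    simp [h]
  by_cases hl : l ∈ m.support
  · rw [if_pos hl, if_pos (hs.2 hl)]
    congr 1
    rw [add_tsub_assoc_of_le]
    rw [Finsupp.single_le_iff]
    exact Nat.one_le_iff_ne_zero.2 (Finsupp.mem_support_iff.1 hl)
  · rw [if_neg hl, if_neg (mt hs.1 hl)]

lemma divX_one (k : Fin (Module.finrank K V)) : divX K V k 1 = 0 := by
  have h : (1 : MvPolynomial (Fin (Module.finrank K V)) K).divMonomial (Finsupp.single k 1) = 0 := by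
    ext m
    rw [MvPolynomial.coeff_divMonomial, MvPolynomial.coeff_one, if_neg, MvPolynomial.coeff_zero]
    intro h
    have := DFunLike.congr_fun h k
    simp at this
    omega
  rw [divX_apply, map_one, h, map_zero]

variable {M : Type u} [AddCommGroup M] [Module K M] [Module (SymW K V) M]
  [IsScalarTower K (SymW K V) M]

lemma koszul_koszul (α : ExtV K V →ₗ[K] M) : koszul M (koszul M α) = 0 := by
  refine LinearMap.ext fun b => ?_
  rw [koszul_apply, LinearMap.zero_apply]
  simp only [koszul_apply, Finset.smul_sum, smul_smul, ← mul_assoc]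
  refine sum_sum_eq_zero _ (fun k => ?_) fun k l => ?_
  · rw [e_mul_self]
    simp
  · rw [mul_comm (x K V l), ← smul_add, ← map_add, ← add_mul, e_mul_add_swap]
    simp

/-- The composite of the projections `1 - x_k D_k`. -/
noncomputable def koszulProj (D : Fin (Module.finrank K V) → M →ₗ[K] M) :
    List (Fin (Module.finrank K V)) → M →ₗ[K] M
  | [] => LinearMap.id
  | k :: T => (LinearMap.id - Algebra.lsmul K K M (x K V k) ∘ₗ D k) ∘ₗ koszulProj D T

lemma koszulProj_cons (D : Fin (Module.finrank K V) → M →ₗ[K] M) (k : Fin (Module.finrank K V))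
    (T : List (Fin (Module.finrank K V))) (m : M) :
    koszulProj D (k :: T) m = koszulProj D T m - x K V k • D k (koszulProj D T m) := rfl

variable {D : Fin (Module.finrank K V) → M →ₗ[K] M} (h₁ : ∀ k m, D k (x K V k • m) = m)
  (h₂ : ∀ k l, k ≠ l → ∀ m, D k (x K V l • m) = x K V l • D k m)

lemma koszulProj_smul_of_notMem (h₂ : ∀ k l, k ≠ l → ∀ m, D k (x K V l • m) = x K V l • D k m)
    (l : Fin (Module.finrank K V)) (T : List (Fin (Module.finrank K V))) (hl : l ∉ T) (m : M) :
    koszulProj D T (x K V l • m) = x K V l • koszulProj D T m := by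
  induction T with
  | nil => rfl
  | cons k T ih =>
    rw [List.mem_cons, not_or] at hl
    rw [koszulProj_cons, koszulProj_cons, ih hl.2, h₂ k l (Ne.symm hl.1), smul_sub,
      smul_comm (x K V k)]

/-- The factor `1 - x_l D_l` annihilates multiples of `x_l`, because `D_l` is a left inverse of
`x_l`; the factors for other indices commute with `x_l`. -/
lemma koszulProj_smul (h₁ : ∀ k m, D k (x K V k • m) = m)
    (h₂ : ∀ k l, k ≠ l → ∀ m, D k (x K V l • m) = x K V l • D k m)
    (l : Fin (Module.finrank K V)) (T : List (Fin (Module.finrank K V))) (hl : l ∈ T) (m : M) :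
    koszulProj D T (x K V l • m) = 0 := by
  induction T with
  | nil => simp at hl
  | cons k T ih =>
    rw [koszulProj_cons]
    by_cases hT : l ∈ T
    · rw [ih hT, map_zero, smul_zero, sub_zero]
    · obtain rfl : l = k := by simpa [hT] using hl
      rw [koszulProj_smul_of_notMem h₂ l T hT, h₁, sub_self]

/-- One variable is treated at a time. If `c` is the contraction with the `k`-th coordinate, then `γ
↦ D_k ∘ γ ∘ c` is a homotopy which shows that a cycle `γ` is cohomologous to `b ↦ (1 - x_k D_k)
γ(c(e_k b))`. Iteration produces the composite of the projections. -/
lemma exists_koszul_add (h₁ : ∀ k m, D k (x K V k • m) = m)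
    (h₂ : ∀ k l, k ≠ l → ∀ m, D k (x K V l • m) = x K V l • D k m)
    (α : ExtV K V →ₗ[K] M) (hα : koszul M α = 0) (T : List (Fin (Module.finrank K V))) :
    ∃ (β : ExtV K V →ₗ[K] M) (θ : ExtV K V →ₗ[K] ExtV K V),
      α = koszul M β + koszulProj D T ∘ₗ α ∘ₗ θ := by
  induction T with
  | nil => exact ⟨0, LinearMap.id, by rw [map_zero, zero_add]; rfl⟩
  | cons k T ih =>
    obtain ⟨β, θ, h⟩ := ih
    set γ := koszulProj D T ∘ₗ α ∘ₗ θ with hγ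
    have hγ' : koszul M γ = 0 := by
      have := congrArg (koszul M) h
      rw [hα, map_add, koszul_koszul, zero_add] at this
      exact this.symm
    let c : ExtV K V →ₗ[K] ExtV K V :=
      CliffordAlgebra.contractLeft ((Module.finBasis K V).coord k)
    have hc (l : Fin (Module.finrank K V)) (b : ExtV K V) :
        c (e K V l * b) = (if l = k then b else 0) - e K V l * c b := by
      refine (CliffordAlgebra.contractLeft_ι_mul _ _ _).trans ?_
      rw [Module.Basis.coord_apply, Module.Basis.repr_self, Finsupp.single_apply, ite_smul,
        one_smul, zero_smul]
      rfl
    refine ⟨β + D k ∘ₗ γ ∘ₗ c, θ ∘ₗ c ∘ₗ LinearMap.mulLeft K (e K V k), ?_⟩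
    rw [map_add, add_assoc]
    refine h.trans (congrArg (koszul M β + ·) (LinearMap.ext fun b => ?_))
    change γ b = koszul M (D k ∘ₗ γ ∘ₗ c) b +
      (γ (c (e K V k * b)) - x K V k • D k (γ (c (e K V k * b))))
    -- Applying `D_k` to the cycle condition at `c(b)` expresses `γ(e_k c(b))` through the terms
    -- with `l ≠ k`.
    have h₃ := congrArg (D k) (LinearMap.congr_fun hγ' (c b))
    rw [koszul_apply, LinearMap.zero_apply, map_zero, map_sum,
      ← Finset.add_sum_erase _ _ (Finset.mem_univ k), h₁] at h₃
    have h₄ : ∀ l ∈ Finset.univ.erase k, D k (x K V l • γ (e K V l * c b)) =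
        x K V l • D k (γ (e K V l * c b)) := fun l hl => h₂ k l (Finset.ne_of_mem_erase hl).symm _
    rw [Finset.sum_congr rfl h₄] at h₃
    have h₅ : koszul M (D k ∘ₗ γ ∘ₗ c) b = x K V k • D k (γ b) -
        ∑ l, x K V l • D k (γ (e K V l * c b)) := by
      rw [koszul_apply]
      simp only [LinearMap.comp_apply, hc, map_sub, smul_sub, Finset.sum_sub_distrib]
      congr 1
      rw [Finset.sum_eq_single k]
      · rw [if_pos rfl]
      · intro l _ hl
        rw [if_neg hl, map_zero, map_zero, smul_zero]
      · simp
    rw [h₅, ← Finset.add_sum_erase _ _ (Finset.mem_univ k), eq_neg_of_add_eq_zero_right h₃, hc,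
      if_pos rfl, map_sub, map_sub, smul_sub]
    abel

lemma eq_zero_of_sum_eq_zero (h₁ : ∀ k m, D k (x K V k • m) = m)
    (h₂ : ∀ k l, k ≠ l → ∀ m, D k (x K V l • m) = x K V l • D k m)
    (m : Fin (Module.finrank K V) → M) (h₃ : ∀ k l, D k (m l) = 0)
    (hm : ∑ k, x K V k • m k = 0) (k : Fin (Module.finrank K V)) : m k = 0 := by
  have h := congrArg (D k) hm
  rw [map_zero, map_sum, Finset.sum_eq_single k, h₁] at h
  · exact h
  · intro l _ hl
    rw [h₂ k l hl.symm, h₃, smul_zero]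
  · simp

/-- A map on the exterior algebra that vanishes on all products `e_k b` factors through the
augmentation. -/
lemma apply_eq_augmentation {N : Type*} [AddCommGroup N] [Module K N] (γ : ExtV K V →ₗ[K] N)
    (h : ∀ k b, γ (e K V k * b) = 0) (a : ExtV K V) :
    γ a = (ExteriorAlgebra.algebraMapInv a : K) • γ 1 := by
  -- The statement is strengthened to all products `a * b`, so that the induction on `a` passes
  -- through products.
  suffices h' : ∀ b, γ (a * b) = (ExteriorAlgebra.algebraMapInv a : K) • γ b by
    rw [← h' 1, mul_one]
  induction a using ExteriorAlgebra.induction with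
  | algebraMap c =>
    intro b
    rw [← Algebra.smul_def, map_smul, AlgHom.commutes]
    rfl
  | ι v =>
    intro b
    rw [ExteriorAlgebra.algebraMapInv, ExteriorAlgebra.lift_ι_apply, LinearMap.zero_apply,
      zero_smul, ← (Module.finBasis K V).sum_repr v, map_sum, Finset.sum_mul, map_sum]
    refine Finset.sum_eq_zero fun k _ => ?_
    rw [map_smul, smul_mul_assoc, map_smul]
    exact (congrArg _ (h k b)).trans (smul_zero _)
  | mul a a' ha ha' =>
    intro b
    rw [mul_assoc, ha, ha', map_mul, mul_smul]
  | add a a' ha ha' =>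
    intro b
    rw [add_mul, map_add, ha, ha', map_add, add_smul]

lemma exists_eq_sum_x_mul {n : ℤ} (hn : 0 < n) {s : SymW K V}
    (hs : s ∈ symDeg K (Module.Dual K V) n) :
    ∃ t : Fin (Module.finrank K V) → SymW K V, s = ∑ k, x K V k * t k := by
  obtain ⟨m, rfl⟩ : ∃ m : ℕ, n = m + 1 := ⟨(n - 1).toNat, by omega⟩
  rw [symDeg, if_pos hn.le, show ((m : ℤ) + 1).toNat = m + 1 by omega, pow_succ'] at hs
  induction hs using Submodule.mul_induction_on' with
  | mem_mul_mem w hw t _ =>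
    obtain ⟨w, rfl⟩ := hw
    refine ⟨fun k => w (Module.finBasis K V k) • t, ?_⟩
    conv_lhs => rw [← (Module.finBasis K V).sum_dual_apply_smul_coord w, map_sum, Finset.sum_mul]
    refine Finset.sum_congr rfl fun k _ => ?_
    rw [map_smul, smul_mul_assoc, mul_smul_comm]
    rfl
  | add s _ s' _ h h' =>
    obtain ⟨t, rfl⟩ := h
    obtain ⟨t', rfl⟩ := h'
    exact ⟨t + t', by simp [mul_add, Finset.sum_add_distrib]⟩

/-! ### The Koszul complex of a free module -/

section TensorS

variable (N : Type u) [AddCommGroup N] [Module K N]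

lemma divX_rTensor_x_smul (k : Fin (Module.finrank K V)) (z : SymW K V ⊗[K] N) :
    (divX K V k).rTensor N (x K V k • z) = z := by
  induction z with
  | zero => simp
  | add z z' h h' => rw [smul_add, map_add, h, h']
  | tmul s y => rw [TensorProduct.smul_tmul', smul_eq_mul, LinearMap.rTensor_tmul, divX_x_mul]

lemma divX_rTensor_x_smul_of_ne (k l : Fin (Module.finrank K V)) (hkl : k ≠ l)
    (z : SymW K V ⊗[K] N) :
    (divX K V k).rTensor N (x K V l • z) = x K V l • (divX K V k).rTensor N z := by
  induction z with
  | zero => simp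
  | add z z' h h' => rw [smul_add, map_add, h, h', map_add, smul_add]
  | tmul s y =>
    rw [TensorProduct.smul_tmul', smul_eq_mul, LinearMap.rTensor_tmul, divX_x_mul_of_ne hkl,
      LinearMap.rTensor_tmul, TensorProduct.smul_tmul', smul_eq_mul]

variable {N} [Module.Finite K N] {d : ℤ}

lemma mem_tensorS_deg_self {z : SymW K V ⊗[K] N} (hz : z ∈ (tensorS K V N d).deg d) :
    ∃ y : N, z = 1 ⊗ₜ[K] y := by
  obtain ⟨z, rfl⟩ := hz
  induction z with
  | zero => exact ⟨0, by simp⟩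
  | add z z' h h' =>
    obtain ⟨y, hy⟩ := h
    obtain ⟨y', hy'⟩ := h'
    exact ⟨y + y', by rw [map_add, hy, hy', TensorProduct.tmul_add]⟩
  | tmul s y =>
    obtain ⟨s, hs⟩ := s
    rw [sub_self, symDeg, if_pos le_rfl, Int.toNat_zero, pow_zero, Submodule.one_eq_range] at hs
    obtain ⟨c, hc⟩ := hs
    refine ⟨c • y, ?_⟩
    change s ⊗ₜ[K] y = _
    rw [← hc, Algebra.linearMap_apply, Algebra.algebraMap_eq_smul_one, TensorProduct.smul_tmul]

lemma tensorS_deg_eq_zero {n : ℤ} (hn : n < d) {z : SymW K V ⊗[K] N}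
    (hz : z ∈ (tensorS K V N d).deg n) : z = 0 := by
  obtain ⟨z, rfl⟩ := hz
  induction z with
  | zero => simp
  | add z z' h h' => rw [map_add, h, h', add_zero]
  | tmul s y =>
    obtain ⟨s, hs⟩ := s
    rw [symDeg, if_neg (by omega), Submodule.mem_bot] at hs
    subst hs
    rw [LinearMap.rTensor_tmul, Submodule.subtype_apply, TensorProduct.zero_tmul]

/-- Above the degree of the generators, every element is a sum of multiples of the `x_k`, and
`koszulProj_smul` applies to each of them. -/
lemma koszulProj_tensorS {n : ℤ} (hn : d < n) {z : SymW K V ⊗[K] N}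
    (hz : z ∈ (tensorS K V N d).deg n) :
    koszulProj (fun k => (divX K V k).rTensor N) (List.finRange _) z = 0 := by
  obtain ⟨z, rfl⟩ := hz
  induction z with
  | zero => simp
  | add z z' h h' => rw [map_add, map_add, h, h', add_zero]
  | tmul s y =>
    obtain ⟨t, ht⟩ := exists_eq_sum_x_mul (by omega) s.2
    rw [LinearMap.rTensor_tmul, Submodule.subtype_apply, ht, TensorProduct.sum_tmul, map_sum]
    refine Finset.sum_eq_zero fun k _ => ?_
    have := koszulProj_smul (D := fun k => (divX K V k).rTensor N) (divX_rTensor_x_smul N)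
      (divX_rTensor_x_smul_of_ne N) k (List.finRange _) (List.mem_finRange k) (t k ⊗ₜ[K] y)
    rwa [TensorProduct.smul_tmul', smul_eq_mul] at this

lemma koszul_proj_comp (M : SMod K V) {i j : ℤ} (h : i + 1 = j) (α : ExtV K V →ₗ[K] M.carrier) :
    koszul M.carrier (M.proj i ∘ₗ α) = M.proj j ∘ₗ koszul M.carrier α := by
  refine LinearMap.ext fun b => ?_
  rw [LinearMap.comp_apply, koszul_apply, koszul_apply, map_sum]
  exact Finset.sum_congr rfl fun k _ => (M.proj_smul (x_mem K V k) (by omega) _).symm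

variable (N) in
-- Below `d` the terms vanish. Above `d` the correction term in `exists_koszul_add` is zero by
-- `koszulProj_tensorS`, so every cycle is a boundary.
lemma R₀_tensorS_exactAt {n : ℤ} (hn : n ≠ d) :
    ((R₀ : SMod K V ⥤ _).obj (tensorS K V N d)).ExactAt n := by
  rcases lt_or_gt_of_ne hn with hn | hn
  · refine ShortComplex.exact_of_isZero_X₂ _ (GrMod.isZero_of_forall fun α => HomE.ext fun b =>
      Subtype.ext ?_)
    exact tensorS_deg_eq_zero hn (HomE.fn α b).2
  · obtain ⟨i, rfl⟩ : ∃ i, n = i + 1 := ⟨n - 1, by omega⟩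
    rw [exactAt_iff_exact _ i (i + 1) (i + 1 + 1) rfl rfl, GrMod.exact_iff]
    intro α hα
    let M : SMod K V := tensorS K V N d
    have hα' : GrMod.Hom.lin (Rd M rfl : homE (M.deg (i + 1)) (i + 1) ⟶ homE (M.deg (i + 1 + 1)) _) α
        = 0 := (congrArg (fun k => GrMod.Hom.lin k α) (R₀_d M rfl)).symm.trans hα
    let α' : ExtV K V →ₗ[K] SymW K V ⊗[K] N := (M.deg (i + 1)).subtype ∘ₗ HomE.fn α
    have h : koszul (SymW K V ⊗[K] N) α' = 0 :=
      (LinearMap.ext fun b => (koszul_apply _ b).trans ((Rd_apply M rfl α b).symm.trans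
        (congrArg (fun γ : HomE K V (M.deg (i + 1 + 1)) =>
          ((HomE.fn γ b : M.deg _) : M.carrier)) hα')))
    obtain ⟨β, θ, hβ⟩ := exists_koszul_add (D := fun k => (divX K V k).rTensor N)
      (divX_rTensor_x_smul N) (divX_rTensor_x_smul_of_ne N) α' h (List.finRange _)
    have h₀ : koszulProj (fun k => (divX K V k).rTensor N) (List.finRange _) ∘ₗ α' ∘ₗ θ = 0 :=
      LinearMap.ext fun b => koszulProj_tensorS hn (HomE.fn α (θ b)).2
    rw [h₀, add_zero] at hβ
    have hβ' := koszul_proj_comp M (rfl : i + 1 = i + 1) β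
    refine ⟨HomE.of ((M.proj i ∘ₗ β).codRestrict (M.deg i) fun b => M.proj_mem _ _), ?_⟩
    refine (congrArg (fun k => GrMod.Hom.lin k _) (R₀_d M rfl)).trans
      (HomE.ext fun b => Subtype.ext ?_)
    refine (Rd_apply M rfl _ b).trans
      ((koszul_apply (M := M.carrier) (M.proj i ∘ₗ β) b).symm.trans ?_)
    rw [hβ']
    refine (congrArg (M.proj (i + 1)) (LinearMap.congr_fun hβ b).symm).trans ?_
    exact M.proj_of_mem (HomE.fn α b).2

/-- This computes the remaining cohomology as `N`. The values of `γ` lie in `1 ⊗ N`, where all `D_l`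
vanish; there the relation `∑ x_k γ(e_k b) = 0` forces every `γ(e_k b)` to be zero, so `γ` is
determined by `γ(1)`. -/
lemma exists_socle_eq (γ : HomE K V ((tensorS K V N d).deg d))
    (hγ : GrMod.Hom.lin (Rd (tensorS K V N d) (rfl : d + 1 = d + 1)) γ = 0) :
    ∃ (y : N) (hy : (1 ⊗ₜ[K] y : SymW K V ⊗[K] N) ∈ (tensorS K V N d).deg d),
      γ = socle ⟨1 ⊗ₜ[K] y, hy⟩ := by
  let M : SMod K V := tensorS K V N d
  obtain ⟨y, hy⟩ := mem_tensorS_deg_self (HomE.fn γ 1).2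
  refine ⟨y, hy ▸ (HomE.fn γ 1).2, HomE.ext fun b => ?_⟩
  have h (k : Fin (Module.finrank K V)) (b : ExtV K V) : HomE.fn γ (e K V k * b) = 0 := by
    have h' : ∑ k, x K V k • ((HomE.fn γ (e K V k * b) : M.deg d) : M.carrier) = 0 :=
      (Rd_apply M rfl γ b).symm.trans (congrArg (fun δ : HomE K V (M.deg (d + 1)) =>
        ((HomE.fn δ b : M.deg _) : M.carrier)) hγ)
    refine Subtype.ext (eq_zero_of_sum_eq_zero (D := fun k => (divX K V k).rTensor N)
      (divX_rTensor_x_smul N) (divX_rTensor_x_smul_of_ne N)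
      (fun k => ((HomE.fn γ (e K V k * b) : M.deg d) : M.carrier)) (fun k l => ?_) h' k)
    obtain ⟨z, hz⟩ := mem_tensorS_deg_self (HomE.fn γ (e K V l * b)).2
    refine (congrArg ((divX K V k).rTensor N) hz).trans ?_
    rw [LinearMap.rTensor_tmul, divX_one, TensorProduct.zero_tmul]
  refine (apply_eq_augmentation (HomE.fn γ) h b).trans ?_
  exact congrArg (fun z => (ExteriorAlgebra.algebraMapInv b : K) • z) (Subtype.ext hy)

end TensorS

end KoszulExact

end

section

/-! ### The unit of the adjunction between `L` and `R` -/

section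

variable {C D : Type*} [Category* C] [Category* D] [Preadditive C] [Preadditive D]
  [HasFiniteCoproducts D] (Φ : C ⥤ CochainComplex D ℤ) [Φ.Additive]

lemma totalize_isStrictlyLE (h : ∀ M, ∃ m, (Φ.obj M).IsStrictlyLE m) (F : BddCx C) :
    ∃ m, ((totalize Φ).obj F).IsStrictlyLE m := by
  choose m hm using h
  obtain ⟨c, hc⟩ : ∃ c : ℤ, ∀ i ∈ supp F, i + m (F.obj.X i) ≤ c := by
    obtain ⟨c, hc⟩ := ((supp F).image fun i => i + m (F.obj.X i)).bddAbove
    exact ⟨c, fun i hi => hc (by simpa using ⟨i, hi, rfl⟩)⟩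
  refine ⟨c, (CochainComplex.isStrictlyLE_iff _ _).2 fun n hn => ?_⟩
  rw [IsZero.iff_id_eq_zero]
  refine total_hom_ext fun i j hij => ?_
  refine IsZero.eq_of_src ?_ _ _
  by_cases hi : i ∈ supp F
  · have := hm (F.obj.X i)
    exact (Φ.obj (F.obj.X i)).isZero_of_isStrictlyLE (m (F.obj.X i)) j (by
      have := hc i hi
      omega)
  · exact isZero_totalX Φ (isZero_of_notMem_supp hi)

end

variable {K : Type u} [Field K] {V : Type u} [AddCommGroup V] [Module K V] [FiniteDimensional K V]

lemma bounded_L_obj (G : BddCx (EMod K V)) : bounded (SMod K V) ((L K V).obj G) := by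
  obtain ⟨a, ha⟩ := totalize_isStrictlyGE (C := EMod K V) (D := SMod K V) (Φ := L₀)
    (fun P => by
      obtain ⟨m, n, h, _⟩ := L₀_isStrictly P
      exact ⟨m, h⟩) G
  obtain ⟨b, hb⟩ := totalize_isStrictlyLE (C := EMod K V) (D := SMod K V) L₀
    (fun P => by
      obtain ⟨m, n, _, h⟩ := L₀_isStrictly P
      exact ⟨n, h⟩) G
  exact ⟨a, b, ha, hb⟩

variable (K V) in
/-- The functor `L`, with values in bounded complexes. -/
noncomputable def LB : BddCx (EMod K V) ⥤ BddCx (SMod K V) :=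
  (bounded (SMod K V)).lift (L K V) bounded_L_obj

instance : (LB K V).Additive where
  map_add {_ _ f g} := (bounded (SMod K V)).ι.map_injective
    ((totalize (L₀ : EMod K V ⥤ _)).map_add (f := f) (g := g))

section Coinduction

variable {P Q : EMod K V} {N N' : Type u} [AddCommGroup N] [Module K N] [Module.Finite K N]
  [AddCommGroup N'] [Module K N'] [Module.Finite K N']

/-- The morphism to `Hom_K(E, N)` given by a linear map to `N`. -/
noncomputable def coind {q : ℤ} (φ : P.carrier →ₗ[K] N)
    (h : ∀ i, i ≠ q → ∀ y ∈ P.deg i, φ y = 0) : P ⟶ homE N q :=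
  GrMod.ofLin
    { toFun := fun g => HomE.of
        (φ ∘ₗ (LinearMap.toSpanSingleton (ExtV K V) P.carrier g).restrictScalars K)
      map_add' := fun g g' => HomE.ext fun b => by
        change φ (b • (g + g')) = φ (b • g) + φ (b • g')
        rw [smul_add, map_add]
      map_smul' := fun a g => HomE.ext fun b => by
        change φ (b • a • g) = φ ((b * a) • g)
        rw [mul_smul] }
    (fun t g hg s hs b hb => h (s + t) (by omega) _
      (SetLike.GradedSMul.smul_mem (B := P.deg) hb hg))

end Coinduction

section Unit

variable (G H : BddCx (EMod K V))

/-- The map `y ↦ 1 ⊗ y`, from a term of `G` to a term of `L(G)`. -/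
noncomputable def unitVal (n j p : ℤ) (h : n + j = p) :
    (G.obj.X n).carrier →ₗ[K] (((LB K V).obj G).obj.X p).carrier :=
  ((GrMod.Hom.lin (totalι (C := EMod K V) (D := SMod K V) L₀ G n j p h)).restrictScalars K) ∘ₗ
    (TensorProduct.mk K (SymW K V) ((G.obj.X n).deg (-j)) 1) ∘ₗ
      ((G.obj.X n).proj (-j)).codRestrict ((G.obj.X n).deg (-j)) (GrMod.proj_mem _ _)

variable {G H}

lemma one_tmul_mem {N : Type u} [AddCommGroup N] [Module K N] [Module.Finite K N] (d : ℤ) (y : N) :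
    (1 ⊗ₜ[K] y : SymW K V ⊗[K] N) ∈ (tensorS K V N d).deg d :=
  ⟨(⟨1, by rw [sub_self]; exact one_mem_symDeg K _⟩ : symDeg K (Module.Dual K V) (d - d)) ⊗ₜ y,
    LinearMap.rTensor_tmul _ _ _ _⟩

lemma unitVal_apply {n j p : ℤ} (h : n + j = p) (y : (G.obj.X n).carrier) :
    unitVal G n j p h y = GrMod.Hom.lin (totalι (C := EMod K V) (D := SMod K V) L₀ G n j p h)
      (1 ⊗ₜ[K] (⟨(G.obj.X n).proj (-j) y, GrMod.proj_mem _ _ _⟩ : (G.obj.X n).deg (-j)) :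
        SymW K V ⊗[K] (G.obj.X n).deg (-j)) := rfl

lemma unitVal_mem {n j p : ℤ} (h : n + j = p) {q : ℤ} (hq : q = -j) (y : (G.obj.X n).carrier) :
    unitVal G n j p h y ∈ (((LB K V).obj G).obj.X p).deg q := by
  subst hq
  exact GrMod.Hom.map_mem (totalι (C := EMod K V) (D := SMod K V) L₀ G n j p h)
    (one_tmul_mem (-j) _)

lemma unitVal_eq_zero {n j p : ℤ} (h : n + j = p) {i : ℤ} (hi : i ≠ -j) {y : (G.obj.X n).carrier}
    (hy : y ∈ (G.obj.X n).deg i) : unitVal G n j p h y = 0 := by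
  have : (⟨(G.obj.X n).proj (-j) y, GrMod.proj_mem _ _ _⟩ : (G.obj.X n).deg (-j)) = 0 :=
    Subtype.ext (GrMod.proj_of_mem_ne _ hy hi)
  rw [unitVal_apply, this]
  refine (congrArg (GrMod.Hom.lin (totalι (C := EMod K V) (D := SMod K V) L₀ G n j p h))
    (TensorProduct.tmul_zero _ _)).trans (map_zero _)

lemma map_unitVal (f : G ⟶ H) {n j p : ℤ} (h : n + j = p) (y : (G.obj.X n).carrier) :
    GrMod.Hom.lin (((LB K V).map f).hom.f p) (unitVal G n j p h y) =
      unitVal H n j p h (GrMod.Hom.lin (f.hom.f n) y) := by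
  refine (congrArg (fun k => GrMod.Hom.lin k _)
    (totalι_map (C := EMod K V) (D := SMod K V) L₀ f n j p h)).trans ?_
  rw [unitVal_apply]
  refine congrArg (GrMod.Hom.lin (totalι (C := EMod K V) (D := SMod K V) L₀ H n j p h)) ?_
  refine congrArg (fun z => (1 ⊗ₜ[K] z : SymW K V ⊗[K] (H.obj.X n).deg (-j))) (Subtype.ext ?_)
  exact (GrMod.proj_hom (f.hom.f n) (-j) y).symm

/-- The elements `1 ⊗ y` generate `L(G)`, so this formula is all that is needed about its
differential. -/
lemma d_unitVal {n j p n' j' p' : ℤ} (h : n + j = p) (hn : n + 1 = n') (hj : j + 1 = j')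
    (hp : p + 1 = p') (y : (G.obj.X n).carrier) :
    GrMod.Hom.lin (((LB K V).obj G).obj.d p p') (unitVal G n j p h y) =
      unitVal G n' j p' (by omega) (GrMod.Hom.lin (G.obj.d n n') y) +
      n.negOnePow • ∑ k, x K V k • unitVal G n j' p' (by omega) (e K V k • y) := by
  refine (lin_d_totalι (C := EMod K V) L₀ n j p n' j' p' h hn hj hp _).trans ?_
  refine congrArg₂ (· + ·) ?_ (congrArg (n.negOnePow • ·) ?_)
  · rw [unitVal_apply]
    refine congrArg (GrMod.Hom.lin (totalι (C := EMod K V) (D := SMod K V) L₀ G n' j p' _)) ?_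
    refine congrArg (fun z => (1 ⊗ₜ[K] z : SymW K V ⊗[K] (G.obj.X n').deg (-j))) (Subtype.ext ?_)
    exact (GrMod.proj_hom (G.obj.d n n') (-j) y).symm
  · let τ := GrMod.Hom.lin (totalι (C := EMod K V) (D := SMod K V) L₀ G n j' p' (by omega))
    refine (congrArg (fun k => τ (GrMod.Hom.lin k _)) (L₀_d (G.obj.X n) hj)).trans ?_
    have h₁ : ∀ z, GrMod.Hom.lin (Ld (G.obj.X n) hj) z = ∑ k,
        GrMod.Hom.lin (tensorSMap K V (d := -j) (d' := -j') (x_mem K V k) (by omega)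
          ((G.obj.X n).act (e_mem K V k) (by omega : -1 + -j = -j'))) z := fun z => by
      rw [Ld]
      exact map_sum (⟨⟨fun f => GrMod.Hom.lin f z, rfl⟩, fun _ _ => rfl⟩ :
        (tensorS K V ((G.obj.X n).deg (-j)) (-j) ⟶ tensorS K V ((G.obj.X n).deg (-j')) (-j')) →+
          (tensorS K V ((G.obj.X n).deg (-j')) (-j')).carrier) _ _
    refine (congrArg τ (h₁ _)).trans ((map_sum τ _ _).trans (Finset.sum_congr rfl fun k _ => ?_))
    rw [unitVal_apply]
    refine Eq.trans (congrArg τ ?_) (map_smul τ (x K V k) _)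
    refine Eq.trans ?_ (TensorProduct.smul_tmul' (x K V k) (1 : SymW K V) _).symm
    refine congrArg₂ (fun a b => a ⊗ₜ[K] b) rfl (Subtype.ext ?_)
    exact (GrMod.proj_smul _ (e_mem K V k) (by omega) y).symm

/-- The signs in the unit. -/
def unitSign (q : ℤ) : ℤˣ := (q * (q + 1) / 2).negOnePow

/-- This recursion characterizes the signs up to a global one. It makes the terms `∑ x_k ⊗ e_k b g`
from the differential of `L(G)` and from that of `R` cancel. -/
lemma unitSign_sub_one (q : ℤ) : unitSign (q - 1) = unitSign q * q.negOnePow := by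
  have h : (q - 1) * (q - 1 + 1) / 2 = q * (q + 1) / 2 - q := by
    rw [show (q - 1) * (q - 1 + 1) = q * (q + 1) + (-q) * 2 by ring, Int.add_mul_ediv_right _ _ two_ne_zero]
    ring
  rw [unitSign, h, Int.negOnePow_sub, unitSign]

/-- The value of an element of `Hom_K(E, M_q)`, as an element of `M`. -/
def HomE.val (M : SMod K V) {q : ℤ} (b : ExtV K V) : HomE K V (M.deg q) →+ M.carrier where
  toFun α := ((HomE.fn α b : M.deg q) : M.carrier)
  map_zero' := rfl
  map_add' _ _ := rfl

lemma HomE.val_units_smul (M : SMod K V) {q : ℤ} (b : ExtV K V) (s : ℤˣ)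
    (α : HomE K V (M.deg q)) : HomE.val M b (s • α) = s • HomE.val M b α := by
  rw [Units.smul_def, Units.smul_def, map_zsmul]

lemma HomE.ext_val {M : SMod K V} {q : ℤ} {α β : HomE K V (M.deg q)}
    (h : ∀ b, HomE.val M b α = HomE.val M b β) : α = β :=
  HomE.ext fun b => Subtype.ext (h b)

lemma HomE.val_Rd (M : SMod K V) {i j : ℤ} (h : i + 1 = j) (α : HomE K V (M.deg i))
    (b : ExtV K V) : HomE.val M b (GrMod.Hom.lin (Rd M h) α) =
      ∑ k, x K V k • HomE.val M (e K V k * b) α := Rd_apply M h α b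

lemma HomE.val_R₀_map {M N : SMod K V} (f : M ⟶ N) {i : ℤ} (α : HomE K V (M.deg i))
    (b : ExtV K V) : HomE.val N b (GrMod.Hom.lin ((R₀.map f).f i) α) =
      GrMod.Hom.lin f (HomE.val M b α) := rfl

lemma HomE.val_lin_units_smul (M : SMod K V) {P : EMod K V} {q : ℤ} (s : ℤˣ)
    (f : P ⟶ homE (M.deg q) q) (g : P.carrier) (b : ExtV K V) :
    HomE.val M b (GrMod.Hom.lin (s • f) g) = s • HomE.val M b (GrMod.Hom.lin f g) := by
  rcases Int.units_eq_one_or s with rfl | rfl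
  · rw [one_smul, one_smul]
  · rw [Units.neg_smul, one_smul, Units.neg_smul, one_smul]
    rfl

variable (G) in
/-- A component of the unit. -/
noncomputable def unitComp (n p q : ℤ) (h : p + q = n) :
    G.obj.X n ⟶ homE ((((LB K V).obj G).obj.X p).deg q) q :=
  unitSign q • coind (q := q)
    (LinearMap.codRestrict ((((LB K V).obj G).obj.X p).deg q) (unitVal G n (-q) p (by omega))
      fun y => unitVal_mem _ (by omega) y)
    fun i hi y hy => Subtype.ext (unitVal_eq_zero _ (by omega) hy)

lemma val_unitComp {n p q : ℤ} (h : p + q = n) (g : (G.obj.X n).carrier) (b : ExtV K V) :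
    HomE.val (((LB K V).obj G).obj.X p) b (GrMod.Hom.lin (unitComp G n p q h) g) =
      unitSign q • unitVal G n (-q) p (by omega) (b • g) :=
  HomE.val_lin_units_smul _ _ _ _ _

/-- A term of the unit. -/
noncomputable def unitX (G : BddCx (EMod K V)) (n : ℤ) :
    G.obj.X n ⟶ ((totalize (C := SMod K V) (D := EMod K V) R₀).obj ((LB K V).obj G)).X n :=
  totalLift (C := SMod K V) (D := EMod K V) R₀ fun p q h => unitComp G n p q h

lemma unitX_π (n p q : ℤ) (h : p + q = n) :
    unitX G n ≫ totalπ (C := SMod K V) (D := EMod K V) R₀ ((LB K V).obj G) p q n h =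
      unitComp G n p q h :=
  totalLift_π (C := SMod K V) (D := EMod K V) R₀ (fun p q h => unitComp G n p q h) p q h

lemma lin_unitX_π (n p q : ℤ) (h : p + q = n) (g : (G.obj.X n).carrier) :
    GrMod.Hom.lin (totalπ (C := SMod K V) (D := EMod K V) R₀ ((LB K V).obj G) p q n h)
      (GrMod.Hom.lin (unitX G n) g) = GrMod.Hom.lin (unitComp G n p q h) g :=
  congrArg (fun k => GrMod.Hom.lin k g) (unitX_π n p q h)

lemma val_unitComp_d {n n' p p' q : ℤ} (h : p + q = n) (hn : n + 1 = n') (hp : p + 1 = p')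
    (g : (G.obj.X n).carrier) (b : ExtV K V) :
    HomE.val (((LB K V).obj G).obj.X p') b
      (GrMod.Hom.lin ((R₀.map (((LB K V).obj G).obj.d p p')).f q)
        (GrMod.Hom.lin (unitComp G n p q h) g)) =
    unitSign q • (unitVal G n' (-q) p' (by omega) (GrMod.Hom.lin (G.obj.d n n') (b • g)) +
      n.negOnePow • ∑ k, x K V k • unitVal G n (-(q - 1)) p' (by omega) (e K V k • b • g)) := by
  refine (HomE.val_R₀_map _ _ b).trans ?_
  refine Eq.trans ?_ (congrArg (unitSign q • ·)
    (d_unitVal (show n + -q = p by omega) hn (show -q + 1 = -(q - 1) by omega) hp (b • g)))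
  rw [val_unitComp, Units.smul_def, Units.smul_def]
  exact map_zsmul (GrMod.Hom.lin (((LB K V).obj G).obj.d p p')) _ _

lemma sum_smul_units {A M ι : Type*} [Ring A] [AddCommGroup M] [Module A M] [Fintype ι]
    (a : ι → A) (s : ℤˣ) (y : ι → M) : ∑ k, a k • s • y k = s • ∑ k, a k • y k := by
  rcases Int.units_eq_one_or s with rfl | rfl
  · simp only [one_smul]
  · simp only [Units.neg_smul, one_smul, smul_neg, Finset.sum_neg_distrib]

lemma GrMod.lin_apply_units_smul {A : Type u} [Ring A] [Algebra K A] {𝒜 : ℤ → Submodule K A}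
    {M N : GrMod 𝒜} (f : M ⟶ N) (s : ℤˣ) (y : M.carrier) :
    Hom.lin f (s • y) = s • Hom.lin f y := by
  rw [Units.smul_def, Units.smul_def, map_zsmul]

lemma units_smul_add_cancel {M : Type*} [AddCommGroup M] {s t u v : ℤˣ} (y z : M)
    (h : u * v = -(s * t)) : s • (y + t • z) + u • v • z = s • y := by
  rw [smul_smul, h, smul_add, smul_smul, Units.neg_smul, add_neg_cancel_right]

lemma val_Rd_unitComp {n p q q' : ℤ} (h : p + q = n) (hq : q + 1 = q')
    (g : (G.obj.X n).carrier) (b : ExtV K V) :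
    HomE.val (((LB K V).obj G).obj.X p) b
      (GrMod.Hom.lin (((R₀ : SMod K V ⥤ _).obj (((LB K V).obj G).obj.X p)).d q q')
        (GrMod.Hom.lin (unitComp G n p q h) g)) =
    unitSign q • ∑ k, x K V k • unitVal G n (-q) p (by omega) (e K V k • b • g) := by
  refine (congrArg (fun k => HomE.val (((LB K V).obj G).obj.X p) b
    (GrMod.Hom.lin k (GrMod.Hom.lin (unitComp G n p q h) g)))
    (R₀_d (((LB K V).obj G).obj.X p) hq)).trans ?_
  refine (HomE.val_Rd (((LB K V).obj G).obj.X p) hq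
    (GrMod.Hom.lin (unitComp G n p q h) g) b).trans ?_
  refine (Finset.sum_congr rfl fun k _ => congrArg (x K V k • ·)
    ((val_unitComp h g (e K V k * b)).trans (congrArg (fun y => unitSign q •
      unitVal G n (-q) p (by omega) y) (mul_smul (e K V k) b g)))).trans ?_
  exact sum_smul_units _ _ _

lemma lin_totalπ_R_d (F : BddCx (SMod K V)) (i j n i' j' n' : ℤ) (h : i' + j' = n') (hi : i + 1 = i') (hj : j + 1 = j')
    (hn : n + 1 = n') (y : (((totalize (C := SMod K V) (D := EMod K V) R₀).obj F).X n).carrier) (b : ExtV K V)  :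
    HomE.val (F.obj.X i') b (GrMod.Hom.lin (totalπ (C := SMod K V) (D := EMod K V) R₀ F i' j' n' h) (GrMod.Hom.lin (((totalize (C := SMod K V) (D := EMod K V) R₀).obj F).d n n') y)) =
      HomE.val (F.obj.X i') b (GrMod.Hom.lin ((R₀.map (F.obj.d i i')).f j')
        (GrMod.Hom.lin (totalπ (C := SMod K V) (D := EMod K V) R₀ F i j' n (by omega)) y)) +
      i'.negOnePow • HomE.val (F.obj.X i') b (GrMod.Hom.lin (((R₀ : SMod K V ⥤ _).obj (F.obj.X i')).d j j')
        (GrMod.Hom.lin (totalπ (C := SMod K V) (D := EMod K V) R₀ F i' j n (by omega)) y)) := by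
  refine (congrArg (HomE.val (F.obj.X i') b) (lin_totalπ_d (C := SMod K V) R₀ i j n i' j' n' h hi hj hn y)).trans ?_
  refine ((HomE.val (F.obj.X i') b).map_add _ _).trans ?_
  exact congrArg _ (HomE.val_units_smul _ _ _ _)

/-- The component in position `(p', q')` receives contributions from `(p' - 1, q')` and `(p', q' -
1)`. Both contain the sum of the `x_k • unitVal (e_k b g)`; these sums cancel by the choice of
signs, and the image of the differential of `G` is left. -/
lemma val_unitX_comm (n n' p' q' : ℤ) (hn : n + 1 = n') (h : p' + q' = n') (g : (G.obj.X n).carrier) (b : ExtV K V)  :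
   HomE.val (((LB K V).obj G).obj.X p') b (GrMod.Hom.lin (totalπ (C := SMod K V) (D := EMod K V) R₀ ((LB K V).obj G) p' q' n' h) (GrMod.Hom.lin (((totalize (C := SMod K V) (D := EMod K V) R₀).obj ((LB K V).obj G)).d n n') (GrMod.Hom.lin (unitX G n) g))) = HomE.val (((LB K V).obj G).obj.X p') b (GrMod.Hom.lin (totalπ (C := SMod K V) (D := EMod K V) R₀ ((LB K V).obj G) p' q' n' h) (GrMod.Hom.lin (unitX G n') (GrMod.Hom.lin (G.obj.d n n') g))) := by
  have h₁ := (congrArg (fun α => HomE.val (((LB K V).obj G).obj.X p') b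
    (GrMod.Hom.lin ((R₀.map (((LB K V).obj G).obj.d (p' - 1) p')).f q') α))
    (lin_unitX_π n (p' - 1) q' (by omega) g)).trans (val_unitComp_d _ hn (by omega) g b)
  have h₂ := (congrArg (fun α => HomE.val (((LB K V).obj G).obj.X p') b
    (GrMod.Hom.lin (((R₀ : SMod K V ⥤ _).obj (((LB K V).obj G).obj.X p')).d (q' - 1) q') α))
    (lin_unitX_π n p' (q' - 1) (by omega) g)).trans (val_Rd_unitComp _ (by omega) g b)
  have h₃ := (congrArg (HomE.val (((LB K V).obj G).obj.X p') b)
    (lin_unitX_π n' p' q' h (GrMod.Hom.lin (G.obj.d n n') g))).trans (val_unitComp _ _ _)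
  refine (lin_totalπ_R_d ((LB K V).obj G) (p' - 1) (q' - 1) n p' q' n' h (by omega) (by omega) hn _ b).trans
    ((congrArg₂ (fun y z => y + p'.negOnePow • z) h₁ h₂).trans (Eq.trans ?_ h₃.symm))
  rw [← map_smul (GrMod.Hom.lin (G.obj.d n n'))]
  have h₅ : p'.negOnePow * unitSign (q' - 1) = - (unitSign q' * n.negOnePow) := by
    obtain rfl : n = p' - 1 + q' := by omega
    rw [unitSign_sub_one, Int.negOnePow_add, Int.negOnePow_sub, Int.negOnePow_one, mul_neg_one,
      neg_mul, mul_neg, neg_neg, mul_left_comm]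
  exact units_smul_add_cancel _ _ h₅

lemma unitX_comm (n n' : ℤ) (hn : n + 1 = n') :
    unitX G n ≫ ((totalize (C := SMod K V) (D := EMod K V) R₀).obj ((LB K V).obj G)).d n n' =
      G.obj.d n n' ≫ unitX G n' := by
  refine total_hom_ext_to (C := SMod K V) (Φ := R₀) fun p' q' h => GrMod.hom_ext fun g =>
    HomE.ext_val fun b => ?_
  exact val_unitX_comm n n' p' q' hn h g b
variable (K V) in
/-- The unit. -/
noncomputable def unit : (bounded (EMod K V)).ι ⟶ LB K V ⋙ R K V where
  app G :=
    { f := unitX G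
      comm' := fun n n' hn => unitX_comm n n' hn }
  naturality G H f := by
    refine HomologicalComplex.hom_ext _ _ fun n => ?_
    refine total_hom_ext_to (C := SMod K V) (Φ := R₀) fun p q h => GrMod.hom_ext fun g =>
      HomE.ext_val fun b => ?_
    refine (congrArg (HomE.val (((LB K V).obj H).obj.X p) b) (lin_unitX_π n p q h
      (GrMod.Hom.lin (f.hom.f n) g))).trans ?_
    refine Eq.trans ?_ (congrArg (fun k => HomE.val (((LB K V).obj H).obj.X p) b
      (GrMod.Hom.lin k (GrMod.Hom.lin (unitX G n) g)))
        (total_map_π (C := SMod K V) (D := EMod K V) R₀ ((LB K V).map f) p q n h)).symm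
    refine (val_unitComp h (GrMod.Hom.lin (f.hom.f n) g) b).trans
      (((congrArg (fun α => HomE.val (((LB K V).obj H).obj.X p) b
        (GrMod.Hom.lin ((R₀.map (((LB K V).map f).hom.f p)).f q) α)) (lin_unitX_π n p q h g)).trans
        ((HomE.val_R₀_map (((LB K V).map f).hom.f p) (GrMod.Hom.lin (unitComp G n p q h) g) b).trans
          ((congrArg (GrMod.Hom.lin (((LB K V).map f).hom.f p)) (val_unitComp h g b)).trans
            ?_))).symm)
    refine (GrMod.lin_apply_units_smul (((LB K V).map f).hom.f p) _ _).trans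
      (congrArg (unitSign q • ·) ((map_unitVal f (show n + -q = p by omega) (b • g)).trans ?_))
    exact congrArg (unitVal H n (-q) p (by omega)) (map_smul (GrMod.Hom.lin (f.hom.f n)) b g)

end Unit

end

section

/-! ### The unit is a quasi-isomorphism -/

variable {K : Type u} [Field K] {V : Type u} [AddCommGroup V] [Module K V] [FiniteDimensional K V]

/-! ### Modules concentrated in one degree -/

section Column

variable {N₀ : Type u} [AddCommGroup N₀] [Module K N₀] [Module.Finite K N₀] {d : ℤ} {N : SMod K V}
  (e : tensorS K V N₀ d ≅ N)

include e in
lemma R₀_exactAt_of_iso {n : ℤ} (hn : n ≠ d) : ((R₀ : SMod K V ⥤ _).obj N).ExactAt n :=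
  (R₀_tensorS_exactAt N₀ hn).of_iso ((R₀ : SMod K V ⥤ _).mapIso e)

lemma GrMod.lin_hom_inv {A : Type u} [Ring A] [Algebra K A] {𝒜 : ℤ → Submodule K A}
    {M N : GrMod 𝒜} (e : M ≅ N) (y : N.carrier) : Hom.lin e.hom (Hom.lin e.inv y) = y :=
  congrArg (fun k => Hom.lin k y) e.inv_hom_id

lemma GrMod.lin_inv_hom {A : Type u} [Ring A] [Algebra K A] {𝒜 : ℤ → Submodule K A}
    {M N : GrMod 𝒜} (e : M ≅ N) (y : M.carrier) : Hom.lin e.inv (Hom.lin e.hom y) = y :=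
  congrArg (fun k => Hom.lin k y) e.hom_inv_id

include e in
lemma isZero_R₀_X_of_iso {n : ℤ} (hn : n < d) : IsZero (((R₀ : SMod K V ⥤ _).obj N).X n) := by
  refine GrMod.isZero_of_forall fun α => HomE.ext_val fun b => ?_
  have h : GrMod.Hom.lin e.inv (HomE.val N b α) = 0 :=
    tensorS_deg_eq_zero hn (GrMod.Hom.map_mem e.inv (HomE.fn α b).2)
  rw [← GrMod.lin_hom_inv e (HomE.val N b α), h, map_zero]
  rfl

lemma exists_val_eq {q : ℤ} (hq : q = d) (γ : HomE K V (N.deg q))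
    (hγ : GrMod.Hom.lin (Rd N (rfl : q + 1 = q + 1)) γ = 0) :
    ∃ y : N₀, ∀ b, HomE.val N b γ = (ExteriorAlgebra.algebraMapInv b : K) •
      GrMod.Hom.lin e.hom (1 ⊗ₜ[K] y : SymW K V ⊗[K] N₀) := by
  subst hq
  let γ' : HomE K V ((tensorS K V N₀ q).deg q) :=
    GrMod.Hom.lin (homEMap (GrMod.Hom.onDeg e.inv q) q) γ
  have hγ' : GrMod.Hom.lin (Rd (tensorS K V N₀ q) (rfl : q + 1 = q + 1)) γ' = 0 := by
    refine HomE.ext_val fun b => (HomE.val_Rd _ rfl γ' b).trans ?_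
    refine (Finset.sum_congr rfl fun k _ =>
      (map_smul (GrMod.Hom.lin e.inv) (x K V k) (HomE.val N (BGG.e K V k * b) γ)).symm).trans ?_
    refine (map_sum (GrMod.Hom.lin e.inv) _ _).symm.trans ?_
    refine (congrArg (GrMod.Hom.lin e.inv) ((HomE.val_Rd N rfl γ b).symm.trans
      (congrArg (HomE.val N b) hγ))).trans ?_
    exact (congrArg (GrMod.Hom.lin e.inv) (map_zero (HomE.val N b))).trans (map_zero _)
  obtain ⟨y, hy, h⟩ := exists_socle_eq γ' hγ'
  refine ⟨y, fun b => ?_⟩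
  have h₂ : GrMod.Hom.lin e.inv (HomE.val N b γ) =
      (ExteriorAlgebra.algebraMapInv b : K) • (1 ⊗ₜ[K] y : SymW K V ⊗[K] N₀) :=
    congrArg (HomE.val (tensorS K V N₀ q) b) h
  refine (GrMod.lin_hom_inv e _).symm.trans ?_
  refine (congrArg (GrMod.Hom.lin e.hom) h₂).trans ?_
  exact map_smul ((GrMod.Hom.lin e.hom).restrictScalars K) _ _

/-- The augmentation of `S` provides a left inverse of `y ↦ 1 ⊗ y`. -/
lemma one_tmul_injective {y : N₀} (h : (1 ⊗ₜ[K] y : SymW K V ⊗[K] N₀) = 0) : y = 0 := by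
  have := congrArg (fun z => TensorProduct.lid K N₀
    ((SymmetricAlgebra.algebraMapInv : SymW K V →ₐ[K] K).toLinearMap.rTensor N₀ z)) h
  simpa using this

end Column

lemma units_smul_smul_map_smul {M N : Type*} [AddCommGroup M] [AddCommGroup N] [Module K M]
    [Module K N] (f : M →ₗ[K] N) (s : ℤˣ) (c : K) (y : M) : s • c • f (s • y) = c • f y := by
  rcases Int.units_eq_one_or s with rfl | rfl
  · rw [one_smul, one_smul]
  · rw [Units.neg_smul, one_smul, Units.neg_smul, one_smul, map_neg, smul_neg, neg_neg]

lemma mem_deg_of_concentrated {P : EMod K V} {t : ℤ} (h : ∀ i, i ≠ t → ∀ y ∈ P.deg i, y = 0)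
    (z : P.carrier) : z ∈ P.deg t := by
  obtain ⟨T, hT⟩ := exists_eq_sum_component P.isInternal z
  rw [hT]
  refine sum_mem fun i _ => ?_
  by_cases hi : i = t
  · subst hi
    exact component_mem _ _ _
  · rw [h i hi _ (component_mem P.isInternal i z)]
    exact zero_mem _

/-- The `e_k` lower the degree, so they act as zero and `E` acts through its augmentation. -/
lemma smul_eq_of_concentrated {P : EMod K V} {t : ℤ} (h : ∀ i, i ≠ t → ∀ y ∈ P.deg i, y = 0)
    (b : ExtV K V) (y : P.carrier) :
    b • y = (ExteriorAlgebra.algebraMapInv b : K) • y := by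
  refine (apply_eq_augmentation ((LinearMap.toSpanSingleton (ExtV K V) P.carrier y).restrictScalars
    K) (fun k b => ?_) b).trans (congrArg _ (one_smul _ _))
  change (e K V k * b) • y = 0
  rw [mul_smul]
  exact h (-1 + t) (by omega) _ (SetLike.GradedSMul.smul_mem (B := P.deg) (e_mem K V k)
    (mem_deg_of_concentrated h _))

section

variable {G : BddCx (EMod K V)} {a t : ℤ} (hG : ∀ i, i ≠ a → IsZero (G.obj.X i))
  (ht : ∀ i, i ≠ t → ∀ y ∈ (G.obj.X a).deg i, y = 0)

include hG ht in
lemma isZero_LB_X {p : ℤ} (hp : p ≠ a - t) : IsZero (((LB K V).obj G).obj.X p) := by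
  refine IsZero.of_iso ?_ (totalColumnIso (C := EMod K V) (D := SMod K V) L₀ hG (p - a) p
    (by omega)).symm
  refine GrMod.isZero_of_forall fun z => ?_
  have h (y : (G.obj.X a).deg (-(p - a))) : y = 0 := Subtype.ext (ht _ (by omega) _ y.2)
  induction z using TensorProduct.induction_on with
  | zero => rfl
  | tmul s y => exact (congrArg (s ⊗ₜ[K] ·) (h y)).trans (TensorProduct.tmul_zero _ _)
  | add z z' h h' => exact (congrArg₂ (· + ·) h h').trans (add_zero _)

/-- The nonzero term of `L(G)`, if `G` has one nonzero term, which is concentrated in one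
degree. -/
noncomputable def LBColumnIso (hG : ∀ i, i ≠ a → IsZero (G.obj.X i)) (t : ℤ) :
    tensorS K V ((G.obj.X a).deg (- -t)) (- -t) ≅ ((LB K V).obj G).obj.X (a - t) :=
  totalColumnIso (C := EMod K V) (D := SMod K V) L₀ hG (-t) (a - t) rfl

include ht in
-- On such a module the unit is, up to the sign `unitSign t`, the map that sends `y` to the socle
-- element of `1 ⊗ y`; that sign is compensated in the argument.
lemma val_unitComp_column (y : (G.obj.X a).deg (- -t)) (b : ExtV K V) :
    HomE.val (((LB K V).obj G).obj.X (a - t)) b (GrMod.Hom.lin (unitComp G a (a - t) t (by omega))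
      (unitSign t • y.1)) = (ExteriorAlgebra.algebraMapInv b : K) •
      GrMod.Hom.lin (LBColumnIso hG t).hom
        (1 ⊗ₜ[K] y : SymW K V ⊗[K] (G.obj.X a).deg (- -t)) := by
  have h : unitVal G a (-t) (a - t) rfl y.1 = GrMod.Hom.lin (LBColumnIso hG t).hom
      (1 ⊗ₜ[K] y : SymW K V ⊗[K] (G.obj.X a).deg (- -t)) :=
    congrArg (fun z : (G.obj.X a).deg (- -t) => GrMod.Hom.lin (LBColumnIso hG t).hom
      (1 ⊗ₜ[K] z : SymW K V ⊗[K] (G.obj.X a).deg (- -t)))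
      (Subtype.ext ((G.obj.X a).proj_of_mem y.2))
  refine (val_unitComp _ _ b).trans ?_
  rw [smul_eq_of_concentrated ht, map_smul, ← h]
  exact units_smul_smul_map_smul _ _ _ _

end

end

section

variable {K : Type u} [Field K] {V : Type u} [AddCommGroup V] [Module K V] [FiniteDimensional K V]

section

variable {G : BddCx (EMod K V)} {a t : ℤ}

lemma unitX_column_injective (hG : ∀ i, i ≠ a → IsZero (G.obj.X i))
    (ht : ∀ i, i ≠ t → ∀ y ∈ (G.obj.X a).deg i, y = 0) (y : (G.obj.X a).carrier)
    (hy : GrMod.Hom.lin (unitX G a) y = 0) : y = 0 := by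
  have hmem : y ∈ (G.obj.X a).deg (- -t) := by
    rw [neg_neg]
    exact mem_deg_of_concentrated ht y
  have h₁ : GrMod.Hom.lin (unitComp G a (a - t) t (by omega)) y = 0 :=
    (lin_unitX_π a (a - t) t (by omega) y).symm.trans ((congrArg _ hy).trans (map_zero _))
  have h₂ := (val_unitComp_column hG ht ⟨y, hmem⟩ 1).trans
    ((congrArg (· • _) (map_one ExteriorAlgebra.algebraMapInv)).trans (one_smul K _))
  have h₃ : GrMod.Hom.lin (unitComp G a (a - t) t (by omega)) (unitSign t • y) = 0 :=
    (GrMod.lin_apply_units_smul _ _ _).trans ((congrArg (unitSign t • ·) h₁).trans (smul_zero _))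
  have h₄ : GrMod.Hom.lin (LBColumnIso hG t).hom
      (1 ⊗ₜ[K] (⟨y, hmem⟩ : (G.obj.X a).deg (- -t)) : SymW K V ⊗[K] (G.obj.X a).deg (- -t)) = 0 :=
    h₂.symm.trans ((congrArg (HomE.val _ 1) h₃).trans (map_zero (HomE.val _ 1)))
  have h₅ := (GrMod.lin_inv_hom (LBColumnIso hG t) _).symm.trans
    ((congrArg (GrMod.Hom.lin (LBColumnIso hG t).inv) h₄).trans (map_zero _))
  exact congrArg Subtype.val (one_tmul_injective (V := V) h₅)

lemma exists_unitX_column_eq (hG : ∀ i, i ≠ a → IsZero (G.obj.X i))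
    (ht : ∀ i, i ≠ t → ∀ y ∈ (G.obj.X a).deg i, y = 0)
    (y : (((totalize (C := SMod K V) (D := EMod K V) R₀).obj ((LB K V).obj G)).X a).carrier)
    (hy : GrMod.Hom.lin (((totalize (C := SMod K V) (D := EMod K V) R₀).obj
      ((LB K V).obj G)).d a (a + 1)) y = 0) :
    ∃ z, GrMod.Hom.lin (unitX G a) z = y := by
  have hF : ∀ i, i ≠ a - t → IsZero (((LB K V).obj G).obj.X i) := fun i hi => isZero_LB_X hG ht hi
  let ε := totalColumnIso (C := SMod K V) (D := EMod K V) R₀ hF t a (by omega)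
  let γ : HomE K V ((((LB K V).obj G).obj.X (a - t)).deg t) := GrMod.Hom.lin ε.inv y
  have hγ : GrMod.Hom.lin (Rd (((LB K V).obj G).obj.X (a - t)) (rfl : t + 1 = t + 1)) γ = 0 := by
    let ε' := totalColumnIso (C := SMod K V) (D := EMod K V) R₀ hF (t + 1) (a + 1) (by omega)
    have h := totalι_d_column (C := SMod K V) (D := EMod K V) R₀ hF t a (t + 1) (a + 1)
      (by omega) rfl rfl
    rw [R₀_d _ rfl] at h
    have h₁ := (congrArg (fun k => GrMod.Hom.lin k (GrMod.Hom.lin ε.inv y)) h).symm.trans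
      ((congrArg (GrMod.Hom.lin (((totalize (C := SMod K V) (D := EMod K V) R₀).obj
        ((LB K V).obj G)).d a (a + 1))) (GrMod.lin_hom_inv ε y)).trans hy)
    have h₂ : (a - t).negOnePow • GrMod.Hom.lin ε'.hom (GrMod.Hom.lin
      (Rd (((LB K V).obj G).obj.X (a - t)) (rfl : t + 1 = t + 1)) γ) = 0 :=
      (GrMod.lin_units_smul _ _ _).symm.trans h₁
    have h₃ := (smul_eq_zero_iff_eq _).1 h₂
    exact (GrMod.lin_inv_hom ε' _).symm.trans ((congrArg (GrMod.Hom.lin ε'.inv) h₃).trans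
      (map_zero _))
  obtain ⟨z, hz⟩ := exists_val_eq (LBColumnIso hG t) (neg_neg t).symm γ hγ
  refine ⟨unitSign t • z.1, ?_⟩
  have h : GrMod.Hom.lin ε.inv (GrMod.Hom.lin (unitX G a) (unitSign t • z.1)) =
      GrMod.Hom.lin ε.inv y :=
    (lin_unitX_π a (a - t) t (by omega) _).trans (HomE.ext_val fun b =>
      (val_unitComp_column hG ht z b).trans (hz b).symm)
  exact (GrMod.lin_hom_inv ε _).symm.trans ((congrArg (GrMod.Hom.lin ε.hom) h).trans
    (GrMod.lin_hom_inv ε _))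

/-- Since `T^{a-1} = 0`, the cohomology of `T` in degree `a` is the kernel of its differential,
which `f` must identify with `G^a`. -/
lemma quasiIso_of_column {C : Type*} [Category* C] [Abelian C] {G T : CochainComplex C ℤ} {a : ℤ}
    (f : G ⟶ T) (hG : ∀ i, i ≠ a → IsZero (G.X i)) (hT : ∀ i, i ≠ a → T.ExactAt i)
    (h : IsZero (T.X (a - 1))) (hf : Mono (f.f a))
    (hf' : (ShortComplex.mk (f.f a) (T.d a (a + 1))
      (by rw [f.comm, (hG (a + 1) (by omega)).eq_of_tgt (G.d a (a + 1)) 0, zero_comp])).Exact) :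
    QuasiIso f := by
  rw [quasiIso_iff]
  intro i
  by_cases hi : i = a
  · subst hi
    rw [quasiIsoAt_iff' f (i - 1) i (i + 1) (by simp) (by simp)]
    exact (ShortComplex.quasiIso_iff_of_zeros _ ((hG (i - 1) (by omega)).eq_of_src _ _)
      ((hG (i + 1) (by omega)).eq_of_tgt _ _) (h.eq_of_src _ _)).2 ⟨hf', hf⟩
  · rw [quasiIsoAt_iff_exactAt f i (ShortComplex.exact_of_isZero_X₂ _ (hG i hi))]
    exact hT i hi

/-- Here `L(G)` is `S ⊗ N` in degree `a - t`, up to isomorphism. Its image under `R` is the Koszul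
complex, whose cohomology sits in total degree `a` and consists of the socle elements, the image of
the unit. -/
lemma quasiIso_unit_column (hG : ∀ i, i ≠ a → IsZero (G.obj.X i))
    (ht : ∀ i, i ≠ t → ∀ y ∈ (G.obj.X a).deg i, y = 0) : QuasiIso ((unit K V).app G) := by
  have hF : ∀ i, i ≠ a - t → IsZero (((LB K V).obj G).obj.X i) := fun i hi => isZero_LB_X hG ht hi
  refine quasiIso_of_column (a := a) _ hG (fun i hi => ?_) ?_ ?_ ?_
  · exact (exactAt_totalize_column (C := SMod K V) (D := EMod K V) R₀ hF (i - (a - t)) i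
      (by omega)).1 (R₀_exactAt_of_iso (LBColumnIso hG t) (by omega))
  · exact IsZero.of_iso (isZero_R₀_X_of_iso (LBColumnIso hG t) (n := t - 1) (by omega))
      (totalColumnIso (C := SMod K V) (D := EMod K V) R₀ hF (t - 1) (a - 1) (by omega)).symm
  · refine GrMod.mono_of_injective _ ((injective_iff_map_eq_zero _).2 fun y hy => ?_)
    exact unitX_column_injective hG ht y hy
  · rw [GrMod.exact_iff]
    exact fun y hy => exists_unitX_column_eq hG ht y hy

end

/-! ### Reduction to modules concentrated in one degree -/

section Devissage

variable (M : EMod K V) {m : ℤ}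

/-- Elements of `E` do not raise degrees, so the part of lowest degree is a submodule. This is what
makes dévissage along the internal degree possible. -/
lemma smul_mem_of_lowest (hm : ∀ i < m, ∀ y ∈ M.deg i, y = 0) (b : ExtV K V) :
    ∀ y ∈ M.deg m, b • y ∈ M.deg m := by
  induction b using ExteriorAlgebra.induction with
  | algebraMap c =>
    intro y hy
    rw [algebraMap_smul]
    exact (M.deg m).smul_mem c hy
  | ι v =>
    intro y hy
    rw [hm (-1 + m) (by omega) _
        (SetLike.GradedSMul.smul_mem (B := M.deg) (ι_mem_extDeg K V v) hy)]
    exact zero_mem _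
  | mul b b' h h' =>
    intro y hy
    rw [mul_smul]
    exact h _ (h' y hy)
  | add b b' h h' =>
    intro y hy
    rw [add_smul]
    exact add_mem (h y hy) (h' y hy)

/-- The lowest degree part of a graded module, as a submodule. -/
noncomputable def lowest (hm : ∀ i < m, ∀ y ∈ M.deg i, y = 0) : Submodule (ExtV K V) M.carrier where
  __ := M.deg m
  smul_mem' b y hy := smul_mem_of_lowest M hm b y hy

lemma proj_mem_lowest (hm : ∀ i < m, ∀ y ∈ M.deg i, y = 0) (i : ℤ) (y : M.carrier)
    (hy : y ∈ lowest M hm) : M.proj i y ∈ lowest M hm := by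
  change y ∈ M.deg m at hy
  by_cases hi : m = i
  · subst hi
    exact M.proj_mem _ _
  · rw [M.proj_of_mem_ne hy hi]
    exact zero_mem _

/-- The short exact sequence given by the lowest degree part of a graded module. -/
noncomputable def lowestShortComplex (hm : ∀ i < m, ∀ y ∈ M.deg i, y = 0) : ShortComplex (EMod K V) :=
  ShortComplex.mk (X₁ := M.sub (lowest M hm) (proj_mem_lowest M hm)) (X₂ := M)
    (X₃ := M.quot (lowest M hm) (proj_mem_lowest M hm))
    (GrMod.ofLin (lowest M hm).subtype fun _ _ hx => hx)
    (GrMod.ofLin (lowest M hm).mkQ fun _ y hy => ⟨y, hy, rfl⟩)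
    (GrMod.hom_ext fun y => (Submodule.Quotient.mk_eq_zero _).2 y.2)

lemma lowestShortComplex_shortExact (hm : ∀ i < m, ∀ y ∈ M.deg i, y = 0) :
    (lowestShortComplex M hm).ShortExact := by
  refine @ShortComplex.ShortExact.mk _ _ _ _ ?_ ?_ ?_
  · rw [GrMod.exact_iff]
    exact fun y hy => ⟨⟨y, (Submodule.Quotient.mk_eq_zero _).1 hy⟩, rfl⟩
  · exact GrMod.mono_of_injective _ Subtype.val_injective
  · exact GrMod.epi_of_surjective _ (Submodule.mkQ_surjective _)

lemma quasiIso_unit_single_of_concentrated {t : ℤ} (ht : ∀ i, i ≠ t → ∀ y ∈ M.deg i, y = 0)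
    (a : ℤ) : QuasiIso ((unit K V).app ((singleB a).obj M)) := by
  refine quasiIso_unit_column (a := a) (t := t)
    (fun i hi => HomologicalComplex.isZero_single_obj_X _ _ _ _ hi) fun i hi y hy => ?_
  let ε : ((singleB a).obj M).obj.X a ≅ M :=
    HomologicalComplex.singleObjXSelf (ComplexShape.up ℤ) a M
  rw [← GrMod.lin_inv_hom ε y, ht i hi _ (GrMod.Hom.map_mem ε.hom hy), map_zero]

instance : (R K V).Additive := inferInstanceAs (totalize R₀).Additive

lemma unit_shortExact (S : ShortComplex (BddCx (EMod K V)))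
    (hS : (S.map (bounded (EMod K V)).ι).ShortExact) : (S.map (LB K V ⋙ R K V)).ShortExact :=
  totalize_shortExact (C := SMod K V) (D := EMod K V) degreewiseExact_R₀ (S.map (LB K V))
    (totalize_shortExact (C := EMod K V) (D := SMod K V) degreewiseExact_L₀ S hS)

/-- Induction on the number of degrees in which `M` can be nonzero: the lowest part is concentrated
in one degree and the quotient by it occupies fewer degrees. -/
lemma quasiIso_unit_single (a : ℤ) : QuasiIso ((unit K V).app ((singleB a).obj M)) := by
  obtain ⟨m, n, h⟩ := exists_deg_eq_zero M
  obtain ⟨k, hk⟩ : ∃ k : ℕ, n < m + k := ⟨(n - m + 1).toNat, by omega⟩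
  induction k generalizing M m with
  -- Here `n < m`, so `M` is zero and the degree `0` is an arbitrary choice.
  | zero => exact quasiIso_unit_single_of_concentrated M (t := 0) (fun i _ => h i (by omega)) a
  | succ k ih =>
    have hm : ∀ i < m, ∀ y ∈ M.deg i, y = 0 := fun i hi => h i (Or.inl hi)
    refine quasiIso_app_single_of_shortExact (C := EMod K V) (D := EMod K V)
      (A := (bounded (EMod K V)).ι) (B := LB K V ⋙ R K V) (η := unit K V) (fun _ hS => hS) unit_shortExact
      (lowestShortComplex M hm) (lowestShortComplex_shortExact M hm) a ?_ ?_
    · refine quasiIso_unit_single_of_concentrated _ (t := m) (fun i hi y hy => Subtype.ext ?_) a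
      exact (M.proj_of_mem hy).symm.trans (M.proj_of_mem_ne y.2 (Ne.symm hi))
    · refine ih _ (m + 1) ?_ (by push_cast at hk; omega)
      rintro i hi _ ⟨y, hy, rfl⟩
      by_cases him : i = m
      · subst him
        exact (Submodule.Quotient.mk_eq_zero _).2 hy
      · rw [h i (by omega) y hy, map_zero]
        rfl

lemma quasiIso_unit (G : BddCx (EMod K V)) : QuasiIso ((unit K V).app G) :=
  quasiIso_app_of_single (C := EMod K V) (D := EMod K V)
      (A := (bounded (EMod K V)).ι) (B := LB K V ⋙ R K V) (η := unit K V) (fun _ hS => hS) unit_shortExact (fun a M => quasiIso_unit_single M a) G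

end Devissage

end

section

/-! ### The morphism `L(G) ⟶ F` given by a morphism `G ⟶ R(F)` -/

variable {K : Type u} [Field K] {V : Type u} [AddCommGroup V] [Module K V] [FiniteDimensional K V]

lemma lift_mem_deg {N : Type u} [AddCommGroup N] [Module K N] {d n : ℤ}
    {M : SMod K V} (φ : N →ₗ[K] M.carrier) (h : ∀ y, φ y ∈ M.deg d)
    (z : symDeg K (Module.Dual K V) (n - d) ⊗[K] N) :
    TensorProduct.AlgebraTensorModule.lift (LinearMap.toSpanSingleton (SymW K V)
      (N →ₗ[K] M.carrier) φ) ((symDeg K (Module.Dual K V) (n - d)).subtype.rTensor N z) ∈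
      M.deg n := by
  induction z with
  | zero =>
    rw [map_zero, map_zero]
    exact zero_mem _
  | add z z' h h' =>
    rw [map_add, map_add]
    exact add_mem h h'
  | tmul s y =>
    have := SetLike.GradedSMul.smul_mem (B := M.deg) s.2 (h y)
    rw [vadd_eq_add, sub_add_cancel] at this
    exact this

/-- The morphism `S ⊗ N ⟶ M` given by a linear map from `N` to `M`. -/
noncomputable def tensorSDesc {N : Type u} [AddCommGroup N] [Module K N] [Module.Finite K N] {d : ℤ}
    {M : SMod K V} (φ : N →ₗ[K] M.carrier) (h : ∀ y, φ y ∈ M.deg d) : tensorS K V N d ⟶ M :=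
  GrMod.ofLin (TensorProduct.AlgebraTensorModule.lift
    ((LinearMap.toSpanSingleton (SymW K V) (N →ₗ[K] M.carrier) φ))) (by
    rintro n _ ⟨z, rfl⟩
    exact lift_mem_deg φ h z)

lemma tensorSDesc_tmul {N : Type u} [AddCommGroup N] [Module K N] [Module.Finite K N] {d : ℤ}
    {M : SMod K V} (φ : N →ₗ[K] M.carrier) (h : ∀ y, φ y ∈ M.deg d) (s : SymW K V) (y : N) :
    GrMod.Hom.lin (tensorSDesc φ h) (s ⊗ₜ[K] y : SymW K V ⊗[K] N) = s • φ y := rfl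

lemma LB_hom_ext {G : BddCx (EMod K V)} {p : ℤ} {M : SMod K V}
    {f g : ((LB K V).obj G).obj.X p ⟶ M}
    (h : ∀ n j (h : n + j = p) y, GrMod.Hom.lin f (unitVal G n j p h y) =
      GrMod.Hom.lin g (unitVal G n j p h y)) : f = g := by
  refine total_hom_ext (C := EMod K V) (Φ := L₀) (D := SMod K V) fun n j hp =>
    tensorS_hom_ext fun s y => ?_
  let τ := GrMod.Hom.lin (totalι (C := EMod K V) (D := SMod K V) L₀ G n j p hp)
  have h₁ : τ (s ⊗ₜ[K] y : SymW K V ⊗[K] (G.obj.X n).deg (-j)) =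
      s • unitVal G n j p hp y.1 := by
    refine Eq.trans (congrArg τ ?_) (map_smul τ s _)
    refine Eq.trans ?_ (TensorProduct.smul_tmul' s (1 : SymW K V) _).symm
    refine congrArg₂ (fun a b => a ⊗ₜ[K] b) (mul_one s).symm (Subtype.ext ?_)
    exact ((G.obj.X n).proj_of_mem y.2).symm
  refine (congrArg (GrMod.Hom.lin f) h₁).trans (Eq.trans ?_ (congrArg (GrMod.Hom.lin g) h₁).symm)
  exact (map_smul (GrMod.Hom.lin f) s _).trans ((congrArg (s • ·) (h n j hp y.1)).trans
    (map_smul (GrMod.Hom.lin g) s _).symm)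

lemma one_mem_extDeg : (1 : ExtV K V) ∈ extDeg K V 0 := by
  simp [extDeg]

section EvalOne

variable {P : EMod K V} {M : SMod K V} {q : ℤ} (f : P ⟶ homE (M.deg q) q)

/-- The value at `1` of a morphism to `Hom_K(E, M_q)`. -/
noncomputable def evalOne : P.carrier →ₗ[K] M.carrier :=
  ((M.deg q).subtype ∘ₗ LinearMap.applyₗ (1 : ExtV K V) ∘ₗ
    (HomE.of (K := K) (V := V) (N := M.deg q)).symm.toLinearMap) ∘ₗ
    (GrMod.Hom.lin f).restrictScalars K

lemma evalOne_smul (b : ExtV K V) (y : P.carrier) :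
    evalOne f (b • y) = HomE.val M b (GrMod.Hom.lin f y) := by
  refine (congrArg (HomE.val M 1) (map_smul (GrMod.Hom.lin f) b y)).trans ?_
  exact congrArg (fun b => HomE.val M b (GrMod.Hom.lin f y)) (one_mul b)

lemma evalOne_mem (y : P.carrier) : evalOne f y ∈ M.deg q :=
  (HomE.fn (GrMod.Hom.lin f y : HomE K V (M.deg q)) 1).2

lemma evalOne_eq_zero {t : ℤ} (ht : t ≠ q) {y : P.carrier} (hy : y ∈ P.deg t) :
    evalOne f y = 0 :=
  congrArg Subtype.val ((GrMod.Hom.map_mem f hy : _ ∈ HomE.deg (M.deg q) q t) 0 (by omega) 1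
    one_mem_extDeg)

/-- `1` has degree zero, so only the component of degree `q` of `y` contributes to the value at `1`.
-/
lemma evalOne_proj (y : P.carrier) : evalOne f (P.proj q y) = evalOne f y := by
  obtain ⟨T, hT⟩ := exists_eq_sum_component P.isInternal y
  rw [hT, map_sum, map_sum, map_sum]
  refine Finset.sum_congr rfl fun t _ => ?_
  have hm := P.proj_mem t y
  by_cases ht : t = q
  · subst ht
    exact congrArg _ (P.proj_of_mem hm)
  · refine Eq.trans ?_ (evalOne_eq_zero f ht hm).symm
    exact (congrArg _ (P.proj_of_mem_ne hm ht)).trans (map_zero _)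

end EvalOne

section

variable {F : BddCx (SMod K V)} {G : BddCx (EMod K V)} (i : G.obj ⟶ (R K V).obj F)

/-- A component of a morphism to `R(F)`. -/
noncomputable def compR (n p q : ℤ) (h : p + q = n) : G.obj.X n ⟶ homE ((F.obj.X p).deg q) q :=
  i.f n ≫ totalπ (C := SMod K V) (D := EMod K V) R₀ F p q n h

/-- A term of the adjoint morphism. -/
noncomputable def adjX (p : ℤ) : ((LB K V).obj G).obj.X p ⟶ F.obj.X p :=
  totalDesc (C := EMod K V) (D := SMod K V) L₀ fun n j h => unitSign (-j) •
    tensorSDesc (evalOne (compR i n p (-j) (by omega)) ∘ₗ ((G.obj.X n).deg (-j)).subtype)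
      fun y => evalOne_mem _ _

lemma adjX_unitVal {n j p q : ℤ} (h : n + j = p) (hq : q = -j) (y : (G.obj.X n).carrier) :
    GrMod.Hom.lin (adjX i p) (unitVal G n j p h y) =
      unitSign q • evalOne (compR i n p q (by omega)) y := by
  subst hq
  refine (congrArg (fun k => GrMod.Hom.lin k (1 ⊗ₜ[K] (⟨(G.obj.X n).proj (-j) y,
    GrMod.proj_mem _ _ _⟩ : (G.obj.X n).deg (-j)) : SymW K V ⊗[K] (G.obj.X n).deg (-j)))
    (totalι_desc (C := EMod K V) (D := SMod K V) L₀ _ n j h)).trans ?_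
  refine (GrMod.lin_units_smul _ _ _).trans (congrArg (unitSign (-j) • ·) ?_)
  refine (tensorSDesc_tmul _ _ _ _).trans ((one_smul _ _).trans ?_)
  exact evalOne_proj _ y

lemma evalOne_compR_d {n p q n' p' q' : ℤ} (h : p + q' = n) (hn : n + 1 = n') (hp : p + 1 = p')
    (hq : q + 1 = q') (y : (G.obj.X n).carrier) :
    evalOne (compR i n' p' q' (by omega)) (GrMod.Hom.lin (G.obj.d n n') y) =
      GrMod.Hom.lin (F.obj.d p p') (evalOne (compR i n p q' h) y) +
      p'.negOnePow • ∑ k, x K V k • evalOne (compR i n p' q (by omega)) (e K V k • y) := by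
  have h₁ : GrMod.Hom.lin (i.f n') (GrMod.Hom.lin (G.obj.d n n') y) =
      GrMod.Hom.lin (((totalize (C := SMod K V) (D := EMod K V) R₀).obj F).d n n')
        (GrMod.Hom.lin (i.f n) y) :=
    congrArg (fun k => GrMod.Hom.lin k y) (i.comm n n').symm
  refine (congrArg (fun z => HomE.val (F.obj.X p') 1 (GrMod.Hom.lin (totalπ (C := SMod K V)
    (D := EMod K V) R₀ F p' q' n' (by omega)) z)) h₁).trans ?_
  refine (lin_totalπ_R_d F p q n p' q' n' (by omega) hp hq hn (GrMod.Hom.lin (i.f n) y) 1).trans ?_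
  refine congrArg₂ (fun y z => y + p'.negOnePow • z)
    (HomE.val_R₀_map (F.obj.d p p') (GrMod.Hom.lin (compR i n p q' h) y) 1) ?_
  refine (congrArg (fun k => HomE.val (F.obj.X p') 1 (GrMod.Hom.lin k
    (GrMod.Hom.lin (compR i n p' q (by omega)) y))) (R₀_d (F.obj.X p') hq)).trans ?_
  refine (HomE.val_Rd (F.obj.X p') hq (GrMod.Hom.lin (compR i n p' q (by omega)) y) 1).trans
    (Finset.sum_congr rfl fun k _ => congrArg (x K V k • ·) ?_)
  refine Eq.trans ?_ (evalOne_smul (compR i n p' q (by omega)) (e K V k) y).symm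
  exact congrArg (fun b => HomE.val (F.obj.X p') b
    (GrMod.Hom.lin (compR i n p' q (by omega)) y)) (mul_one (e K V k))

/-- On a generator `1 ⊗ y`, this is the condition that `i` is a morphism of complexes, evaluated at
`1`. The sums over `k` cancel by `unitSign_sub_one`, as in the construction of the unit. -/
lemma adjX_comm (p p' : ℤ) (hp : p + 1 = p') :
    adjX i p ≫ F.obj.d p p' = ((LB K V).obj G).obj.d p p' ≫ adjX i p' := by
  refine LB_hom_ext fun n j h y => ?_
  have h₁ := adjX_unitVal i (j := j) (q := -j) (show n + j = p by omega) rfl y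
  have h₂ := adjX_unitVal i (j := j) (q := -j) (show n + 1 + j = p' by omega) rfl
    (GrMod.Hom.lin (G.obj.d n (n + 1)) y)
  have h₃ (k : Fin (Module.finrank K V)) := adjX_unitVal i (j := j + 1) (q := -(j + 1))
    (show n + (j + 1) = p' by omega) rfl (e K V k • y)
  have h₄ := d_unitVal (n' := n + 1) (j' := j + 1) h rfl rfl hp y
  have h₅ := evalOne_compR_d i (show p + -j = n by omega) rfl hp
    (show -(j + 1) + 1 = -j by omega) y
  have h₆ : GrMod.Hom.lin (adjX i p') (∑ k, x K V k • unitVal G n (j + 1) p' (by omega)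
      (e K V k • y)) = unitSign (-(j + 1)) • ∑ k, x K V k •
        evalOne (compR i n p' (-(j + 1)) (by omega)) (e K V k • y) := by
    refine (map_sum _ _ _).trans (Eq.trans (Finset.sum_congr rfl fun k _ => ?_)
      (sum_smul_units _ _ _))
    exact (map_smul _ _ _).trans (congrArg (x K V k • ·) (h₃ k))
  have hl : GrMod.Hom.lin (F.obj.d p p') (GrMod.Hom.lin (adjX i p) (unitVal G n j p h y)) =
      unitSign (-j) • GrMod.Hom.lin (F.obj.d p p') (evalOne (compR i n p (-j) (by omega)) y) :=
    (congrArg (GrMod.Hom.lin (F.obj.d p p')) h₁).trans (GrMod.lin_apply_units_smul _ _ _)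
  refine hl.trans (Eq.trans ?_ (congrArg (GrMod.Hom.lin (adjX i p')) h₄).symm)
  refine Eq.trans ?_ ((map_add (GrMod.Hom.lin (adjX i p')) _ _).trans (congrArg₂ (· + ·) (h₂.trans
    (congrArg (unitSign (-j) • ·) h₅)) ((GrMod.lin_apply_units_smul _ _ _).trans
      (congrArg (n.negOnePow • ·) h₆)))).symm
  refine (units_smul_add_cancel _ _ ?_).symm
  have := unitSign_sub_one (-j)
  rw [show -j - 1 = -(j + 1) by ring] at this
  obtain rfl : p' = n + j + 1 := by omega
  rw [this, Int.negOnePow_succ, Int.negOnePow_add, Int.negOnePow_neg, mul_neg, neg_neg,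
    mul_left_comm]

/-- The morphism `L(G) ⟶ F` given by a morphism `G ⟶ R(F)`. -/
noncomputable def adj : (LB K V).obj G ⟶ F :=
  ObjectProperty.homMk
    { f := adjX i
      comm' := fun p p' hp => adjX_comm i p p' hp }

/-- The part of the adjunction that is used. A morphism to `Hom_K(E, M_q)` is determined by its
values at `1`, and the sign occurs twice. -/
lemma unit_adj : (unit K V).app G ≫ (R K V).map (adj i) = i := by
  refine HomologicalComplex.hom_ext _ _ fun n => ?_
  refine total_hom_ext_to (C := SMod K V) (Φ := R₀) fun p q h => GrMod.hom_ext fun g =>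
    HomE.ext_val fun b => ?_
  refine (congrArg (fun k => HomE.val (F.obj.X p) b (GrMod.Hom.lin k (GrMod.Hom.lin (unitX G n) g)))
    (total_map_π (C := SMod K V) (D := EMod K V) R₀ (adj i) p q n h)).trans ?_
  refine (congrArg (fun α => HomE.val (F.obj.X p) b (GrMod.Hom.lin ((R₀.map (adjX i p)).f q) α))
    (lin_unitX_π n p q h g)).trans ?_
  refine (HomE.val_R₀_map (adjX i p) (GrMod.Hom.lin (unitComp G n p q h) g) b).trans ?_
  refine (congrArg (GrMod.Hom.lin (adjX i p)) (val_unitComp h g b)).trans ?_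
  refine (GrMod.lin_apply_units_smul (adjX i p) _ _).trans ?_
  refine (congrArg (unitSign q • ·) (adjX_unitVal i (show n + -q = p by omega)
    (neg_neg q).symm (b • g))).trans ?_
  rw [smul_smul, Int.units_mul_self, one_smul ℤˣ]
  exact evalOne_smul (compR i n p q h) b g

/-- By `unit_adj` and `quasiIso_unit`, the image of `adj i` under `R` is a quasi-isomorphism, and
`R` reflects these. -/
lemma quasiIso_adj (hi : QuasiIso i) : QuasiIso (adj i).hom := by
  have := quasiIso_unit G
  have h := unit_adj i
  refine quasiIso_of_quasiIso_R (adj i) ?_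
  rw [← h] at hi
  exact (quasiIso_iff_comp_left ((unit K V).app G) ((R K V).map (adj i))).1 hi

end

end

section

open Pretriangulated

/-! ### The equivalence of derived categories -/

section Triangulated

variable {𝒞 𝒟 : Type*} [Category* 𝒞] [Category* 𝒟] [HasZeroObject 𝒞] [HasZeroObject 𝒟]
  [HasShift 𝒞 ℤ] [HasShift 𝒟 ℤ] [Preadditive 𝒞] [Preadditive 𝒟]
  [∀ n : ℤ, (CategoryTheory.shiftFunctor 𝒞 n).Additive]
  [∀ n : ℤ, (CategoryTheory.shiftFunctor 𝒟 n).Additive] [Pretriangulated 𝒞] [Pretriangulated 𝒟]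
  (R : 𝒞 ⥤ 𝒟)

/-- If `R f = 0` and `g` is the next morphism in a triangle on `f`, then `R g` has a retraction. By
fullness it is `R s` for some `s`; then `g ≫ s` is an isomorphism because its image is one, and `f ≫
g = 0` gives `f = 0`. -/
lemma faithful_of_full_of_reflectsIsomorphisms [R.CommShift ℤ] [R.IsTriangulated] [R.Full]
    [R.ReflectsIsomorphisms] : R.Faithful := by
  have : R.Additive := inferInstance
  have key {X Y : 𝒞} (f : X ⟶ Y) (hf : R.map f = 0) : f = 0 := by
    obtain ⟨Z, g, h, hT⟩ := distinguished_cocone_triangle f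
    obtain ⟨r, hr⟩ := Triangle.yoneda_exact₂ _ (R.map_distinguished _ hT) (𝟙 (R.obj Y))
      ((Category.comp_id _).trans hf)
    obtain ⟨s, rfl⟩ := R.map_surjective r
    have hs : R.map (g ≫ s) = 𝟙 _ := (R.map_comp g s).trans hr.symm
    have : IsIso (R.map (g ≫ s)) := by rw [hs]; infer_instance
    have : IsIso (g ≫ s) := isIso_of_reflects_iso _ R
    rw [← cancel_mono (g ≫ s), zero_comp]
    exact (Category.assoc f g s).symm.trans
      ((congrArg (· ≫ s) (comp_distTriang_mor_zero₁₂ _ hT)).trans zero_comp)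
  exact ⟨fun {X Y f f'} h => sub_eq_zero.1 (key _ (by rw [R.map_sub, h, sub_self]))⟩

/-- For fullness, replace the source and the target by objects in the image of `L`. By naturality of
`ε`, a morphism between their images under `R` is `R` of a morphism in the image of `L`. -/
lemma isEquivalence_of_essSurj [R.CommShift ℤ] [R.IsTriangulated] [R.ReflectsIsomorphisms]
    {L : 𝒟 ⥤ 𝒞} [L.EssSurj] (ε : L ⋙ R ≅ 𝟭 𝒟) : R.IsEquivalence := by
  have : R.Full := by
    refine ⟨fun {X Y} f => ?_⟩
    let a := L.objObjPreimageIso X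
    let b := L.objObjPreimageIso Y
    let g := L.map (ε.inv.app _ ≫ R.map a.hom ≫ f ≫ R.map b.inv ≫ ε.hom.app _)
    have hg : R.map g = R.map a.hom ≫ f ≫ R.map b.inv := by
      have h := ε.hom.naturality (ε.inv.app _ ≫ R.map a.hom ≫ f ≫ R.map b.inv ≫ ε.hom.app _)
      rw [← cancel_mono (ε.hom.app _)]
      refine h.trans ?_
      simp
    refine ⟨a.inv ≫ g ≫ b.hom, ?_⟩
    rw [R.map_comp, R.map_comp]
    refine (congrArg (fun t => R.map a.inv ≫ t ≫ R.map b.hom) hg).trans ?_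
    simp only [Category.assoc, ← R.map_comp, b.inv_hom_id, R.map_id, Category.comp_id]
    simp only [← Category.assoc, ← R.map_comp, a.inv_hom_id, R.map_id, Category.id_comp]
  have : R.Faithful := faithful_of_full_of_reflectsIsomorphisms R
  have : R.EssSurj := ⟨fun Y => ⟨L.obj Y, ⟨ε.app Y⟩⟩⟩
  exact { }

end Triangulated

/-! ### The equivalence obtained from a natural quasi-isomorphism -/

section

variable {C : Type*} [Category* C] [Abelian C] [HasDerivedCategory.{w} C]
  {D : Type*} [Category* D] [Abelian D] [HasDerivedCategory.{w'} D]
  {Φ : C ⥤ CochainComplex D ℤ} [Φ.Additive] {Ψ : D ⥤ CochainComplex C ℤ} [Ψ.Additive]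
  (hB : ∀ F, DerivedCategory.TStructure.t.bounded (DerivedCategory.Q.obj ((totalize Φ).obj F)))
  (hB' : ∀ F, DerivedCategory.TStructure.t.bounded (DerivedCategory.Q.obj ((totalize Ψ).obj F)))
  (hΦ : DegreewiseExact Φ) (hΨ : DegreewiseExact Ψ)
  (hb : ∀ G, bounded C ((totalize Ψ).obj G))
  (η : (bounded D).ι ⟶ (bounded C).lift (totalize Ψ) hb ⋙ totalize Φ)
  (hη : ∀ G, QuasiIso (η.app G))

/-- The functor `totalQ` takes values in the images of bounded complexes. -/
noncomputable def liftCompBoundedQ : (bounded C).lift (totalize Ψ) hb ⋙ boundedQ C ≅ totalQ Ψ hB' :=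
  NatIso.ofComponents (fun _ => Iso.refl _) fun _ =>
    (Category.comp_id _).trans (Category.id_comp _).symm

/-- A natural quasi-isomorphism is an isomorphism in the derived category. -/
noncomputable def boundedQIso : boundedQ D ≅ (bounded C).lift (totalize Ψ) hb ⋙ totalQ Φ hB :=
  NatIso.ofComponents (fun G =>
    (DerivedCategory.TStructure.t.bounded (C := DerivedCategory D)).fullyFaithfulι.preimageIso
      (@asIso (DerivedCategory D) _ _ _ (DerivedCategory.Q.map (η.app G))
        ((DerivedCategory.isIso_Q_map_iff_quasiIso D (η.app G)).2 (hη G)))) fun {G H} f => by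
    refine DerivedCategory.Bounded.ι.map_injective ?_
    change DerivedCategory.Q.map f.hom ≫ DerivedCategory.Q.map (η.app H) =
      DerivedCategory.Q.map (η.app G) ≫ DerivedCategory.Q.map
        ((totalize Φ).map (((bounded C).lift (totalize Ψ) hb).map f))
    rw [← Functor.map_comp, ← Functor.map_comp]
    exact congrArg _ (η.naturality f)

/-- The composition of the derived functors is isomorphic to the identity. -/
noncomputable def derivedCompDerived : derived hB' hΨ ⋙ derived hB hΦ ≅ 𝟭 _ :=
  letI : Localization.Lifting (boundedQ D) (quasiIsoB D)
    (boundedQ D ⋙ derived hB' hΨ ⋙ derived hB hΦ) (derived hB' hΨ ⋙ derived hB hΦ) := ⟨Iso.refl _⟩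
  Localization.liftNatIso (boundedQ D) (quasiIsoB D)
    (boundedQ D ⋙ derived hB' hΨ ⋙ derived hB hΦ) (boundedQ D) _ _
    ((Functor.associator _ _ _).symm ≪≫
      Functor.isoWhiskerRight (boundedQCompDerived hB' hΨ ≪≫ (liftCompBoundedQ hB' hb).symm) _ ≪≫
      Functor.associator _ _ _ ≪≫ Functor.isoWhiskerLeft _ (boundedQCompDerived hB hΦ) ≪≫
      (boundedQIso hB hb η hη).symm)

lemma derived_reflectsIsomorphisms
    (h : ∀ ⦃F G : BddCx C⦄ (f : F ⟶ G), QuasiIso ((totalize Φ).map f) → QuasiIso f.hom) :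
    (derived hB hΦ).ReflectsIsomorphisms where
  reflects {X Y} f hf := by
    obtain ⟨F, G, g, e₁, e₂, hg⟩ := exists_arrow_iso f
    have h₁ : (derived hB hΦ).map ((boundedQ C).map g) =
        (derived hB hΦ).map e₁.hom ≫ (derived hB hΦ).map f ≫ (derived hB hΦ).map e₂.inv := by
      rw [← Functor.map_comp, ← Functor.map_comp, ← reassoc_of% hg, e₂.hom_inv_id,
        Category.comp_id]
    have h₂ : IsIso ((boundedQ C ⋙ derived hB hΦ).map g) := by
      rw [Functor.comp_map, h₁]
      infer_instance
    have h₃ : IsIso ((totalQ Φ hB).map g) :=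
      ((NatIso.isIso_map_iff (boundedQCompDerived hB hΦ) g).1 h₂)
    have h₄ : QuasiIso ((totalize Φ).map g) :=
      (DerivedCategory.isIso_Q_map_iff_quasiIso D _).1
        (inferInstanceAs (IsIso (DerivedCategory.Bounded.ι.map ((totalQ Φ hB).map g))))
    have h₅ : IsIso ((boundedQ C).map g) := (isIso_boundedQ_map_iff g).2 (h g h₄)
    have h₆ : f = e₁.inv ≫ (boundedQ C).map g ≫ e₂.hom := by
      rw [hg, e₁.inv_hom_id_assoc]
    rw [h₆]
    infer_instance

lemma derived_essSurj
    (h : ∀ F, ∃ (G : BddCx D) (f : ((bounded C).lift (totalize Ψ) hb).obj G ⟶ F), QuasiIso f.hom) :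
    (derived hB' hΨ).EssSurj where
  mem_essImage X := by
    obtain ⟨G, f, hf⟩ := h ((boundedQ C).objPreimage X)
    have : IsIso ((boundedQ C).map f) := (isIso_boundedQ_map_iff f).2 hf
    exact ⟨(boundedQ D).obj G, ⟨(boundedQCompDerived hB' hΨ).app G ≪≫
      (liftCompBoundedQ hB' hb).symm.app G ≪≫ asIso ((boundedQ C).map f) ≪≫
      (boundedQ C).objObjPreimageIso X⟩⟩

include hΦ hΨ hη in
/-- A criterion for functors that are given by total complexes to induce an equivalence of
bounded derived categories. -/
lemma exists_equivalence
    (hB : ∀ F, DerivedCategory.TStructure.t.bounded (DerivedCategory.Q.obj ((totalize Φ).obj F)))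
    (hB' : ∀ F, DerivedCategory.TStructure.t.bounded (DerivedCategory.Q.obj ((totalize Ψ).obj F)))
    (h₁ : ∀ ⦃F G : BddCx C⦄ (f : F ⟶ G), QuasiIso ((totalize Φ).map f) → QuasiIso f.hom)
    (h₂ : ∀ F, ∃ (G : BddCx D) (f : ((bounded C).lift (totalize Ψ) hb).obj G ⟶ F),
      QuasiIso f.hom) :
    ∃ (e : DerivedCategory.Bounded C ≌ DerivedCategory.Bounded D) (_ : e.functor.CommShift ℤ),
      e.functor.IsTriangulated ∧
      Nonempty (boundedQ C ⋙ e.functor ⋙ DerivedCategory.Bounded.ι ≅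
        totalize Φ ⋙ DerivedCategory.Q) ∧
      Nonempty (boundedQ D ⋙ e.inverse ⋙ DerivedCategory.Bounded.ι ≅
        totalize Ψ ⋙ DerivedCategory.Q) := by
  have := derived_reflectsIsomorphisms hB hΦ h₁
  have := derived_essSurj hB' hΨ hb h₂
  let ε := derivedCompDerived hB hB' hΦ hΨ hb η hη
  have : (derived hB hΦ).IsEquivalence := isEquivalence_of_essSurj (derived hB hΦ) ε
  -- A one-sided inverse of an equivalence, up to isomorphism, is a quasi-inverse.
  let ε' : (derived hB hΦ).asEquivalence.inverse ≅ derived hB' hΨ :=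
    (Functor.leftUnitor _).symm ≪≫ Functor.isoWhiskerRight ε.symm _ ≪≫
      Functor.associator _ _ _ ≪≫ Functor.isoWhiskerLeft _ (derived hB hΦ).asEquivalence.unitIso.symm ≪≫
      Functor.rightUnitor _
  exact ⟨(derived hB hΦ).asEquivalence, (inferInstance : (derived hB hΦ).CommShift ℤ),
    (inferInstance : (derived hB hΦ).IsTriangulated),
    ⟨Functor.isoWhiskerRight (boundedQCompDerived hB hΦ) DerivedCategory.Bounded.ι⟩,
    ⟨Functor.isoWhiskerLeft _ (Functor.isoWhiskerRight ε' _) ≪≫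
      Functor.isoWhiskerRight (boundedQCompDerived hB' hΨ) DerivedCategory.Bounded.ι⟩⟩

end

section

variable {K : Type u} [Field K] {V : Type u} [AddCommGroup V] [Module K V] [FiniteDimensional K V]

/-- The complex `R(F)` is bounded below and exact above some degree `b`, so its truncation at `b` is
a bounded complex with a quasi-isomorphism to `R(F)`. Its adjoint is the required morphism. -/
lemma exists_quasiIso_LB (F : BddCx (SMod K V)) :
    ∃ (G : BddCx (EMod K V)) (f : (LB K V).obj G ⟶ F), QuasiIso f.hom := by
  obtain ⟨a, ha⟩ := totalize_isStrictlyGE (C := SMod K V) (D := EMod K V) R₀_isStrictlyGE F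
  obtain ⟨b, hb⟩ := totalize_exactAt (C := SMod K V) (D := EMod K V) degreewiseExact_R₀ R₀_exactAt F
  have hle : ((R K V).obj F).IsLE b := (CochainComplex.isLE_iff _ _).2 hb
  have hge : ((R K V).obj F).IsStrictlyGE a := ha
  let G : BddCx (EMod K V) := ⟨((R K V).obj F).truncLE b, a, b, inferInstance, inferInstance⟩
  exact ⟨G, adj (((R K V).obj F).ιTruncLE b), quasiIso_adj (G := G) _
    ((((R K V).obj F).quasiIso_ιTruncLE_iff b).2 hle)⟩

end

end

end BGG

theorem corollary2p7 {K : Type u} [Field K] {V : Type u} [AddCommGroup V] [Module K V]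
    [FiniteDimensional K V]
    [HasDerivedCategory.{w} (BGG.SMod K V)] [HasDerivedCategory.{w'} (BGG.EMod K V)] :
    ∃ (Φ : DerivedCategory.Bounded (BGG.SMod K V) ≌ DerivedCategory.Bounded (BGG.EMod K V))
      (_ : Φ.functor.CommShift ℤ),
      Φ.functor.IsTriangulated ∧
      Nonempty (BGG.boundedQ (BGG.SMod K V) ⋙ Φ.functor ⋙ DerivedCategory.Bounded.ι ≅
        BGG.R K V ⋙ DerivedCategory.Q (C := BGG.EMod K V)) ∧
      Nonempty (BGG.boundedQ (BGG.EMod K V) ⋙ Φ.inverse ⋙ DerivedCategory.Bounded.ι ≅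
        BGG.L K V ⋙ DerivedCategory.Q (C := BGG.SMod K V)) := by
  exact BGG.exists_equivalence (C := BGG.SMod K V) (D := BGG.EMod K V)
    BGG.degreewiseExact_R₀ BGG.degreewiseExact_L₀ BGG.bounded_L_obj (BGG.unit K V)
    BGG.quasiIso_unit BGG.bounded_R BGG.bounded_L
    (fun _ _ f hf => BGG.quasiIso_of_quasiIso_R f hf) BGG.exists_quasiIso_LB
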